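/- Let $\mathbb T=\mathbb R/\mathbb Z$ be the circle with its wrap-around distance and normalized Lebesgue measure $\mathrm dt$. For a finite complex Borel measure $\mu$ on $\mathbb T$ let $\|\mu\|_{TV}=|\mu|(\mathbb T)$ be its total-variation norm, for a function $K$ on $\mathbb T$ let $(K*\mu)(t)=\int_{\mathbb T}K(t-\tau)\,\mu(\mathrm d\tau)$, and let $\|g\|_{L_1}=\int_{\mathbb T}|g(t)|\,\mathrm dt$. For integers $f_{\mathrm{hi}}>f_{\mathrm{lo}}\ge 1$ put $\lambda_{\mathrm{lo}}=1/f_{\mathrm{lo}}$, $\mathrm{SRF}=f_{\mathrm{hi}}/f_{\mathrm{lo}}$, let $Q_{\mathrm{lo}}\mu=K_{\mathrm{lo}}*\mu$, where $K_{\mathrm{lo}}(t)=\sum_{k=-f_{\mathrm{lo}}}^{f_{\mathrm{lo}}}e^{2\pi i kt}$ is the Dirichlet kernel, and let $$K_{\mathrm{hi}}(t)=\frac1{f_{\mathrm{hi}}+1}\sum_{k=-f_{\mathrm{hi}}}^{f_{\mathrm{hi}}}(f_{\mathrm{hi}}+1-|k|)\,e^{2\pi i kt}$$ be the Fejér kernel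 with cut-off frequency $f_{\mathrm{hi}}$. There is a numerical constant $C_0>0$ such that the following holds for all integers $f_{\mathrm{hi}}>f_{\mathrm{lo}}\ge1$. Let $x=\sum_{t_j\in T}a_j\delta_{t_j}$ with $T\subset\mathbb T$ finite and $a_j\in\mathbb C\setminus\{0\}$, and assume that the support $T$ has minimum separation $$\Delta(T)=\inf_{t,t'\in T,\ t\ne t'}|t-t'|\ \ge\ 2\lambda_{\mathrm{lo}}=\frac{2}{f_{\mathrm{lo}}}$$ (with $\Delta(T)=\infty$ if $T$ has at most one point). Let $\delta\ge0$ and $y=Q_{\mathrm{lo}}x+z$, where $z\in L_1(\mathbb T)$ satisfies $\|z\|_{L_1}\le\delta$. Then every solution $x_{\mathrm{est}}$ of $$\min_{\tilde x}\ \|\tilde x\|_{TV}\quad\text{subject to}\quad \|Q_{\mathrm{lo}}\tilde x-y\|_{L_1}\le\delta,$$ where $\tilde x$ ranges over all finite complex Borel measures on $\mathbb T$, and more generally every feasible $x_{\mathrm{est}}$ with $\|x_{\mathrm{est}}\|_{TV}\le\|x\|_{TV}$, satisfies $$\|K_{\mathrm{hi}}*(x_{\mathrm{est}}-x)\|_{L_1}\le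 C_0\,\mathrm{SRF}^2\,\delta .$$ -/

import Mathlib

open MeasureTheory

noncomputable section

namespace SuperRes

/-- The complex measure `∑_{t ∈ T} a t • δ_t` on the circle `ℝ/ℤ`. -/
def spikes (T : Finset UnitAddCircle) (a : UnitAddCircle → ℂ) : ComplexMeasure UnitAddCircle :=
  ∑ t ∈ T, VectorMeasure.dirac t (a t)

/-- The total-variation norm `|μ|(𝕋)` of a complex measure. -/
def tvNorm (μ : ComplexMeasure UnitAddCircle) : ENNReal :=
  μ.variation Set.univ

/-- The `L¹` norm `∫_𝕋 |g(t)| dt`, for the Lebesgue (Haar probability) measure of the circle. -/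
def l1Norm (g : UnitAddCircle → ℂ) : ENNReal :=
  eLpNorm g 1 volume

/-- The convolution `(K * μ)(t) = ∫ K(t - τ) μ(dτ)` of a kernel with a complex measure. -/
def conv (K : UnitAddCircle → ℂ) (μ : ComplexMeasure UnitAddCircle) (t : UnitAddCircle) : ℂ :=
  VectorMeasure.integral μ (fun τ => K (t - τ)) (ContinuousLinearMap.mul ℝ ℂ)

/-- The periodic Dirichlet kernel `∑_{|k| ≤ f} e^{2πikt}`. -/
def dirichletKernel (f : ℕ) (t : UnitAddCircle) : ℂ :=
  ∑ k ∈ Finset.Icc (-(f : ℤ)) (f : ℤ), fourier k t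

/-- The Fejér kernel `(f + 1)⁻¹ ∑_{|k| ≤ f} (f + 1 - |k|) e^{2πikt}`. -/
def fejerKernel (f : ℕ) (t : UnitAddCircle) : ℂ :=
  (1 / ((f : ℂ) + 1)) *
    ∑ k ∈ Finset.Icc (-(f : ℤ)) (f : ℤ), ((f : ℂ) + 1 - ((|k| : ℤ) : ℂ)) * fourier k t

/-- The low-pass filter with cut-off frequency `f`: convolution with the Dirichlet kernel. -/
def lowPass (f : ℕ) (μ : ComplexMeasure UnitAddCircle) : UnitAddCircle → ℂ :=
  conv (dirichletKernel f) μ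

/-- The complex measures `μ` with `‖Q μ - y‖_{L¹} ≤ δ`, where `Q` is the low-pass filter. -/
def feasibleSet (f : ℕ) (y : UnitAddCircle → ℂ) (δ : ℝ) : Set (ComplexMeasure UnitAddCircle) :=
  {μ | l1Norm (fun t => lowPass f μ t - y t) ≤ ENNReal.ofReal δ}

/-- `μ` minimizes the total-variation norm over the feasible set. -/
def IsSolution (f : ℕ) (y : UnitAddCircle → ℂ) (δ : ℝ) (μ : ComplexMeasure UnitAddCircle) : Prop :=
  μ ∈ feasibleSet f y δ ∧ IsMinOn tvNorm (feasibleSet f y δ) μ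

end SuperRes

end

/-! Write h for the difference between the estimate and x, f and F for the two cut-offs, and R =
F/f. The triangle inequality gives ‖Q h‖₁ ≤ 2δ, Q being the low-pass filter. Minimality of the total
variation gives the cone condition |h|(Tᶜ) ≤ ∑ |h{t}| over t in T (`variation_compl_le_sum`).

A dual certificate (`exists_dual_certificate`) is a trigonometric polynomial q of degree f taking
the conjugate phases of h on T, with |q| ≤ 1 - c·min(1, f² dist(t, T)²). The cone condition turns
this into ∫ (1 - |q|) d|h| ≤ |∫ q dh| (`integral_one_sub_norm_le`). A polynomial of degree f only
sees the filtered measure, so the right side is at most ‖Q h‖₁ (`norm_cint_trigSum_le`).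

By duality the L¹ norm of the Fejér smoothing equals ∫ G dh for some G of degree F with |G| ≤ 1
(`exists_trigSum_cint_eq_integral_norm`). Bernstein's inequality bounds G' by a multiple of F and
G'' by a multiple of F². Hermite interpolation of G and G' on T (`exists_hermite`) gives p of degree
f with |p| ≤ C·R. As p and G agree to first order on T, |G - p| ≤ C·R²·min(1, f² dist²) ≤ C·R²·(1 -
|q|) (`exists_lowDegree_approx`). Then ∫ G dh = ∫ (G - p) dh + ∫ p dh, and both terms are at most
C·R²·‖Q h‖₁.

Both q and p are sums of translates of a Jackson kernel (for values) and an odd companion (for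
derivatives). For 1/N-separated nodes the interpolation system is a small perturbation of the
identity; the margins are numerical and need N ≥ 10000. To reach every f ≥ 2, the nodes are pulled
back under multiplication by m on the circle, the problem is solved there at degree at most mf, and
the result is averaged over the m preimages, which brings the degree down to f. For f = 1 the
separation leaves at most one node. -/

noncomputable section

namespace SuperRes

/-! ### Trigonometric polynomials and the squared geometric sum. -/

section

open Complex Finset

/-- The character `t ↦ e^{2πikt}` of `ℝ`. -/
def expo (k : ℤ) (t : ℝ) : ℂ := Complex.exp (2 * Real.pi * I * k * t)

/-- Trigonometric polynomials of degree at most `n` and period `1`. -/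
def TrigPoly (n : ℕ) : Submodule ℂ (ℝ → ℂ) :=
  Submodule.span ℂ (expo '' {k | |k| ≤ (n : ℤ)})

lemma expo_mem {n : ℕ} {k : ℤ} (hk : |k| ≤ (n : ℤ)) : expo k ∈ TrigPoly n :=
  Submodule.subset_span ⟨k, hk, rfl⟩

lemma expo_mul (k l : ℤ) : expo k * expo l = expo (k + l) := by
  ext t; simp only [expo, Pi.mul_apply, ← Complex.exp_add]; congr 1; push_cast; ring

lemma expo_mul_apply (k l : ℤ) (t : ℝ) : expo k t * expo l t = expo (k + l) t :=
  congrFun (expo_mul k l) t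

lemma expo_zero (t : ℝ) : expo 0 t = 1 := by simp [expo]

lemma expo_at_zero (k : ℤ) : expo k 0 = 1 := by simp [expo]

lemma expo_add (k : ℤ) (s t : ℝ) : expo k (s + t) = expo k s * expo k t := by
  simp only [expo, ← Complex.exp_add]; congr 1; push_cast; ring

lemma expo_int (k n : ℤ) : expo k n = 1 := by
  have := Complex.exp_int_mul_two_pi_mul_I (k * n)
  simp only [expo]; rw [← this]; congr 1; push_cast; ring

lemma norm_expo (k : ℤ) (t : ℝ) : ‖expo k t‖ = 1 := by
  have : (2 * Real.pi * I * k * t : ℂ) = ((2 * Real.pi * k * t : ℝ) : ℂ) * I := by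
    push_cast; ring
  rw [expo, this, Complex.norm_exp_ofReal_mul_I]

lemma conj_expo (k : ℤ) (t : ℝ) : (starRingEnd ℂ) (expo k t) = expo (-k) t := by
  simp only [expo, ← Complex.exp_conj]; congr 1; simp [map_ofNat]

lemma hasDerivAt_expo (k : ℤ) (t : ℝ) :
    HasDerivAt (expo k) (2 * Real.pi * I * k * expo k t) t := by
  have h : HasDerivAt (fun t : ℝ => (2 * Real.pi * I * k * t : ℂ)) (2 * Real.pi * I * k) t := by
    simpa using (Complex.ofRealCLM.hasDerivAt (x := t)).const_mul (2 * Real.pi * I * k : ℂ)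
  exact h.cexp.congr_deriv (by simp only [expo]; ring)

lemma continuous_expo (k : ℤ) : Continuous (expo k) := by
  unfold expo; fun_prop

lemma TrigPoly_mono {m n : ℕ} (h : m ≤ n) : TrigPoly m ≤ TrigPoly n :=
  Submodule.span_mono (Set.image_mono fun k hk => by
    simp only [Set.mem_ofPred_eq] at *; omega)

lemma TrigPoly_mul {m n : ℕ} {P Q : ℝ → ℂ} (hP : P ∈ TrigPoly m) (hQ : Q ∈ TrigPoly n) :
    P * Q ∈ TrigPoly (m + n) := by
  have := Submodule.mul_mem_mul hP hQ
  rw [TrigPoly, TrigPoly, Submodule.span_mul_span] at this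
  refine Submodule.span_mono ?_ this
  rintro _ ⟨_, ⟨k, hk, rfl⟩, _, ⟨l, hl, rfl⟩, rfl⟩
  refine ⟨k + l, ?_, (expo_mul k l).symm⟩
  simp only [Set.mem_ofPred_eq] at *
  push_cast; exact (abs_add_le k l).trans (add_le_add hk hl)

lemma TrigPoly_comp_sub {n : ℕ} {P : ℝ → ℂ} (hP : P ∈ TrigPoly n) (a : ℝ) :
    (fun t => P (t - a)) ∈ TrigPoly n := by
  induction hP using Submodule.span_induction with
  | mem x h =>
    obtain ⟨k, hk, rfl⟩ := h
    have : (fun t => expo k (t - a)) = expo k (-a) • expo k := by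
      ext t; simp [sub_eq_add_neg, expo_add, mul_comm]
    rw [this]; exact Submodule.smul_mem _ _ (expo_mem hk)
  | zero => exact Submodule.zero_mem _
  | add x y _ _ hx hy => exact Submodule.add_mem _ hx hy
  | smul c x _ hx => exact Submodule.smul_mem _ c hx

lemma TrigPoly_hasDerivAt {n : ℕ} {P : ℝ → ℂ} (hP : P ∈ TrigPoly n) :
    ∃ P' ∈ TrigPoly n, ∀ t, HasDerivAt P (P' t) t := by
  induction hP using Submodule.span_induction with
  | mem x h =>
    obtain ⟨k, hk, rfl⟩ := h
    exact ⟨(2 * Real.pi * I * k : ℂ) • expo k, Submodule.smul_mem _ _ (expo_mem hk),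
      fun t => hasDerivAt_expo k t⟩
  | zero => exact ⟨0, Submodule.zero_mem _, fun t => by simp⟩
  | add x y _ _ hx hy =>
    obtain ⟨x', hx', hx⟩ := hx
    obtain ⟨y', hy', hy⟩ := hy
    exact ⟨x' + y', Submodule.add_mem _ hx' hy', fun t => (hx t).add (hy t)⟩
  | smul c x _ hx =>
    obtain ⟨x', hx', hx⟩ := hx
    exact ⟨c • x', Submodule.smul_mem _ _ hx', fun t => (hx t).const_smul c⟩

lemma TrigPoly_periodic {n : ℕ} {P : ℝ → ℂ} (hP : P ∈ TrigPoly n) (t : ℝ) (m : ℤ) :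
    P (t + m) = P t := by
  induction hP using Submodule.span_induction with
  | mem x h =>
    obtain ⟨k, hk, rfl⟩ := h
    rw [expo_add, expo_int, mul_one]
  | zero => rfl
  | add x y _ _ hx hy => simp [hx, hy]
  | smul c x _ hx => simp [hx]

lemma TrigPoly_continuous {n : ℕ} {P : ℝ → ℂ} (hP : P ∈ TrigPoly n) : Continuous P := by
  obtain ⟨P', -, h⟩ := TrigPoly_hasDerivAt hP
  exact continuous_iff_continuousAt.2 fun t => (h t).continuousAt

lemma TrigPoly_coeff {n : ℕ} {P : ℝ → ℂ} (hP : P ∈ TrigPoly n) :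
    ∃ c : ℤ → ℂ, ∀ t, P t = ∑ k ∈ Icc (-(n : ℤ)) n, c k * expo k t := by
  induction hP using Submodule.span_induction with
  | mem x h =>
    obtain ⟨k, hk, rfl⟩ := h
    refine ⟨fun l => if l = k then 1 else 0, fun t => ?_⟩
    simp only [ite_mul, one_mul, zero_mul]
    rw [Finset.sum_ite_eq', if_pos]
    exact mem_Icc.2 (abs_le.1 hk)
  | zero => exact ⟨0, fun t => by simp⟩
  | add x y _ _ hx hy =>
    obtain ⟨c, hc⟩ := hx
    obtain ⟨d, hd⟩ := hy
    exact ⟨c + d, fun t => by simp [hc, hd, add_mul, sum_add_distrib]⟩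
  | smul a x _ hx =>
    obtain ⟨c, hc⟩ := hx
    exact ⟨a • c, fun t => by simp [hc, mul_sum, mul_assoc]⟩

lemma TrigPoly_of_coeff (n : ℕ) (c : ℤ → ℂ) :
    (fun t => ∑ k ∈ Icc (-(n : ℤ)) n, c k * expo k t) ∈ TrigPoly n := by
  have : (fun t => ∑ k ∈ Icc (-(n : ℤ)) n, c k * expo k t) =
      ∑ k ∈ Icc (-(n : ℤ)) n, c k • expo k := by
    ext t; simp
  rw [this]
  exact Submodule.sum_mem _ fun k hk =>
    Submodule.smul_mem _ _ (expo_mem (abs_le.2 (mem_Icc.1 hk)))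

lemma sum_expo_div {m : ℕ} (hm : 0 < m) (k : ℤ) :
    ∑ j ∈ range m, expo k ((j : ℝ) / m) = if (m : ℤ) ∣ k then (m : ℂ) else 0 := by
  have hm' : (m : ℝ) ≠ 0 := by positivity
  have hpow : ∀ j : ℕ, expo k ((j : ℝ) / m) = (expo k (1 / m)) ^ j := by
    intro j
    simp only [expo, ← Complex.exp_nat_mul]; congr 1; push_cast; ring
  simp only [hpow]
  split_ifs with h
  · obtain ⟨l, rfl⟩ := h
    have : expo (m * l) (1 / m) = 1 := by
      have h1 := expo_int l 1
      rw [← h1]; simp only [expo]; congr 1; push_cast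
      have : (m : ℂ) ≠ 0 := by exact_mod_cast hm.ne'
      field_simp
    simp only [this, one_pow, sum_const, card_range, nsmul_eq_mul, mul_one]
  · have hne : expo k (1 / m) ≠ 1 := by
      intro h1
      rw [expo, Complex.exp_eq_one_iff] at h1
      obtain ⟨n, hn⟩ := h1
      apply h
      refine ⟨n, ?_⟩
      have hmC : (m : ℂ) ≠ 0 := by exact_mod_cast hm.ne'
      have hpi : (Real.pi : ℂ) ≠ 0 := by exact_mod_cast Real.pi_ne_zero
      push_cast at hn
      field_simp at hn
      have h2 : (k : ℂ) = m * n := by simpa using hn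
      exact_mod_cast h2
    rw [geom_sum_eq hne, ← hpow, div_self hm', show ((1:ℝ)) = ((1:ℤ):ℝ) by simp, expo_int]
    simp

/-- Averaging a trigonometric polynomial of degree `m n` over the `m` preimages of a point under
multiplication by `m` gives one of degree `n`. -/
lemma TrigPoly_average {m n : ℕ} (hm : 0 < m) {P : ℝ → ℂ} (hP : P ∈ TrigPoly (m * n)) :
    (fun t => (1 / (m : ℂ)) * ∑ j ∈ range m, P ((t + j) / m)) ∈ TrigPoly n := by
  have hm' : (m : ℂ) ≠ 0 := by exact_mod_cast hm.ne'
  induction hP using Submodule.span_induction with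
  | mem x h =>
    obtain ⟨k, hk, rfl⟩ := h
    -- Only the frequencies divisible by `m` survive the averaging, and each is divided by `m`.
    have h1 : ∀ t : ℝ, (1 / (m : ℂ)) * ∑ j ∈ range m, expo k ((t + j) / m) =
        if (m : ℤ) ∣ k then expo k (t / m) else 0 := by
      intro t
      simp only [add_div, expo_add, ← mul_sum, sum_expo_div hm]
      split_ifs
      · field_simp
      · simp
    simp only [h1]
    split_ifs with hd
    · obtain ⟨l, rfl⟩ := hd
      have : (fun t : ℝ => expo (m * l) (t / m)) = expo l := by
        ext t; simp only [expo]; congr 1; push_cast; field_simp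
      rw [this]
      apply expo_mem
      simp only [Set.mem_ofPred_eq, abs_mul, Nat.abs_cast] at hk
      push_cast at hk
      exact le_of_mul_le_mul_left hk (by exact_mod_cast hm)
    · exact Submodule.zero_mem _
  | zero => convert Submodule.zero_mem _ using 1; ext; simp
  | add x y _ _ hx hy =>
    convert Submodule.add_mem _ hx hy using 1
    ext t; simp [sum_add_distrib, mul_add]
  | smul c x _ hx =>
    convert Submodule.smul_mem _ c hx using 1
    ext t; simp only [Pi.smul_apply, smul_eq_mul, ← mul_sum]; ring

/-! ### The Fejér kernel -/

/-- Exactly n - |k| pairs (a, b) have difference k. The induction adds one row, one column and the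
corner, which together meet each k in [-n, n] once. -/
lemma sum_range_sub_eq (φ : ℤ → ℂ) (n : ℕ) :
    ∑ a ∈ range n, ∑ b ∈ range n, φ ((a : ℤ) - b) =
      ∑ k ∈ Icc (-(n : ℤ)) n, ((n : ℂ) - ((|k| : ℤ) : ℂ)) * φ k := by
  induction n with
  | zero => simp
  | succ n ih =>
    have hI : Icc (-((n + 1 : ℕ) : ℤ)) ((n + 1 : ℕ) : ℤ) =
        insert (-((n : ℤ) + 1)) (insert ((n : ℤ) + 1) (Icc (-(n : ℤ)) n)) := by
      ext k; simp only [mem_Icc, mem_insert]; push_cast; omega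
    have hone : ∑ a ∈ range n, φ ((a : ℤ) - n) + ∑ b ∈ range n, φ ((n : ℤ) - b) + φ 0 =
        ∑ k ∈ Icc (-(n : ℤ)) n, φ k := by
      have hI' : Icc (-(n : ℤ)) n = (((range n).image fun a : ℕ => (a : ℤ) - n) ∪
          ((range n).image fun a : ℕ => (n : ℤ) - a)) ∪ {0} := by
        ext k
        simp only [mem_Icc, mem_union, mem_image, mem_range, mem_singleton]
        constructor
        · rintro ⟨h1, h2⟩
          rcases lt_trichotomy k 0 with h | h | h
          · exact Or.inl (Or.inl ⟨(k + n).toNat, by omega, by omega⟩)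
          · exact Or.inr h
          · exact Or.inl (Or.inr ⟨(n - k).toNat, by omega, by omega⟩)
        · rintro ((⟨a, h1, h2⟩ | ⟨a, h1, h2⟩) | h) <;> omega
      rw [hI', sum_union, sum_union, sum_image, sum_image, sum_singleton]
      · intro a _ b _ h; simp only at h; omega
      · intro a _ b _ h; simp only at h; omega
      · rw [disjoint_left]; intro k h1 h2
        simp only [mem_image, mem_range] at h1 h2
        obtain ⟨a, h1, h3⟩ := h1
        obtain ⟨b, h2, h4⟩ := h2
        omega
      · rw [disjoint_left]; intro k h1 h2
        simp only [mem_union, mem_image, mem_range, mem_singleton] at h1 h2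
        rcases h1 with ⟨a, h1, h3⟩ | ⟨a, h1, h3⟩ <;> omega
    have hz : ∀ k : ℤ, |k| = n + 1 → ((((n + 1 : ℕ) : ℂ)) - ((|k| : ℤ) : ℂ)) * φ k = 0 := by
      intro k hk; rw [hk]; push_cast; ring
    rw [hI, sum_insert, sum_insert, hz _ (by rw [abs_neg]; exact abs_of_nonneg (by positivity)),
      hz _ (abs_of_nonneg (by positivity))]
    · rw [sum_range_succ]
      simp only [sum_range_succ _ n]
      rw [sum_add_distrib, ih, sub_self]
      have : ∀ k : ℤ, (((n + 1 : ℕ) : ℂ) - ((|k| : ℤ) : ℂ)) * φ k =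
          ((n : ℂ) - ((|k| : ℤ) : ℂ)) * φ k + φ k := by
        intro k; push_cast; ring
      simp only [this, sum_add_distrib, ← hone]
      ring
    · simp
    · simp only [mem_insert, mem_Icc]; omega

/-- The modulus squared of the geometric sum of the first `n` characters. -/
def geomSq (n : ℕ) (t : ℝ) : ℝ := ‖∑ k ∈ range n, expo k t‖ ^ 2

lemma geomSq_eq (n : ℕ) (t : ℝ) :
    (geomSq n t : ℂ) = ∑ a ∈ range n, ∑ b ∈ range n, expo ((a : ℤ) - b) t := by
  rw [geomSq]
  push_cast
  rw [← Complex.mul_conj', map_sum, sum_mul_sum]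
  simp only [conj_expo, expo_mul_apply, sub_eq_add_neg]

lemma geomSq_mem (n : ℕ) : (fun t => (geomSq (n + 1) t : ℂ)) ∈ TrigPoly n := by
  have : (fun t => (geomSq (n + 1) t : ℂ)) =
      ∑ a ∈ range (n + 1), ∑ b ∈ range (n + 1), expo ((a : ℤ) - b) := by
    ext t; simp [geomSq_eq]
  rw [this]
  refine Submodule.sum_mem _ fun a ha => Submodule.sum_mem _ fun b hb => expo_mem ?_
  rw [mem_range] at ha hb
  rw [abs_le]; omega

lemma geomSq_nonneg (n : ℕ) (t : ℝ) : 0 ≤ geomSq n t := by unfold geomSq; positivity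

lemma geomSq_le (n : ℕ) (t : ℝ) : geomSq n t ≤ (n : ℝ) ^ 2 := by
  unfold geomSq
  gcongr
  refine (norm_sum_le _ _).trans ?_
  simp [norm_expo]

lemma geomSq_zero (n : ℕ) : geomSq n 0 = (n : ℝ) ^ 2 := by
  simp [geomSq, expo_at_zero]

lemma norm_one_sub_expo_sq (k : ℤ) (t : ℝ) :
    ‖1 - expo k t‖ ^ 2 = 4 * Real.sin (Real.pi * k * t) ^ 2 := by
  have h1 : expo k t = Complex.exp (((2 * Real.pi * k * t : ℝ) : ℂ) * I) := by
    rw [expo]; congr 1; push_cast; ring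
  rw [h1, Complex.exp_mul_I, ← Complex.ofReal_cos, ← Complex.ofReal_sin, Complex.sq_norm,
    Complex.normSq_apply]
  simp only [sub_re, one_re, add_re, ofReal_re, mul_re, I_re, mul_zero, ofReal_im, I_im, mul_one,
    sub_im, one_im, add_im, mul_im, zero_sub, sub_zero, add_zero, zero_add, mul_neg]
  have h2 : 2 * Real.pi * k * t = 2 * (Real.pi * k * t) := by ring
  rw [h2, Real.cos_two_mul, Real.sin_two_mul]
  have := Real.sin_sq_add_cos_sq (Real.pi * k * t)
  generalize Real.sin (Real.pi * k * t) = s at *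
  generalize Real.cos (Real.pi * k * t) = c at *
  have hc : c ^ 2 = 1 - s ^ 2 := by linarith
  linear_combination (4 * c ^ 2 - 4) * this

/-- Summing the geometric series. The product form also covers the zeros of sin(πt), where the
quotient is meaningless. -/
lemma geomSq_mul_sin (n : ℕ) (t : ℝ) :
    geomSq n t * Real.sin (Real.pi * t) ^ 2 = Real.sin (Real.pi * n * t) ^ 2 := by
  have h := norm_one_sub_expo_sq 1 t
  have hn := norm_one_sub_expo_sq n t
  have hp : ∀ k : ℕ, expo k t = expo 1 t ^ k := by
    intro k; simp only [expo, ← Complex.exp_nat_mul]; congr 1; push_cast; ring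
  have hg : (∑ k ∈ range n, expo k t) * (1 - expo 1 t) = 1 - expo n t := by
    simp only [hp]; exact geom_sum_mul_neg _ _
  have : geomSq n t * ‖1 - expo 1 t‖ ^ 2 = ‖1 - expo n t‖ ^ 2 := by
    rw [geomSq, ← mul_pow, ← norm_mul, hg]
  rw [h, hn] at this
  push_cast at this
  simp only [mul_one] at this
  linarith

end

/-! ### Bernstein's inequality from the Fejér kernel. -/

section

open Complex Finset

lemma integral_expo (k : ℤ) : ∫ τ in (0 : ℝ)..1, expo k τ = if k = 0 then 1 else 0 := by
  split_ifs with h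
  · subst h; simp [expo_zero]
  · have hc : (2 * Real.pi * I * k : ℂ) ≠ 0 := by
      have : (k : ℂ) ≠ 0 := by exact_mod_cast h
      simp [Real.pi_ne_zero, this]
    have hd : ∀ t ∈ Set.uIcc (0 : ℝ) 1,
        HasDerivAt (fun t => expo k t / (2 * Real.pi * I * k)) (expo k t) t := by
      intro t _
      have := (hasDerivAt_expo k t).div_const (2 * Real.pi * I * k : ℂ)
      rwa [mul_div_cancel_left₀ _ hc] at this
    rw [intervalIntegral.integral_eq_sub_of_hasDerivAt hd
      ((continuous_expo k).intervalIntegrable _ _)]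
    have h1 : expo k 1 = 1 := by simpa using expo_int k 1
    rw [h1, expo_at_zero, sub_self]

lemma geomSq_eq_sum (n : ℕ) (t : ℝ) :
    (geomSq n t : ℂ) = ∑ k ∈ Icc (-(n : ℤ)) n, ((n : ℂ) - ((|k| : ℤ) : ℂ)) * expo k t := by
  rw [geomSq_eq, sum_range_sub_eq (fun k => expo k t)]

lemma continuous_geomSq (n : ℕ) : Continuous (geomSq n) := by
  unfold geomSq
  have := continuous_expo
  fun_prop

lemma integral_expo_mul_geomSq (n : ℕ) (l : ℤ) :
    ∫ τ in (0 : ℝ)..1, expo l τ * (geomSq n τ : ℂ) =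
      if |l| ≤ (n : ℤ) then (n : ℂ) - ((|l| : ℤ) : ℂ) else 0 := by
  have h1 : ∀ τ : ℝ, expo l τ * (geomSq n τ : ℂ) =
      ∑ k ∈ Icc (-(n : ℤ)) n, ((n : ℂ) - ((|k| : ℤ) : ℂ)) * expo (l + k) τ := by
    intro τ
    rw [geomSq_eq_sum, mul_sum]
    refine sum_congr rfl fun k _ => ?_
    rw [← expo_mul_apply]; ring
  simp only [h1]
  rw [intervalIntegral.integral_finsetSum fun k _ =>
    ((continuous_expo _).const_mul _).intervalIntegrable _ _]
  simp only [intervalIntegral.integral_const_mul, integral_expo]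
  have h2 : ∀ k : ℤ, ((n : ℂ) - ((|k| : ℤ) : ℂ)) * (if l + k = 0 then (1 : ℂ) else 0) =
      if k = -l then (n : ℂ) - ((|k| : ℤ) : ℂ) else 0 := by
    intro k
    by_cases h : k = -l
    · subst h; simp
    · rw [if_neg h, if_neg (by omega), mul_zero]
  simp only [h2, sum_ite_eq', mem_Icc, abs_neg]
  congr 1
  rw [abs_le]
  exact propext ⟨fun h => by omega, fun h => by omega⟩

lemma integral_geomSq (n : ℕ) : ∫ τ in (0 : ℝ)..1, geomSq n τ = n := by
  have h := integral_expo_mul_geomSq n 0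
  simp only [expo_zero, one_mul, abs_zero, Nat.cast_nonneg, if_true, Int.cast_zero, sub_zero] at h
  rw [intervalIntegral.integral_ofReal] at h
  exact_mod_cast h

lemma sin_eq_expo (n : ℕ) (t : ℝ) :
    (Real.sin (2 * Real.pi * n * t) : ℂ) = (expo n t - expo (-n) t) / (2 * I) := by
  rw [Complex.ofReal_sin, Complex.sin]
  have h1 : expo n t = Complex.exp (((2 * Real.pi * n * t : ℝ) : ℂ) * I) := by
    rw [expo]; congr 1; push_cast; ring
  have h2 : expo (-n) t = Complex.exp (-((2 * Real.pi * n * t : ℝ) : ℂ) * I) := by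
    rw [expo]; congr 1; push_cast; ring
  rw [h1, h2]
  have : (I : ℂ) ≠ 0 := I_ne_zero
  field_simp
  rw [I_sq]; ring

/-- Multiplying the Fejér kernel by sin(2πnτ) replaces its hat of coefficients by a difference of
two hats centred at ±n, which is linear in k on [-n, n]. Convolution with it therefore
differentiates polynomials of degree n, up to a constant, and its L¹ norm is at most n. -/
lemma integral_expo_mul_geomSq_mul_sin {n : ℕ} {k : ℤ} (hk : |k| ≤ (n : ℤ)) (t : ℝ) :
    ∫ τ in (0 : ℝ)..1, expo k (t - τ) * ((geomSq n τ * Real.sin (2 * Real.pi * n * τ) : ℝ) : ℂ) =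
      (k / (2 * I)) * expo k t := by
  have h1 : ∀ τ : ℝ, expo k (t - τ) * ((geomSq n τ * Real.sin (2 * Real.pi * n * τ) : ℝ) : ℂ) =
      (expo k t / (2 * I)) * (expo (-k + n) τ * (geomSq n τ : ℂ)) -
      (expo k t / (2 * I)) * (expo (-k + -n) τ * (geomSq n τ : ℂ)) := by
    intro τ
    have : expo k (-τ) = expo (-k) τ := by simp only [expo]; congr 1; push_cast; ring
    rw [sub_eq_add_neg, expo_add, this]
    push_cast
    have := sin_eq_expo n τ
    push_cast at this
    rw [this, ← expo_mul_apply, ← expo_mul_apply]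
    ring
  have hc : ∀ l : ℤ, Continuous fun τ : ℝ => (expo k t / (2 * I)) * (expo l τ * (geomSq n τ : ℂ)) := by
    intro l
    have := continuous_expo l
    have := continuous_geomSq n
    fun_prop
  simp only [h1]
  rw [intervalIntegral.integral_sub ((hc _).intervalIntegrable _ _)
    ((hc _).intervalIntegrable _ _), intervalIntegral.integral_const_mul,
    intervalIntegral.integral_const_mul, integral_expo_mul_geomSq, integral_expo_mul_geomSq]
  have hk' := abs_le.1 hk
  have : ((if |-k + (n : ℤ)| ≤ (n : ℤ) then (n : ℂ) - ((|-k + (n : ℤ)| : ℤ) : ℂ) else 0) -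
      if |-k + -(n : ℤ)| ≤ (n : ℤ) then (n : ℂ) - ((|-k + -(n : ℤ)| : ℤ) : ℂ) else 0) = k := by
    have ha : |-k + (n : ℤ)| = n - k := by rw [abs_of_nonneg (by omega)]; ring
    have hb : |-k + -(n : ℤ)| = n + k := by rw [abs_of_nonpos (by omega)]; ring
    rw [ha, hb]
    rcases lt_trichotomy k 0 with h | h | h
    · rw [if_neg (by omega), if_pos (by omega)]; push_cast; ring
    · subst h; simp
    · rw [if_pos (by omega), if_neg (by omega)]; push_cast; ring
  rw [← mul_sub, this]; ring

/-- Bernstein's inequality, with the constant `4π` in place of `2π`. -/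
lemma norm_deriv_le_of_mem_TrigPoly {n : ℕ} {P P' : ℝ → ℂ} (hP : P ∈ TrigPoly n)
    (hd : ∀ t, HasDerivAt P (P' t) t) {M : ℝ} (hM : ∀ t, ‖P t‖ ≤ M) (t : ℝ) :
    ‖P' t‖ ≤ 4 * Real.pi * n * M := by
  obtain ⟨c, hc⟩ := TrigPoly_coeff hP
  have hP' : P' t = ∑ k ∈ Icc (-(n : ℤ)) n, c k * (2 * Real.pi * I * k * expo k t) := by
    refine (hd t).unique ?_
    have : P = fun t => ∑ k ∈ Icc (-(n : ℤ)) n, c k * expo k t := funext hc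
    rw [this]
    exact HasDerivAt.fun_sum fun k _ => (hasDerivAt_expo k t).const_mul (c k)
  set κ : ℝ → ℝ := fun τ => geomSq n τ * Real.sin (2 * Real.pi * n * τ) with hκ
  have hκc : Continuous κ := by
    have := continuous_geomSq n
    fun_prop
  have hPc := TrigPoly_continuous hP
  have hrep : P' t = (-4 * Real.pi : ℂ) * ∫ τ in (0 : ℝ)..1, P (t - τ) * (κ τ : ℂ) := by
    simp only [hc, sum_mul]
    rw [intervalIntegral.integral_finsetSum, hP', mul_sum]
    · refine sum_congr rfl fun k hk => ?_
      simp only [mul_assoc, intervalIntegral.integral_const_mul]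
      rw [integral_expo_mul_geomSq_mul_sin (abs_le.2 (mem_Icc.1 hk))]
      have : (I : ℂ) ≠ 0 := I_ne_zero
      field_simp
      rw [I_sq]; ring
    · intro k _
      have := continuous_expo k
      exact Continuous.intervalIntegrable (by fun_prop) _ _
  have hM0 : 0 ≤ M := (norm_nonneg _).trans (hM 0)
  have hb : ‖∫ τ in (0 : ℝ)..1, P (t - τ) * (κ τ : ℂ)‖ ≤ ∫ τ in (0 : ℝ)..1, M * geomSq n τ := by
    refine intervalIntegral.norm_integral_le_of_norm_le zero_le_one
      (Filter.Eventually.of_forall fun τ _ => ?_)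
      (((continuous_geomSq n).const_mul M).intervalIntegrable _ _)
    rw [norm_mul, Complex.norm_real, hκ, Real.norm_eq_abs, abs_mul,
      abs_of_nonneg (geomSq_nonneg n τ)]
    refine mul_le_mul (hM _) ?_ (by have := geomSq_nonneg n τ; positivity) hM0
    exact mul_le_of_le_one_right (geomSq_nonneg n τ) (Real.abs_sin_le_one _)
  rw [intervalIntegral.integral_const_mul, integral_geomSq] at hb
  have hn : ‖(-4 * Real.pi : ℂ)‖ = 4 * Real.pi := by
    simp [abs_of_pos Real.pi_pos]
  rw [hrep, norm_mul, hn]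
  calc 4 * Real.pi * _ ≤ 4 * Real.pi * (M * n) := by gcongr
    _ = _ := by ring

end

/-! ### The Jackson kernel, its odd companion and their derivatives. -/

section

open Real

/-- The normalized Fejér kernel `(sin (πNt) / (N sin (πt)))²`. -/
def fejerSq (N : ℕ) (t : ℝ) : ℝ := geomSq N t / (N : ℝ) ^ 2

/-- The Jackson kernel `(sin (πNt) / (N sin (πt)))⁴`, used to interpolate values. -/
def jackson (N : ℕ) (t : ℝ) : ℝ := fejerSq N t ^ 2

/-- An odd multiple of the Jackson kernel, used to interpolate derivatives. -/
def jacksonOdd (N : ℕ) (t : ℝ) : ℝ := jackson N t * (N * sin (2 * π * t) / 2)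

lemma fejerSq_nonneg (N : ℕ) (t : ℝ) : 0 ≤ fejerSq N t := by
  have := geomSq_nonneg N t
  unfold fejerSq; positivity

lemma fejerSq_le_one (N : ℕ) (t : ℝ) : fejerSq N t ≤ 1 :=
  div_le_one_of_le₀ (geomSq_le N t) (by positivity)

lemma jackson_nonneg (N : ℕ) (t : ℝ) : 0 ≤ jackson N t := by unfold jackson; positivity

lemma jackson_le_one (N : ℕ) (t : ℝ) : jackson N t ≤ 1 :=
  pow_le_one₀ (fejerSq_nonneg N t) (fejerSq_le_one N t)

lemma fejerSq_mul_sq {N : ℕ} (hN : 0 < N) (t : ℝ) :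
    fejerSq N t * (N * sin (π * t)) ^ 2 = sin (π * N * t) ^ 2 := by
  rw [← geomSq_mul_sin, fejerSq]
  have : (N : ℝ) ≠ 0 := by positivity
  field_simp

lemma jackson_zero {N : ℕ} (hN : 0 < N) : jackson N 0 = 1 := by
  have : (N : ℝ) ≠ 0 := by positivity
  rw [jackson, fejerSq, geomSq_zero, div_self (by positivity), one_pow]

lemma jacksonOdd_zero (N : ℕ) : jacksonOdd N 0 = 0 := by simp [jacksonOdd]

lemma jackson_mem (n : ℕ) : (fun t => (jackson (n + 1) t : ℂ)) ∈ TrigPoly (2 * n) := by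
  have h := Submodule.smul_mem _ ((1 / ((n + 1 : ℕ) : ℂ) ^ 2) ^ 2)
    (TrigPoly_mul (geomSq_mem n) (geomSq_mem n))
  rw [← two_mul] at h
  convert h using 1
  ext t
  simp only [jackson, fejerSq, Pi.smul_apply, Pi.mul_apply, smul_eq_mul]
  push_cast; ring

lemma jacksonOdd_mem (n : ℕ) :
    (fun t => (jacksonOdd (n + 1) t : ℂ)) ∈ TrigPoly (2 * n + 1) := by
  have hs : (fun t : ℝ => ((sin (2 * π * t) : ℝ) : ℂ)) ∈ TrigPoly 1 := by
    have : (fun t : ℝ => ((sin (2 * π * t) : ℝ) : ℂ)) =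
        (1 / (2 * Complex.I)) • (expo 1 - expo (-1)) := by
      ext t
      have := sin_eq_expo 1 t
      simp only [Nat.cast_one, mul_one] at this
      rw [this, Pi.smul_apply, Pi.sub_apply, smul_eq_mul]; ring
    rw [this]
    exact Submodule.smul_mem _ _ (Submodule.sub_mem _ (expo_mem (by simp)) (expo_mem (by simp)))
  have h := Submodule.smul_mem _ (((n + 1 : ℕ) : ℂ) / 2) (TrigPoly_mul (jackson_mem n) hs)
  convert h using 1
  ext t
  simp only [jacksonOdd, Pi.smul_apply, Pi.mul_apply, smul_eq_mul]
  push_cast; ring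

lemma jackson_eq {N : ℕ} (hN : 0 < N) {t : ℝ} (ht : sin (π * t) ≠ 0) :
    jackson N t = sin (π * N * t) ^ 4 / (N * sin (π * t)) ^ 4 := by
  have hN' : (N : ℝ) ≠ 0 := by positivity
  have hx : (N * sin (π * t)) ≠ 0 := mul_ne_zero hN' ht
  rw [eq_div_iff (pow_ne_zero _ hx), jackson]
  linear_combination (fejerSq N t * (N * sin (π * t)) ^ 2 + sin (π * N * t) ^ 2) *
    fejerSq_mul_sq hN t

lemma jacksonOdd_eq {N : ℕ} (hN : 0 < N) {t : ℝ} (ht : sin (π * t) ≠ 0) :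
    jacksonOdd N t = sin (π * N * t) ^ 4 * cos (π * t) / (N * sin (π * t)) ^ 3 := by
  have hN' : (N : ℝ) ≠ 0 := by positivity
  rw [jacksonOdd, jackson_eq hN ht, mul_assoc 2 π t, sin_two_mul]
  field_simp

/-- The derivative of `jackson N`, divided by `πN`. -/
def jacksonD (N : ℕ) (t : ℝ) : ℝ :=
  4 * sin (π * N * t) ^ 3 * (cos (π * N * t) * (N * sin (π * t)) - sin (π * N * t) * cos (π * t)) /
    (N * sin (π * t)) ^ 5

/-- The second derivative of `jackson N`, divided by `(πN)²`. -/
def jacksonDD (N : ℕ) (t : ℝ) : ℝ :=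
  (12 * sin (π * N * t) ^ 2 * cos (π * N * t) ^ 2 * (N * sin (π * t)) ^ 2
    - 4 * sin (π * N * t) ^ 4 * (N * sin (π * t)) ^ 2
    - 32 * sin (π * N * t) ^ 3 * cos (π * N * t) * cos (π * t) * (N * sin (π * t))
    + 20 * sin (π * N * t) ^ 4 * cos (π * t) ^ 2
    + 4 * sin (π * N * t) ^ 4 * (N * sin (π * t)) ^ 2 / N ^ 2) / (N * sin (π * t)) ^ 6

/-- The derivative of `jacksonOdd N`, divided by `πN`. -/
def jacksonOddD (N : ℕ) (t : ℝ) : ℝ :=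
  (4 * sin (π * N * t) ^ 3 * cos (π * N * t) * cos (π * t) * (N * sin (π * t))
    - 3 * sin (π * N * t) ^ 4 * cos (π * t) ^ 2
    - sin (π * N * t) ^ 4 * (N * sin (π * t)) ^ 2 / N ^ 2) / (N * sin (π * t)) ^ 4

/-- The second derivative of `jacksonOdd N`, divided by `(πN)²`. -/
def jacksonOddDD (N : ℕ) (t : ℝ) : ℝ :=
  (cos (π * t) * (12 * sin (π * N * t) ^ 2 * cos (π * N * t) ^ 2 - 4 * sin (π * N * t) ^ 4)
      * (N * sin (π * t)) ^ 2
    - 24 * sin (π * N * t) ^ 3 * cos (π * N * t) * cos (π * t) ^ 2 * (N * sin (π * t))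
    + 12 * sin (π * N * t) ^ 4 * cos (π * t) ^ 3
    - 8 * sin (π * N * t) ^ 3 * cos (π * N * t) * (N * sin (π * t)) ^ 3 / N ^ 2
    + 8 * sin (π * N * t) ^ 4 * cos (π * t) * (N * sin (π * t)) ^ 2 / N ^ 2)
      / (N * sin (π * t)) ^ 5

lemma hasDerivAt_sin_pi_mul (a t : ℝ) :
    HasDerivAt (fun t => sin (π * a * t)) (π * a * cos (π * a * t)) t := by
  have := (hasDerivAt_id t).const_mul (π * a)
  simpa [mul_comm] using this.sin

lemma hasDerivAt_cos_pi_mul (a t : ℝ) :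
    HasDerivAt (fun t => cos (π * a * t)) (-(π * a * sin (π * a * t))) t := by
  have := (hasDerivAt_id t).const_mul (π * a)
  simpa [mul_comm] using this.cos

lemma hasDerivAt_sin_pi (t : ℝ) : HasDerivAt (fun t => sin (π * t)) (π * cos (π * t)) t := by
  simpa using hasDerivAt_sin_pi_mul 1 t

lemma hasDerivAt_cos_pi (t : ℝ) : HasDerivAt (fun t => cos (π * t)) (-(π * sin (π * t))) t := by
  simpa using hasDerivAt_cos_pi_mul 1 t

lemma eventually_sin_pi_ne {t : ℝ} (ht : sin (π * t) ≠ 0) :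
    ∀ᶠ r in nhds t, sin (π * r) ≠ 0 :=
  (hasDerivAt_sin_pi t).continuousAt.eventually_ne ht

lemma hasDerivAt_jackson {N : ℕ} (hN : 0 < N) {t : ℝ} (ht : sin (π * t) ≠ 0) :
    HasDerivAt (jackson N) (π * N * jacksonD N t) t := by
  have hN' : (N : ℝ) ≠ 0 := by positivity
  have h := ((hasDerivAt_sin_pi_mul N t).fun_pow 4).fun_div
    (((hasDerivAt_sin_pi t).const_mul (N : ℝ)).fun_pow 4) (pow_ne_zero _ (mul_ne_zero hN' ht))
  refine (h.congr_of_eventuallyEq ?_).congr_deriv ?_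
  · filter_upwards [eventually_sin_pi_ne ht] with r hr using jackson_eq hN hr
  · rw [jacksonD]
    simp only [Nat.reduceSub]
    field_simp
    push_cast
    ring

lemma hasDerivAt_jacksonOdd {N : ℕ} (hN : 0 < N) {t : ℝ} (ht : sin (π * t) ≠ 0) :
    HasDerivAt (jacksonOdd N) (π * N * jacksonOddD N t) t := by
  have hN' : (N : ℝ) ≠ 0 := by positivity
  have h := (((hasDerivAt_sin_pi_mul N t).fun_pow 4).fun_mul (hasDerivAt_cos_pi t)).fun_div
    (((hasDerivAt_sin_pi t).const_mul (N : ℝ)).fun_pow 3) (pow_ne_zero _ (mul_ne_zero hN' ht))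
  refine (h.congr_of_eventuallyEq ?_).congr_deriv ?_
  · filter_upwards [eventually_sin_pi_ne ht] with r hr using jacksonOdd_eq hN hr
  · rw [jacksonOddD]
    simp only [Nat.reduceSub]
    field_simp
    ring

lemma hasDerivAt_jacksonD {N : ℕ} (hN : 0 < N) {t : ℝ} (ht : sin (π * t) ≠ 0) :
    HasDerivAt (jacksonD N) (π * N * jacksonDD N t) t := by
  have hN' : (N : ℝ) ≠ 0 := by positivity
  have hs := hasDerivAt_sin_pi_mul N t
  have hc := hasDerivAt_cos_pi_mul N t
  have hx := (hasDerivAt_sin_pi t).const_mul (N : ℝ)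
  have h := (((hs.fun_pow 3).const_mul 4).fun_mul
    ((hc.fun_mul hx).fun_sub (hs.fun_mul (hasDerivAt_cos_pi t)))).fun_div
    (hx.fun_pow 5) (pow_ne_zero _ (mul_ne_zero hN' ht))
  refine (h.congr_of_eventuallyEq (Filter.Eventually.of_forall fun r => ?_)).congr_deriv ?_
  · simp only [jacksonD]
  · rw [jacksonDD]
    simp only [Nat.reduceSub]
    field_simp
    ring

lemma hasDerivAt_jacksonOddD {N : ℕ} (hN : 0 < N) {t : ℝ} (ht : sin (π * t) ≠ 0) :
    HasDerivAt (jacksonOddD N) (π * N * jacksonOddDD N t) t := by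
  have hN' : (N : ℝ) ≠ 0 := by positivity
  have hs := hasDerivAt_sin_pi_mul N t
  have hc := hasDerivAt_cos_pi_mul N t
  have hC := hasDerivAt_cos_pi t
  have hx := (hasDerivAt_sin_pi t).const_mul (N : ℝ)
  have h := ((((((hs.fun_pow 3).const_mul 4).fun_mul hc).fun_mul hC).fun_mul hx).fun_sub
    (((hs.fun_pow 4).const_mul 3).fun_mul (hC.fun_pow 2))).fun_sub
    (((hs.fun_pow 4).fun_mul (hx.fun_pow 2)).div_const ((N : ℝ) ^ 2)) |>.fun_div
    (hx.fun_pow 4) (pow_ne_zero _ (mul_ne_zero hN' ht))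
  refine (h.congr_of_eventuallyEq (Filter.Eventually.of_forall fun r => ?_)).congr_deriv ?_
  · simp only [jacksonOddD]
  · rw [jacksonOddDD]
    simp only [Nat.reduceSub]
    field_simp
    ring

/-- The quotient formula breaks down at 0. Differentiability comes from being a trigonometric
polynomial, and the derivative vanishes because 0 is a maximum. -/
lemma hasDerivAt_jackson_zero {N : ℕ} (hN : 0 < N) : HasDerivAt (jackson N) 0 0 := by
  obtain ⟨n, rfl⟩ := Nat.exists_eq_succ_of_ne_zero hN.ne'
  obtain ⟨P', -, hP⟩ := TrigPoly_hasDerivAt (jackson_mem n)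
  have h1 : HasDerivAt (jackson (n + 1)) (P' 0).re 0 := by
    exact Complex.reCLM.hasFDerivAt.comp_hasDerivAt (0 : ℝ) (hP 0)
  have h2 : IsLocalMax (jackson (n + 1)) 0 := Filter.Eventually.of_forall fun t => by
    simp only [jackson_zero (Nat.succ_pos n), jackson_le_one]
  rwa [h2.hasDerivAt_eq_zero h1] at h1

lemma hasDerivAt_jacksonOdd_zero {N : ℕ} (hN : 0 < N) :
    HasDerivAt (jacksonOdd N) (π * N) 0 := by
  have h1 : HasDerivAt (fun t : ℝ => (N : ℝ) * sin (2 * π * t) / 2) (π * N) 0 := by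
    have := ((((hasDerivAt_id (0 : ℝ)).const_mul (2 * π)).sin).const_mul (N : ℝ)).div_const 2
    refine this.congr_deriv ?_
    simp; ring
  have := (hasDerivAt_jackson_zero hN).fun_mul h1
  refine this.congr_deriv ?_
  simp [jackson_zero hN]

end

/-! ### Numerical bounds for the kernels, away from the peak and near it. -/

section

open Real

/-- On the unit circle the quadratic form sc - κs² has largest absolute eigenvalue (|κ| + √(1 +
κ²))/2. The hypothesis on `m` says that `m` is at least this value for κ₀; the proof completes the
square. -/
lemma abs_mul_sub_le {c s κ κ₀ m : ℝ} (h : s ^ 2 + c ^ 2 = 1) (hκ : |κ| ≤ κ₀)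
    (hm0 : 0 < m) (hd : 1 ≤ 4 * m * (m - κ₀)) : |s * (c - κ * s)| ≤ m := by
  have h1 := abs_le.1 hκ
  have h2 : 0 ≤ 4 * m * (m - κ) - 1 := by nlinarith
  have h3 : 0 ≤ 4 * m * (m + κ) - 1 := by nlinarith
  rw [abs_le]
  constructor
  · have : 0 ≤ m * (s * (c - κ * s) + m) := by
      have : m * (s * (c - κ * s) + m) = (m * c + s / 2) ^ 2 + (4 * m * (m - κ) - 1) / 4 * s ^ 2 := by
        linear_combination -m ^ 2 * h
      rw [this]; positivity
    linarith [nonneg_of_mul_nonneg_right this hm0]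
  · have : 0 ≤ m * (m - s * (c - κ * s)) := by
      have : m * (m - s * (c - κ * s)) = (m * c - s / 2) ^ 2 + (4 * m * (m + κ) - 1) / 4 * s ^ 2 := by
        linear_combination -m ^ 2 * h
      rw [this]; positivity
    linarith [nonneg_of_mul_nonneg_right this hm0]

variable {N : ℕ} {t : ℝ}

lemma jackson_le (hN : 0 < N) (ht : sin (π * t) ≠ 0) :
    jackson N t ≤ 1 / |N * sin (π * t)| ^ 4 := by
  rw [jackson_eq hN ht, ← abs_pow, abs_of_nonneg (by positivity : 0 ≤ (N * sin (π * t)) ^ 4)]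
  gcongr
  calc sin (π * N * t) ^ 4 = (sin (π * N * t) ^ 2) ^ 2 := by ring
    _ ≤ 1 := pow_le_one₀ (sq_nonneg _) (sin_sq_le_one _)

lemma abs_jacksonOdd_le (hN : 0 < N) (ht : sin (π * t) ≠ 0) :
    |jacksonOdd N t| ≤ 1 / |N * sin (π * t)| ^ 3 := by
  rw [jacksonOdd_eq hN ht, abs_div, abs_pow]
  gcongr
  rw [abs_mul, abs_pow]
  exact mul_le_one₀ (pow_le_one₀ (abs_nonneg _) (abs_sin_le_one _)) (abs_nonneg _)
    (abs_cos_le_one _)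

/-- One of the four Fejér factors in the square absorbs (N sin πt)², leaving a product of factors at
most 1. -/
lemma abs_jacksonOdd_le_one (hN : 0 < N) : |jacksonOdd N t| ≤ 1 := by
  rw [← sq_le_one_iff_abs_le_one]
  have h1 : jacksonOdd N t ^ 2 = fejerSq N t ^ 3 * (fejerSq N t * (N * sin (π * t)) ^ 2)
      * cos (π * t) ^ 2 := by
    rw [jacksonOdd, jackson, mul_assoc 2 π t, sin_two_mul]; ring
  rw [h1, fejerSq_mul_sq hN]
  refine mul_le_one₀ (mul_le_one₀ ?_ (sq_nonneg _) (sin_sq_le_one _)) (sq_nonneg _)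
    (cos_sq_le_one _)
  exact pow_le_one₀ (fejerSq_nonneg N t) (fejerSq_le_one N t)

lemma abs_jacksonD_le (hx : 3.1 ≤ |N * sin (π * t)|) :
    |jacksonD N t| ≤ 2.8 / |N * sin (π * t)| ^ 4 := by
  rw [jacksonD]
  have hC := abs_cos_le_one (π * t)
  have hsc := sin_sq_add_cos_sq (π * N * t)
  have hs := abs_sin_le_one (π * N * t)
  generalize (N * sin (π * t)) = x at *
  generalize cos (π * t) = C at *
  generalize sin (π * N * t) = s at *
  generalize cos (π * N * t) = c at *
  have hx0 : x ≠ 0 := by rintro rfl; norm_num at hx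
  -- With κ = C/x, |κ| ≤ 1/3.1 < 0.33, this has the shape of `abs_mul_sub_le`; the final constant is
  -- 2.8 = 4 · 0.7.
  have h1 : 4 * s ^ 3 * (c * x - s * C) / x ^ 5 = 4 * s ^ 2 * (s * (c - C / x * s)) / x ^ 4 := by
    field_simp
  have hκ : |C / x| ≤ 0.33 := by
    rw [abs_div, div_le_iff₀ (by linarith)]; linarith
  have h2 := abs_mul_sub_le (m := 0.7) hsc hκ (by norm_num) (by norm_num)
  rw [h1, abs_div, abs_pow, abs_mul]
  gcongr
  have : |4 * s ^ 2| ≤ 4 := by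
    rw [abs_of_nonneg (by positivity)]; nlinarith [sq_nonneg c]
  nlinarith [abs_nonneg (s * (c - C / x * s)), abs_nonneg (4 * s ^ 2)]

lemma abs_jacksonOddD_le (hN : 1000 ≤ N) (hx : 3.1 ≤ |N * sin (π * t)|) :
    |jacksonOddD N t| ≤ 2.57 / |N * sin (π * t)| ^ 3 := by
  have hxN : |N * sin (π * t)| ≤ N := by
    rw [abs_mul, Nat.abs_cast]; exact mul_le_of_le_one_right (by positivity) (abs_sin_le_one _)
  rw [jacksonOddD]
  have hN' : (1000 : ℝ) ≤ N := by exact_mod_cast hN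
  have hC := abs_cos_le_one (π * t)
  have hsc := sin_sq_add_cos_sq (π * N * t)
  generalize (N * sin (π * t)) = x at *
  generalize cos (π * t) = C at *
  generalize sin (π * N * t) = s at *
  generalize cos (π * N * t) = c at *
  have hx0 : x ≠ 0 := by rintro rfl; norm_num at hx
  have hN0 : (N : ℝ) ≠ 0 := by positivity
  have h1 : (4 * s ^ 3 * c * C * x - 3 * s ^ 4 * C ^ 2 - s ^ 4 * x ^ 2 / N ^ 2) / x ^ 4 =
      (4 * s ^ 2 * C * (s * (c - 3 / 4 * (C / x) * s)) - s ^ 4 * (x / N) / N) / x ^ 3 := by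
    field_simp
  have hκ : |3 / 4 * (C / x)| ≤ 0.242 := by
    rw [abs_mul, abs_div C, ← le_div_iff₀' (by norm_num), div_le_iff₀ (by linarith)]
    norm_num at hx ⊢
    linarith
  have h2 := abs_mul_sub_le (m := 0.64) hsc hκ (by norm_num) (by norm_num)
  have hs2 : s ^ 2 ≤ 1 := by nlinarith [sq_nonneg c]
  rw [h1, abs_div, abs_pow x]
  gcongr
  refine (abs_sub _ _).trans ?_
  have h3 : |4 * s ^ 2 * C * (s * (c - 3 / 4 * (C / x) * s))| ≤ 2.56 := by
    rw [abs_mul, abs_mul, abs_of_nonneg (by positivity : 0 ≤ 4 * s ^ 2)]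
    have : 4 * s ^ 2 * |C| ≤ 4 := by nlinarith [abs_nonneg C, sq_nonneg s]
    nlinarith [abs_nonneg (s * (c - 3 / 4 * (C / x) * s)),
      mul_nonneg (by positivity : 0 ≤ 4 * s ^ 2) (abs_nonneg C)]
  have h4 : |s ^ 4 * (x / N) / N| ≤ 0.01 := by
    rw [abs_div, abs_mul, abs_div, Nat.abs_cast, abs_of_nonneg (by positivity : 0 ≤ s ^ 4),
      div_le_iff₀ (by linarith)]
    have : |x| / N ≤ 1 := by rw [div_le_one (by linarith)]; exact hxN
    have : s ^ 4 * (|x| / N) ≤ 1 :=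
      mul_le_one₀ (by nlinarith [sq_nonneg s]) (by positivity) this
    linarith
  linarith

lemma abs_jacksonDD_le (hN : 1000 ≤ N) (hx : 2.325 ≤ |N * sin (π * t)|) :
    |jacksonDD N t| ≤ 9.1 / |N * sin (π * t)| ^ 4 := by
  rw [jacksonDD]
  have hN' : (1000 : ℝ) ≤ N := by exact_mod_cast hN
  have hC := abs_cos_le_one (π * t)
  have hsc := sin_sq_add_cos_sq (π * N * t)
  generalize (N * sin (π * t)) = x at *
  generalize cos (π * t) = C at *
  generalize sin (π * N * t) = s at *
  generalize cos (π * N * t) = c at *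
  have hx0 : x ≠ 0 := by rintro rfl; norm_num at hx
  have hN0 : (N : ℝ) ≠ 0 := by positivity
  -- Completing the square in the mixed term turns 12c² - 32cy + 20y², with y = C/x, into a square
  -- to which `abs_mul_sub_le` applies, with a remainder of -4/3 y².
  have h1 : (12 * s ^ 2 * c ^ 2 * x ^ 2 - 4 * s ^ 4 * x ^ 2 - 32 * s ^ 3 * c * C * x
      + 20 * s ^ 4 * C ^ 2 + 4 * s ^ 4 * x ^ 2 / N ^ 2) / x ^ 6 =
      (12 * (s * (c - 4 / 3 * (C / x) * s)) ^ 2 - 4 * s ^ 4 - 4 / 3 * s ^ 4 * (C / x) ^ 2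
        + 4 * s ^ 4 * (1 / N ^ 2)) / x ^ 4 := by
    field_simp
    ring
  have hy : |C / x| ≤ 0.4302 := by
    rw [abs_div, div_le_iff₀ (by linarith)]; linarith
  have hκ : |4 / 3 * (C / x)| ≤ 0.5736 := by
    rw [abs_mul]; norm_num at hy ⊢; linarith
  have h2 := abs_mul_sub_le (m := 0.87) hsc hκ (by norm_num) (by norm_num)
  have hs2 : s ^ 2 ≤ 1 := by nlinarith [sq_nonneg c]
  have hs4 : s ^ 4 ≤ 1 := by nlinarith [sq_nonneg s]
  have hs0 : 0 ≤ s ^ 4 := by positivity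
  have hy2 : (C / x) ^ 2 ≤ 0.2 := by
    rw [← sq_abs]; nlinarith [abs_nonneg (C / x)]
  have hq : (s * (c - 4 / 3 * (C / x) * s)) ^ 2 ≤ 0.757 := by
    rw [← sq_abs]; nlinarith [abs_nonneg (s * (c - 4 / 3 * (C / x) * s))]
  have hNi : 1 / (N : ℝ) ^ 2 ≤ 0.001 := by
    rw [div_le_iff₀ (by positivity)]; nlinarith
  have hNi0 : 0 ≤ 1 / (N : ℝ) ^ 2 := by positivity
  rw [h1, abs_div, abs_pow x]
  gcongr
  generalize (s * (c - 4 / 3 * (C / x) * s)) = q at *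
  generalize (C / x) = y at *
  generalize 1 / (N : ℝ) ^ 2 = n at *
  rw [abs_le]
  constructor
  · nlinarith [sq_nonneg q, mul_le_mul hs4 hy2 (sq_nonneg y) (by norm_num), mul_nonneg hs0 hNi0]
  · nlinarith [mul_nonneg hs0 (sq_nonneg y), mul_le_mul hs4 hNi hNi0 (by norm_num)]

lemma abs_jacksonOddDD_le (hN : 10000 ≤ N) (hx : 2.325 ≤ |N * sin (π * t)|) :
    |jacksonOddDD N t| ≤ 7 / |N * sin (π * t)| ^ 3 := by
  have hxN : |N * sin (π * t)| ≤ N := by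
    rw [abs_mul, Nat.abs_cast]; exact mul_le_of_le_one_right (by positivity) (abs_sin_le_one _)
  rw [jacksonOddDD]
  have hN' : (10000 : ℝ) ≤ N := by exact_mod_cast hN
  have hC := abs_cos_le_one (π * t)
  have hsc := sin_sq_add_cos_sq (π * N * t)
  generalize (N * sin (π * t)) = x at *
  generalize cos (π * t) = C at *
  generalize sin (π * N * t) = s at *
  generalize cos (π * N * t) = c at *
  have hx0 : x ≠ 0 := by rintro rfl; norm_num at hx
  have hN0 : (N : ℝ) ≠ 0 := by positivity
  have h1 : (C * (12 * s ^ 2 * c ^ 2 - 4 * s ^ 4) * x ^ 2 - 24 * s ^ 3 * c * C ^ 2 * x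
      + 12 * s ^ 4 * C ^ 3 - 8 * s ^ 3 * c * x ^ 3 / N ^ 2 + 8 * s ^ 4 * C * x ^ 2 / N ^ 2) / x ^ 5 =
      (C * (12 * (s * (c - C / x * s)) ^ 2 - 4 * s ^ 4)
        + 8 * s ^ 3 * (s * C * (1 / N) - c * (x / N)) * (1 / N)) / x ^ 3 := by
    field_simp
    ring
  have hy : |C / x| ≤ 0.4302 := by
    rw [abs_div, div_le_iff₀ (by linarith)]; linarith
  have h2 := abs_mul_sub_le (m := 0.76) hsc hy (by norm_num) (by norm_num)
  have hs2 : s ^ 2 ≤ 1 := by nlinarith [sq_nonneg c]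
  have hc2 : c ^ 2 ≤ 1 := by nlinarith [sq_nonneg s]
  have hs1 : |s| ≤ 1 := by rwa [← sq_le_one_iff_abs_le_one]
  have hc1 : |c| ≤ 1 := by rwa [← sq_le_one_iff_abs_le_one]
  have hs4 : s ^ 4 ≤ 1 := by nlinarith [sq_nonneg s]
  have hs0 : 0 ≤ s ^ 4 := by positivity
  have hq : (s * (c - C / x * s)) ^ 2 ≤ 0.5776 := by
    rw [← sq_abs]; nlinarith [abs_nonneg (s * (c - C / x * s))]
  have hNi : 1 / (N : ℝ) ≤ 0.0001 := by
    rw [div_le_iff₀ (by positivity)]; linarith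
  have hNi0 : 0 ≤ 1 / (N : ℝ) := by positivity
  have hxN' : |x / N| ≤ 1 := by
    rw [abs_div, Nat.abs_cast, div_le_one (by linarith)]; exact hxN
  rw [h1, abs_div, abs_pow x]
  gcongr
  refine (abs_add_le _ _).trans ?_
  have h3 : |C * (12 * (s * (c - C / x * s)) ^ 2 - 4 * s ^ 4)| ≤ 6.94 := by
    rw [abs_mul]
    refine (mul_le_of_le_one_left (abs_nonneg _) hC).trans ?_
    rw [abs_le]
    constructor <;> nlinarith [sq_nonneg (s * (c - C / x * s))]
  have h4 : |8 * s ^ 3 * (s * C * (1 / N) - c * (x / N)) * (1 / N)| ≤ 0.06 := by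
    rw [abs_mul, abs_mul, abs_mul, abs_pow, abs_of_nonneg hNi0]
    have h5 : |s * C * (1 / N) - c * (x / N)| ≤ 2 := by
      refine (abs_sub _ _).trans ?_
      rw [abs_mul, abs_mul, abs_mul, abs_of_nonneg hNi0]
      have h6 : |s| * |C| ≤ 1 := mul_le_one₀ hs1 (abs_nonneg _) hC
      have h7 : |s| * |C| * (1 / N) ≤ 1 := mul_le_one₀ h6 hNi0 (by linarith)
      have h8 : |c| * |x / N| ≤ 1 := mul_le_one₀ hc1 (abs_nonneg _) hxN'
      linarith
    have h9 : |s| ^ 3 ≤ 1 := pow_le_one₀ (abs_nonneg _) hs1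
    have h10 : |s| ^ 3 * |s * C * (1 / N) - c * (x / N)| ≤ 1 * 2 :=
      mul_le_mul h9 h5 (abs_nonneg _) (by norm_num)
    have h11 := mul_le_mul h10 hNi hNi0 (by norm_num)
    rw [abs_of_nonneg (by norm_num : (0:ℝ) ≤ 8)]
    linarith
  linarith

lemma cos_le_taylor {x : ℝ} (hx : 0 ≤ x) : cos x ≤ 1 - x ^ 2 / 2 + x ^ 4 / 24 := by
  have hm : MonotoneOn (fun x : ℝ => 1 - x ^ 2 / 2 + x ^ 4 / 24 - cos x) (Set.Ici 0) := by
    refine monotoneOn_of_hasDerivWithinAt_nonneg (f' := fun x => -x + x ^ 3 / 6 + sin x)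
      (convex_Ici 0) (by fun_prop) (fun x hx => ?_) (fun x hx => ?_)
    · have h := (((hasDerivAt_pow 2 x).div_const 2).const_sub 1 |>.add
        ((hasDerivAt_pow 4 x).div_const 24)).sub (hasDerivAt_cos x)
      refine HasDerivAt.hasDerivWithinAt (h.congr_deriv ?_)
      simp only [Nat.reduceSub]; push_cast; ring
    · rw [interior_Ici] at hx
      have := sin_ge_sub_cube (le_of_lt hx)
      linarith
  have := hm (Set.mem_Ici.2 le_rfl) hx hx
  simp at this
  linarith

lemma sin_le_taylor {x : ℝ} (hx : 0 ≤ x) : sin x ≤ x - x ^ 3 / 6 + x ^ 5 / 120 := by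
  have hm : MonotoneOn (fun x : ℝ => x - x ^ 3 / 6 + x ^ 5 / 120 - sin x) (Set.Ici 0) := by
    refine monotoneOn_of_hasDerivWithinAt_nonneg (f' := fun x => 1 - x ^ 2 / 2 + x ^ 4 / 24 - cos x)
      (convex_Ici 0) (by fun_prop) (fun x hx => ?_) (fun x hx => ?_)
    · have h := (((hasDerivAt_id x).sub ((hasDerivAt_pow 3 x).div_const 6)).add
        ((hasDerivAt_pow 5 x).div_const 120)).sub (hasDerivAt_sin x)
      refine HasDerivAt.hasDerivWithinAt (h.congr_deriv ?_)
      simp only [Nat.reduceSub]; push_cast; ring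
    · rw [interior_Ici] at hx
      have := cos_le_taylor (le_of_lt hx)
      linarith
  have := hm (Set.mem_Ici.2 le_rfl) hx hx
  simp at this
  linarith

/-- A bound of `fejerSq` by the Taylor polynomial of the cardinal sine. -/
lemma fejerSq_mul_le (hN : 10000 ≤ N) (ht : N * |t| ≤ 1 / 2) (ht0 : t ≠ 0) :
    fejerSq N t * (1 - 2 / 10 ^ 9 * (π * N * t) ^ 2) ^ 2 ≤
      (1 - (π * N * t) ^ 2 / 6 + (π * N * t) ^ 4 / 120) ^ 2 := by
  wlog hpos : 0 < t generalizing t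
  · have h := this (t := -t) (by rwa [abs_neg]) (neg_ne_zero.2 ht0)
      (by rcases lt_or_gt_of_ne ht0 with h | h <;> [linarith; exact absurd h hpos])
    have he : fejerSq N (-t) = fejerSq N t := by
      have : geomSq N (-t) = geomSq N t := by
        have h2 := geomSq_eq N (-t)
        have h3 : ∀ (k : ℤ), expo k (-t) = expo (-k) t := by
          intro k; simp only [expo]; congr 1; push_cast; ring
        simp only [h3, neg_sub] at h2
        rw [Finset.sum_comm, ← geomSq_eq] at h2
        exact_mod_cast h2
      simp only [fejerSq, this]
    rw [he] at h
    convert h using 3 <;> ring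
  rw [abs_of_pos hpos] at ht
  have hN' : (10000 : ℝ) ≤ N := by exact_mod_cast hN
  have hπ := pi_pos
  have hπ4 := pi_lt_d2
  set X := π * N * t with hX
  have hX0 : 0 < X := by positivity
  have hX2 : X ≤ 1.6 := by
    have : X = π * (N * t) := by ring
    rw [this]; nlinarith
  have h1 := fejerSq_mul_sq (N := N) (by omega) t
  rw [← hX] at h1
  have hsX : sin X ≤ X * (1 - X ^ 2 / 6 + X ^ 4 / 120) := by
    have := sin_le_taylor hX0.le; linarith
  have hsX0 : 0 ≤ sin X := sin_nonneg_of_nonneg_of_le_pi hX0.le (by linarith [pi_gt_three])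
  have hx : X * (1 - 2 / 10 ^ 9 * X ^ 2) ≤ N * sin (π * t) := by
    have h2 := sin_ge_sub_cube (x := π * t) (by positivity)
    have h3 : π * t = X / N := by rw [hX]; field_simp
    rw [h3] at h2 ⊢
    have h4 : N * (X / N - (X / N) ^ 3 / 6) = X * (1 - (1 / (6 * N ^ 2)) * X ^ 2) := by
      field_simp
    -- The only use of N ≥ 10000 here: replacing N sin(X/N) by X costs a relative error of at most
    -- X²/(6N²).
    have h5 : 1 / (6 * (N : ℝ) ^ 2) ≤ 2 / 10 ^ 9 := by
      rw [div_le_div_iff₀ (by positivity) (by positivity)]; nlinarith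
    calc X * (1 - 2 / 10 ^ 9 * X ^ 2) ≤ X * (1 - (1 / (6 * N ^ 2)) * X ^ 2) := by gcongr
      _ ≤ _ := by rw [← h4]; gcongr
  have he0 : 0 ≤ 1 - 2 / 10 ^ 9 * X ^ 2 := by nlinarith
  have h6 : fejerSq N t * (X * (1 - 2 / 10 ^ 9 * X ^ 2)) ^ 2 ≤
      (X * (1 - X ^ 2 / 6 + X ^ 4 / 120)) ^ 2 := by
    calc fejerSq N t * (X * (1 - 2 / 10 ^ 9 * X ^ 2)) ^ 2
        ≤ fejerSq N t * (N * sin (π * t)) ^ 2 := by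
          have := fejerSq_nonneg N t
          gcongr
      _ = sin X ^ 2 := h1
      _ ≤ _ := by gcongr
  rw [mul_pow X, mul_pow X, mul_left_comm] at h6
  exact le_of_mul_le_mul_left h6 (by positivity)

/-- Quadratic decay of the Jackson kernel near its peak. -/
lemma jackson_le_near (hN : 10000 ≤ N) (ht : N * |t| ≤ 1 / 4) :
    jackson N t ≤ 1 - 0.528 * (π * N * t) ^ 2 := by
  by_cases ht0 : t = 0
  · subst ht0; simp [jackson_zero (show 0 < N by omega)]
  have h := fejerSq_mul_le hN (by linarith) ht0
  have hu : (π * N * t) ^ 2 ≤ 0.6171 := by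
    rw [← sq_abs, abs_mul, abs_mul, Nat.abs_cast, abs_of_pos pi_pos, mul_assoc]
    have : π * (N * |t|) ≤ 3.1416 * (1 / 4) := by
      have := pi_lt_d4
      gcongr
    have h0 : 0 ≤ π * (N * |t|) := by positivity
    nlinarith
  have h4 : (π * N * t) ^ 4 = ((π * N * t) ^ 2) ^ 2 := by ring
  rw [h4] at h
  have hu0 : 0 ≤ (π * N * t) ^ 2 := sq_nonneg _
  generalize (π * N * t) ^ 2 = u at *
  -- Squaring 1 - 0.29u gives 1 - 0.58u + 0.0841u², which is below 1 - 0.528u as long as u ≤ 0.618;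
  -- hence the bound on u, which is about (π/4)².
  have hF : fejerSq N t ≤ 1 - 0.29 * u := by
    have he : 0 < (1 - 2 / 10 ^ 9 * u) ^ 2 := by
      have : 0 < 1 - 2 / 10 ^ 9 * u := by nlinarith
      positivity
    refine le_of_mul_le_mul_right (h.trans ?_) he
    nlinarith [mul_nonneg hu0 hu0, mul_nonneg hu0 (sub_nonneg.2 hu),
      mul_nonneg (mul_nonneg hu0 hu0) (sub_nonneg.2 hu),
      mul_nonneg (mul_nonneg (mul_nonneg hu0 hu0) hu0) (sub_nonneg.2 hu)]
  have := fejerSq_nonneg N t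
  rw [jackson]
  nlinarith

/-- The Taylor polynomial 1 - u/6 + u²/120 decreases on the range of u, so a lower bound on the
distance to 0 bounds it above. The extra 1e-7 absorbs the relative error of `fejerSq_mul_le`. -/
lemma fejerSq_le_of_le (hN : 10000 ≤ N) (ht : N * |t| ≤ 1 / 2) {r B : ℝ} (hr : 0 < r)
    (htr : r ≤ N * |t|)
    (hB : 1 - (3.1415 * r) ^ 2 / 6 + (3.1415 * r) ^ 4 / 120 ≤ B) :
    fejerSq N t ≤ (B + 1e-7) ^ 2 := by
  have ht0 : t ≠ 0 := by rintro rfl; simp at htr; linarith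
  have h := fejerSq_mul_le hN ht ht0
  have hsq : (π * N * t) ^ 2 = (π * (N * |t|)) ^ 2 := by
    rw [mul_pow, mul_pow, mul_pow, mul_pow, sq_abs]; ring
  have h4 : (π * N * t) ^ 4 = ((π * N * t) ^ 2) ^ 2 := by ring
  have hπ := pi_gt_d4
  have hπ' := pi_lt_d4
  have hu : (π * N * t) ^ 2 ≤ 2.5 := by
    rw [hsq]
    have : π * (N * |t|) ≤ 3.1416 * (1 / 2) := by gcongr
    have h0 : 0 ≤ π * (N * |t|) := by positivity
    nlinarith
  have hu' : (3.1415 * r) ^ 2 ≤ (π * N * t) ^ 2 := by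
    rw [hsq]; gcongr
  have h5 : (3.1415 * r) ^ 4 = ((3.1415 * r) ^ 2) ^ 2 := by ring
  rw [h4] at h
  rw [h5] at hB
  have hv0 : 0 ≤ (3.1415 * r) ^ 2 := by positivity
  generalize (π * N * t) ^ 2 = u at *
  generalize (3.1415 * r) ^ 2 = v at *
  have hp : 1 - u / 6 + u ^ 2 / 120 ≤ B := by nlinarith
  have hp0 : 0.58 ≤ 1 - u / 6 + u ^ 2 / 120 := by nlinarith
  have he : 0 ≤ 1 - 2 / 10 ^ 9 * u := by nlinarith
  by_contra hcon
  rw [not_le] at hcon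
  by_cases hB2 : B ≤ 2
  · have h7 : B ≤ (B + 1e-7) * (1 - 2 / 10 ^ 9 * u) := by nlinarith
    have h8 : B ^ 2 ≤ ((B + 1e-7) * (1 - 2 / 10 ^ 9 * u)) ^ 2 := by
      have : 0 ≤ B := by linarith
      gcongr
    have h9 : (1 - u / 6 + u ^ 2 / 120) ^ 2 ≤ B ^ 2 := by
      have : 0 ≤ 1 - u / 6 + u ^ 2 / 120 := by linarith
      gcongr
    have he' : 0 < (1 - 2 / 10 ^ 9 * u) ^ 2 := by
      have : 0 < 1 - 2 / 10 ^ 9 * u := by nlinarith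
      positivity
    rw [mul_pow] at h8
    have := mul_lt_mul_of_pos_right hcon he'
    linarith
  · have := fejerSq_le_one N t
    nlinarith

lemma jackson_le_of_quarter (hN : 10000 ≤ N) (ht : N * |t| ≤ 1 / 2) (htr : 1 / 4 ≤ N * |t|) :
    jackson N t ≤ 0.66 := by
  have h := fejerSq_le_of_le hN ht (r := 1 / 4) (B := 0.9005) (by norm_num) htr (by norm_num)
  have := fejerSq_nonneg N t
  rw [jackson]
  norm_num at h ⊢
  nlinarith

lemma jackson_le_of_third (hN : 10000 ≤ N) (ht : N * |t| ≤ 1 / 2) (htr : 0.35 ≤ N * |t|) :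
    jackson N t ≤ 0.435 := by
  have h := fejerSq_le_of_le hN ht (r := 0.35) (B := 0.811) (by norm_num) htr (by norm_num)
  have := fejerSq_nonneg N t
  rw [jackson]
  norm_num at h ⊢
  nlinarith

/-- The odd kernel is the Jackson kernel times N sin(2πt)/2, and that factor differs from πNt by a
cubic term. The deviation from πNt thus splits into the defect of the Jackson kernel and the error
in the sine. -/
lemma abs_jacksonOdd_sub_le (hN : 0 < N) :
    |jacksonOdd N t - π * N * t| ≤
      |π * N * t| * (1 - jackson N t) + |π * N * t| * ((π * N * t) ^ 2 / N ^ 2) := by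
  have hN' : (N : ℝ) ≠ 0 := by positivity
  have h1 := abs_sub_sin_le (2 * π * t)
  have h2 : jacksonOdd N t - π * N * t = -(π * N * t * (1 - jackson N t)) -
      jackson N t * (N / 2 * (2 * π * t - sin (2 * π * t))) := by
    rw [jacksonOdd]; ring
  have h0 := jackson_nonneg N t
  have h1' := jackson_le_one N t
  rw [h2]
  refine (abs_sub _ _).trans ?_
  rw [abs_neg, abs_mul (π * N * t), abs_of_nonneg (by linarith : 0 ≤ 1 - jackson N t),
    abs_mul (jackson N t), abs_of_nonneg h0]
  refine add_le_add le_rfl ?_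
  refine (mul_le_of_le_one_left (abs_nonneg _) h1').trans ?_
  rw [abs_mul, abs_of_nonneg (by positivity : (0 : ℝ) ≤ N / 2)]
  calc (N : ℝ) / 2 * |2 * π * t - sin (2 * π * t)| ≤ N / 2 * (|2 * π * t| ^ 3 / 6) := by gcongr
    _ = 2 / 3 * (|π * N * t| * ((π * N * t) ^ 2 / N ^ 2)) := by
      rw [← sq_abs (π * N * t)]
      simp only [abs_mul, Nat.abs_cast, abs_two]
      field_simp
      ring
    _ ≤ _ := by
      have : 0 ≤ |π * N * t| * ((π * N * t) ^ 2 / N ^ 2) := by positivity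
      linarith

end

/-! ### Distance to the nearest integer, and sums of inverse powers over separated nodes. -/

section

open Real Finset

/-- The distance of a real number to the nearest integer. -/
def circ (x : ℝ) : ℝ := |x - round x|

/-- A finite set of reals whose points are `Δ`-separated modulo `1`. -/
def CircSep (Δ : ℝ) (S : Finset ℝ) : Prop := ∀ s ∈ S, ∀ s' ∈ S, s ≠ s' → Δ ≤ circ (s - s')

lemma circ_nonneg (x : ℝ) : 0 ≤ circ x := abs_nonneg _

lemma circ_le_half (x : ℝ) : circ x ≤ 1 / 2 := abs_sub_round x

lemma circ_le (x : ℝ) (n : ℤ) : circ x ≤ |x - n| := round_le x n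

lemma circ_neg (x : ℝ) : circ (-x) = circ x := by
  have h : ∀ x, circ (-x) ≤ circ x := fun x => by
    refine (circ_le (-x) (-round x)).trans (le_of_eq ?_)
    rw [circ, ← abs_neg]; congr 1; push_cast; ring
  refine le_antisymm (h x) ?_
  simpa using h (-x)

lemma circ_sub_comm (x y : ℝ) : circ (x - y) = circ (y - x) := by
  rw [← circ_neg, neg_sub]

lemma circ_add_le (x y : ℝ) : circ (x + y) ≤ circ x + circ y := by
  refine (circ_le (x + y) (round x + round y)).trans ?_
  refine le_trans (le_of_eq ?_) (abs_add_le (x - round x) (y - round y))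
  congr 1; push_cast; ring

lemma abs_sin_pi_mul (x : ℝ) : |sin (π * x)| = sin (π * circ x) := by
  have h1 : |sin (π * x)| = |sin (π * (x - round x))| := by
    have : π * (x - round x) = π * x - (round x : ℤ) * π := by ring
    rw [this, sin_sub_int_mul_pi, abs_mul, abs_zpow, abs_neg, abs_one, one_zpow, one_mul]
  have h2 : π * circ x = |π * (x - round x)| := by
    rw [abs_mul, abs_of_pos pi_pos]; rfl
  have h3 := circ_le_half x
  have h4 : |π * (x - round x)| ≤ π / 2 := by rw [← h2]; nlinarith [pi_pos]
  rw [h1, h2]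
  rcases abs_cases (π * (x - round x)) with ⟨h, h0⟩ | ⟨h, h0⟩
  · rw [h] at h4 ⊢
    rw [abs_of_nonneg]
    exact sin_nonneg_of_nonneg_of_le_pi h0 (by linarith [pi_pos])
  · rw [h] at h4 ⊢
    rw [sin_neg, abs_of_nonpos]
    exact sin_nonpos_of_nonpos_of_neg_pi_le h0.le (by linarith [pi_pos])

/-- On this range the cubic Taylor bound loses at most a relative (π/12)²/6 from the slope π, which
leaves more than 3.1. -/
lemma le_abs_sin_of_circ_le {x : ℝ} (hx : circ x ≤ 1 / 12) : 3.1 * circ x ≤ |sin (π * x)| := by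
  rw [abs_sin_pi_mul]
  have h0 := circ_nonneg x
  have hp := pi_gt_d4
  have hp' := pi_lt_d4
  refine le_trans ?_ (sin_ge_sub_cube (by positivity))
  have h1 : (π * circ x) ^ 2 ≤ 0.069 := by
    have : π * circ x ≤ 3.1416 * (1 / 12) := by gcongr
    have : 0 ≤ π * circ x := by positivity
    nlinarith
  have : (π * circ x) ^ 3 / 6 ≤ π * circ x * 0.0115 := by
    have : (π * circ x) ^ 3 = π * circ x * (π * circ x) ^ 2 := by ring
    rw [this]
    have : 0 ≤ π * circ x := by positivity
    nlinarith
  nlinarith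

lemma two_mul_circ_le_abs_sin (x : ℝ) : 2 * circ x ≤ |sin (π * x)| := by
  rw [abs_sin_pi_mul]
  have h0 := circ_nonneg x
  have h := mul_le_sin (x := π * circ x) (by positivity)
    (by have := circ_le_half x; nlinarith [pi_pos])
  have : 2 / π * (π * circ x) = 2 * circ x := by field_simp
  linarith

lemma sin_pi_ne_zero_of_circ_pos {x : ℝ} (hx : 0 < circ x) : sin (π * x) ≠ 0 := by
  have := two_mul_circ_le_abs_sin x
  intro h
  rw [h, abs_zero] at this
  linarith

/-- Nodes within 1/12 get nearly the slope π. Farther nodes use |sin πx| ≥ 2 circ x; each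
contributes at most (6/N)^p, so all of them together are negligible for large N when p ≥ 3. -/
lemma inv_abs_sin_pow_le {N : ℕ} (hN : 0 < N) {x : ℝ} (hx : 0 < circ x) (p : ℕ) :
    1 / |N * sin (π * x)| ^ p ≤ 1 / (3.1 * (N * circ x)) ^ p + (6 / N) ^ p := by
  have hN' : (0 : ℝ) < N := by positivity
  rw [abs_mul, Nat.abs_cast]
  by_cases h : circ x ≤ 1 / 12
  · have h1 := le_abs_sin_of_circ_le h
    have h2 : 1 / (N * |sin (π * x)|) ^ p ≤ 1 / (3.1 * (N * circ x)) ^ p := by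
      apply one_div_le_one_div_of_le (by positivity)
      apply pow_le_pow_left₀ (by positivity)
      nlinarith
    have : 0 ≤ (6 / (N : ℝ)) ^ p := by positivity
    linarith
  · have h1 := two_mul_circ_le_abs_sin x
    have h2 : 1 / (N * |sin (π * x)|) ^ p ≤ (6 / N) ^ p := by
      rw [div_pow, one_div_le (by have := sin_pi_ne_zero_of_circ_pos hx; positivity) (by positivity),
        one_div_div, ← div_pow]
      apply pow_le_pow_left₀ (by positivity)
      nlinarith
    have : 0 ≤ 1 / (3.1 * (N * circ x)) ^ p := by positivity
    linarith

lemma add_card_le_of_separated {ι : Type*} (F : Finset ι) (r : ι → ℝ) {a : ℝ}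
    (ha : ∀ i ∈ F, a ≤ r i) (hsep : ∀ i ∈ F, ∀ j ∈ F, i ≠ j → 1 ≤ |r i - r j|) :
    ∀ M, a ≤ M → (∀ i ∈ F, r i ≤ M - 1) → a + F.card ≤ M := by
  classical
  induction F using Finset.induction_on_max_value r with
  | empty => intro M hM _; simpa using hM
  | insert i F hi hmax ih =>
    intro M _ hM
    have h1 := ih (fun j hj => ha j (mem_insert_of_mem hj))
      (fun j hj k hk => hsep j (mem_insert_of_mem hj) k (mem_insert_of_mem hk)) (r i)
      (ha i (mem_insert_self _ _)) (fun j hj => by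
        have h2 := hsep i (mem_insert_self _ _) j (mem_insert_of_mem hj) (by rintro rfl; exact hi hj)
        rw [abs_of_nonneg (sub_nonneg.2 (hmax j hj))] at h2
        linarith)
    have h3 := hM i (mem_insert_self _ _)
    rw [card_insert_of_notMem hi]
    push_cast
    linarith

/-- A sum of a decreasing function over separated points is at most the sum over an arithmetic
progression. -/
lemma sum_le_of_separated {ι : Type*} (F : Finset ι) (r : ι → ℝ) {a : ℝ} {g : ℝ → ℝ}
    (hg : AntitoneOn g (Set.Ici a))
    (ha : ∀ i ∈ F, a ≤ r i) (hsep : ∀ i ∈ F, ∀ j ∈ F, i ≠ j → 1 ≤ |r i - r j|) :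
    ∑ i ∈ F, g (r i) ≤ ∑ k ∈ range F.card, g (a + k) := by
  classical
  induction F using Finset.induction_on_max_value r with
  | empty => simp
  | insert i F hi hmax ih =>
    have ha' : ∀ j ∈ F, a ≤ r j := fun j hj => ha j (mem_insert_of_mem hj)
    have hsep' : ∀ j ∈ F, ∀ k ∈ F, j ≠ k → 1 ≤ |r j - r k| :=
      fun j hj k hk => hsep j (mem_insert_of_mem hj) k (mem_insert_of_mem hk)
    have h1 := add_card_le_of_separated F r ha' hsep' (r i)
      (ha i (mem_insert_self _ _)) (fun j hj => by
        have h2 := hsep i (mem_insert_self _ _) j (mem_insert_of_mem hj) (by rintro rfl; exact hi hj)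
        rw [abs_of_nonneg (sub_nonneg.2 (hmax j hj))] at h2
        linarith)
    rw [card_insert_of_notMem hi, sum_insert hi, sum_range_succ, add_comm]
    have h0 : (0 : ℝ) ≤ F.card := by positivity
    exact add_le_add (ih ha' hsep') (hg (Set.mem_Ici.2 (by linarith)) (ha i (mem_insert_self _ _)) h1)

variable {N : ℕ} {S : Finset ℝ}

lemma one_le_mul_abs_sub (hN : 0 < N) (hS : CircSep (1 / N) S) (t : ℝ) {s s' : ℝ} (hs : s ∈ S)
    (hs' : s' ∈ S) (h : s ≠ s') :
    1 ≤ N * |((t - s) - round (t - s)) - ((t - s') - round (t - s'))| := by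
  have h1 := hS s hs s' hs' h
  have h2 := circ_le (s' - s) (round (t - s) - round (t - s'))
  rw [circ_sub_comm] at h1
  have h3 : |s' - s - ((round (t - s) - round (t - s') : ℤ) : ℝ)| =
      |((t - s) - round (t - s)) - ((t - s') - round (t - s'))| := by
    congr 1; push_cast; ring
  rw [h3] at h2
  have hN' : (0 : ℝ) < N := by positivity
  rw [← div_le_iff₀' hN']
  exact h1.trans h2

lemma card_le_of_circSep (hN : 0 < N) (hS : CircSep (1 / N) S) : (S.card : ℝ) ≤ N + 1 := by
  have hN' : (0 : ℝ) < N := by positivity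
  have := add_card_le_of_separated S (fun s => N * (((0 - s) - round (0 - s)) + 1 / 2)) (a := 0)
    (fun s _ => by
      have := (abs_le.1 (abs_sub_round (0 - s))).1
      have : 0 ≤ (0 - s) - round (0 - s) + 1 / 2 := by linarith
      positivity)
    (fun s hs s' hs' h => by
      have := one_le_mul_abs_sub hN hS 0 hs hs' h
      rw [← mul_sub, abs_mul, Nat.abs_cast, add_sub_add_right_eq_sub]
      exact this) (N + 1) (by positivity)
    (fun s _ => by
      have := (abs_le.1 (abs_sub_round (0 - s))).2
      have : (0 - s) - round (0 - s) + 1 / 2 ≤ 1 := by linarith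
      simp only [add_sub_cancel_right]
      exact mul_le_of_le_one_right hN'.le this)
  linarith

/-- On each side of `t` the scaled distances are 1-separated, so they are dominated by an arithmetic
progression starting at `a`; the two sides give the factor 2. -/
lemma sum_circ_le (hN : 0 < N) (hS : CircSep (1 / N) S) {t a : ℝ} {g : ℝ → ℝ}
    (hg : AntitoneOn g (Set.Ici a)) (hg0 : ∀ r, a ≤ r → 0 ≤ g r)
    (ha : ∀ s ∈ S, a ≤ N * circ (t - s)) :
    ∑ s ∈ S, g (N * circ (t - s)) ≤ 2 * ∑ k ∈ range S.card, g (a + k) := by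
  classical
  set u : ℝ → ℝ := fun s => (t - s) - round (t - s) with hu
  have key : ∀ F ⊆ S, (∀ s ∈ F, ∀ s' ∈ F, |circ (t - s) - circ (t - s')| = |u s - u s'|) →
      ∑ s ∈ F, g (N * circ (t - s)) ≤ ∑ k ∈ range S.card, g (a + k) := by
    intro F hF hFu
    refine (sum_le_of_separated F (fun s => N * circ (t - s)) hg (fun s hs => ha s (hF hs))
      (fun s hs s' hs' h => ?_)).trans ?_
    · rw [← mul_sub, abs_mul, Nat.abs_cast, hFu s hs s' hs']
      exact one_le_mul_abs_sub hN hS t (hF hs) (hF hs') h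
    · refine sum_le_sum_of_subset_of_nonneg (range_mono (card_le_card hF)) fun k _ _ => hg0 _ ?_
      have : (0 : ℝ) ≤ k := by positivity
      linarith
  rw [← sum_filter_add_sum_filter_not S (fun s => 0 ≤ u s), two_mul]
  refine add_le_add (key _ (filter_subset _ _) ?_) (key _ (filter_subset _ _) ?_)
  · intro s hs s' hs'
    have h1 : circ (t - s) = u s := abs_of_nonneg (mem_filter.1 hs).2
    have h2 : circ (t - s') = u s' := abs_of_nonneg (mem_filter.1 hs').2
    rw [h1, h2]
  · intro s hs s' hs'
    have h1 : circ (t - s) = -u s := abs_of_neg (not_le.1 (mem_filter.1 hs).2)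
    have h2 : circ (t - s') = -u s' := abs_of_neg (not_le.1 (mem_filter.1 hs').2)
    rw [h1, h2, ← abs_neg]; congr 1; ring

lemma sum_inv_sin_pow_le (hN : 0 < N) (hS : CircSep (1 / N) S) {t a : ℝ} (ha0 : 0 < a)
    (ha : ∀ s ∈ S, a ≤ N * circ (t - s)) (p : ℕ) :
    ∑ s ∈ S, 1 / |N * sin (π * (t - s))| ^ p ≤
      2 / 3.1 ^ p * ∑ k ∈ range S.card, 1 / (a + k) ^ p + (N + 1) * (6 / N) ^ p := by
  have hN' : (0 : ℝ) < N := by positivity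
  have hpos : ∀ s ∈ S, 0 < circ (t - s) := fun s hs =>
    pos_of_mul_pos_right (ha0.trans_le (ha s hs)) hN'.le
  calc ∑ s ∈ S, 1 / |N * sin (π * (t - s))| ^ p
      ≤ ∑ s ∈ S, (1 / (3.1 * (N * circ (t - s))) ^ p + (6 / N) ^ p) :=
        sum_le_sum fun s hs => inv_abs_sin_pow_le hN (hpos s hs) p
    _ = ∑ s ∈ S, 1 / (3.1 * (N * circ (t - s))) ^ p + S.card * (6 / N) ^ p := by
        rw [sum_add_distrib, sum_const, nsmul_eq_mul]
    _ ≤ 2 * ∑ k ∈ range S.card, 1 / (3.1 * (a + k)) ^ p + (N + 1) * (6 / N) ^ p := by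
        refine add_le_add ?_ (mul_le_mul_of_nonneg_right (card_le_of_circSep hN hS) (by positivity))
        refine sum_circ_le (g := fun r => 1 / (3.1 * r) ^ p) hN hS ?_ ?_ ha
        · intro x hx y _ hxy
          have : 0 < x := ha0.trans_le hx
          have : 0 < y := this.trans_le hxy
          dsimp only
          gcongr
        · intro r hr
          have : 0 < r := ha0.trans_le hr
          positivity
    _ = _ := by
        rw [mul_sum, mul_sum]
        congr 1
        refine sum_congr rfl fun k _ => ?_
        rw [mul_pow]; ring

/-- By convexity 1/y⁴ is at most its integral over [y - 1/2, y + 1/2], and these integrals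
telescope. -/
lemma sum_inv_pow_four_tail {b : ℝ} (hb : 1 / 2 < b) (n : ℕ) :
    ∑ k ∈ range n, 1 / (b + k) ^ 4 ≤ (1 / (b - 1 / 2) ^ 3 - 1 / (b + n - 1 / 2) ^ 3) / 3 := by
  induction n with
  | zero => simp
  | succ n ih =>
    rw [sum_range_succ]
    have key : ∀ y : ℝ, 1 / 2 < y → 1 / y ^ 4 ≤ (1 / (y - 1 / 2) ^ 3 - 1 / (y + 1 / 2) ^ 3) / 3 := by
      intro y hy
      obtain ⟨p, rfl⟩ : ∃ p, y = p + 1 / 2 := ⟨y - 1 / 2, by ring⟩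
      have hp : 0 < p := by linarith
      have e1 : p + 1 / 2 - 1 / 2 = p := by ring
      have e2 : p + 1 / 2 + 1 / 2 = p + 1 := by ring
      have h3 : (1 / p ^ 3 - 1 / (p + 1) ^ 3) / 3 = (p ^ 2 + p + 1 / 3) / (p * (p + 1)) ^ 3 := by
        field_simp; ring
      rw [e1, e2, h3, div_le_div_iff₀ (by positivity) (by positivity)]
      have h4 : p * (p + 1) ≤ (p + 1 / 2) ^ 2 := by linarith
      have h5 : (p * (p + 1)) ^ 3 ≤ ((p + 1 / 2) ^ 2) ^ 3 := by gcongr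
      have h6 : 0 ≤ (p + 1 / 2) ^ 4 := by positivity
      nlinarith
    have h := key (b + n) (by have : (0 : ℝ) ≤ n := by positivity
                              linarith)
    have e : b + ((n + 1 : ℕ) : ℝ) - 1 / 2 = b + n + 1 / 2 := by push_cast; ring
    rw [e]
    linarith

lemma sum_inv_pow_three_tail {b : ℝ} (hb : 1 / 2 < b) (n : ℕ) :
    ∑ k ∈ range n, 1 / (b + k) ^ 3 ≤ (1 / (b - 1 / 2) ^ 2 - 1 / (b + n - 1 / 2) ^ 2) / 2 := by
  induction n with
  | zero => simp
  | succ n ih =>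
    rw [sum_range_succ]
    have key : ∀ y : ℝ, 1 / 2 < y → 1 / y ^ 3 ≤ (1 / (y - 1 / 2) ^ 2 - 1 / (y + 1 / 2) ^ 2) / 2 := by
      intro y hy
      obtain ⟨p, rfl⟩ : ∃ p, y = p + 1 / 2 := ⟨y - 1 / 2, by ring⟩
      have hp : 0 < p := by linarith
      have e1 : p + 1 / 2 - 1 / 2 = p := by ring
      have e2 : p + 1 / 2 + 1 / 2 = p + 1 := by ring
      have h3 : (1 / p ^ 2 - 1 / (p + 1) ^ 2) / 2 = (p + 1 / 2) / (p * (p + 1)) ^ 2 := by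
        field_simp; ring
      rw [e1, e2, h3, div_le_div_iff₀ (by positivity) (by positivity)]
      have h4 : p * (p + 1) ≤ (p + 1 / 2) ^ 2 := by linarith
      have h5 : (p * (p + 1)) ^ 2 ≤ ((p + 1 / 2) ^ 2) ^ 2 := by gcongr
      linarith
    have h := key (b + n) (by have : (0 : ℝ) ≤ n := by positivity
                              linarith)
    have e : b + ((n + 1 : ℕ) : ℝ) - 1 / 2 = b + n + 1 / 2 := by push_cast; ring
    rw [e]
    linarith

/-- Keeping the two largest terms exact leaves the telescoping bound for the tail only, where it is
sharp enough. -/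
lemma sum_range_le_two_add {a : ℝ} (ha : 0 < a) (p n : ℕ) :
    ∑ k ∈ range n, 1 / (a + k) ^ p ≤
      1 / a ^ p + 1 / (a + 1) ^ p + ∑ k ∈ range n, 1 / (a + 2 + k) ^ p := by
  have h1 : ∑ k ∈ range n, 1 / (a + k) ^ p ≤ ∑ k ∈ range (n + 2), 1 / (a + k) ^ p :=
    sum_le_sum_of_subset_of_nonneg (range_mono (by omega)) fun k _ _ => by positivity
  rw [sum_range_succ', sum_range_succ'] at h1
  have h2 : ∀ k : ℕ, a + ((k + 1 + 1 : ℕ) : ℝ) = a + 2 + k := by intro k; push_cast; ring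
  simp only [h2] at h1
  norm_num at h1 ⊢
  linarith

lemma sum_inv_sin_pow_four_le (hN : 10000 ≤ N) (hS : CircSep (1 / N) S) {t a : ℝ} (ha0 : 0 < a)
    (ha : ∀ s ∈ S, a ≤ N * circ (t - s)) :
    ∑ s ∈ S, 1 / |N * sin (π * (t - s))| ^ 4 ≤
      2 / 3.1 ^ 4 * (1 / a ^ 4 + 1 / (a + 1) ^ 4 + 1 / (3 * (a + 3 / 2) ^ 3)) + 1e-8 := by
  have hN' : (10000 : ℝ) ≤ N := by exact_mod_cast hN
  refine (sum_inv_sin_pow_le (by omega) hS ha0 ha 4).trans ?_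
  have h1 := sum_range_le_two_add ha0 4 S.card
  have h2 := sum_inv_pow_four_tail (b := a + 2) (by linarith) S.card
  have h3 : 0 ≤ 1 / (a + 2 + S.card - 1 / 2) ^ 3 := by
    have : (0 : ℝ) ≤ S.card := by positivity
    have : 0 < a + 2 + S.card - 1 / 2 := by linarith
    positivity
  have h4 : (1 / (a + 2 - 1 / 2) ^ 3) / 3 = 1 / (3 * (a + 3 / 2) ^ 3) := by
    rw [div_div, mul_comm]; congr 3; ring
  refine add_le_add (mul_le_mul_of_nonneg_left (by linarith) (by norm_num)) ?_
  have : ((N : ℝ) + 1) * (6 / N) ^ 4 = 1296 * ((N + 1) / N) * (1 / N) ^ 3 := by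
    field_simp; norm_num
  rw [this]
  have h5 : ((N : ℝ) + 1) / N ≤ 2 := by rw [div_le_iff₀ (by linarith)]; linarith
  have h6 : (1 / (N : ℝ)) ^ 3 ≤ (1 / 10000) ^ 3 := by gcongr
  calc 1296 * (((N : ℝ) + 1) / N) * (1 / N) ^ 3 ≤ 1296 * 2 * (1 / 10000) ^ 3 := by gcongr
    _ ≤ _ := by norm_num

lemma sum_inv_sin_pow_three_le (hN : 10000 ≤ N) (hS : CircSep (1 / N) S) {t a : ℝ} (ha0 : 0 < a)
    (ha : ∀ s ∈ S, a ≤ N * circ (t - s)) :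
    ∑ s ∈ S, 1 / |N * sin (π * (t - s))| ^ 3 ≤
      2 / 3.1 ^ 3 * (1 / a ^ 3 + 1 / (a + 1) ^ 3 + 1 / (2 * (a + 3 / 2) ^ 2)) + 1e-5 := by
  have hN' : (10000 : ℝ) ≤ N := by exact_mod_cast hN
  refine (sum_inv_sin_pow_le (by omega) hS ha0 ha 3).trans ?_
  have h1 := sum_range_le_two_add ha0 3 S.card
  have h2 := sum_inv_pow_three_tail (b := a + 2) (by linarith) S.card
  have h3 : 0 ≤ 1 / (a + 2 + S.card - 1 / 2) ^ 2 := by positivity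
  have h4 : (1 / (a + 2 - 1 / 2) ^ 2) / 2 = 1 / (2 * (a + 3 / 2) ^ 2) := by
    rw [div_div, mul_comm]; congr 3; ring
  refine add_le_add (mul_le_mul_of_nonneg_left (by linarith) (by norm_num)) ?_
  have : ((N : ℝ) + 1) * (6 / N) ^ 3 = 216 * ((N + 1) / N) * (1 / N) ^ 2 := by
    field_simp; norm_num
  rw [this]
  have h5 : ((N : ℝ) + 1) / N ≤ 2 := by rw [div_le_iff₀ (by linarith)]; linarith
  have h6 : (1 / (N : ℝ)) ^ 2 ≤ (1 / 10000) ^ 2 := by gcongr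
  calc 216 * (((N : ℝ) + 1) / N) * (1 / N) ^ 2 ≤ 216 * 2 * (1 / 10000) ^ 2 := by gcongr
    _ ≤ _ := by norm_num

end

/-! ### The interpolation system: solvability and bounds on its coefficients. -/

section

open Real Finset

/-- Bound of `∑ 1 / |N sin (π(t - s))| ^ 4` over separated nodes at distance at least `a / N`. -/
def quarticSum (a : ℝ) : ℝ :=
  2 / 3.1 ^ 4 * (1 / a ^ 4 + 1 / (a + 1) ^ 4 + 1 / (3 * (a + 3 / 2) ^ 3)) + 1e-8

/-- Bound of `∑ 1 / |N sin (π(t - s))| ^ 3` over separated nodes at distance at least `a / N`. -/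
def cubicSum (a : ℝ) : ℝ :=
  2 / 3.1 ^ 3 * (1 / a ^ 3 + 1 / (a + 1) ^ 3 + 1 / (2 * (a + 3 / 2) ^ 2)) + 1e-5

/-- Sum of translates of the two kernels `k` and `h` with coefficients `α` and `b`. -/
def kernelSum (k h : ℝ → ℝ) (S : Finset ℝ) (α b : ℝ → ℂ) (t : ℝ) : ℂ :=
  ∑ s ∈ S, (α s * (k (t - s) : ℂ) + b s * (h (t - s) : ℂ))

lemma kernelSum_add (k h : ℝ → ℝ) (S : Finset ℝ) (α b α' b' : ℝ → ℂ) (t : ℝ) :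
    kernelSum k h S (α + α') (b + b') t = kernelSum k h S α b t + kernelSum k h S α' b' t := by
  simp only [kernelSum, ← sum_add_distrib, Pi.add_apply]
  exact sum_congr rfl fun _ _ => by ring

lemma kernelSum_smul (k h : ℝ → ℝ) (S : Finset ℝ) (α b : ℝ → ℂ) (c : ℂ) (t : ℝ) :
    kernelSum k h S (c • α) (c • b) t = c * kernelSum k h S α b t := by
  simp only [kernelSum, mul_sum, Pi.smul_apply, smul_eq_mul]
  exact sum_congr rfl fun _ _ => by ring

lemma kernelSum_eq_add_erase (k h : ℝ → ℝ) {S : Finset ℝ} (α b : ℝ → ℂ) (t : ℝ) {s : ℝ}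
    (hs : s ∈ S) : kernelSum k h S α b t =
      α s * (k (t - s) : ℂ) + b s * (h (t - s) : ℂ) + kernelSum k h (S.erase s) α b t := by
  rw [kernelSum, kernelSum, ← add_sum_erase S _ hs]

lemma kernelSum_hasDerivAt {k h k' h' : ℝ → ℝ} {c : ℝ} {S : Finset ℝ} (α b : ℝ → ℂ) {t : ℝ}
    (hk : ∀ s ∈ S, HasDerivAt k (c * k' (t - s)) (t - s))
    (hh : ∀ s ∈ S, HasDerivAt h (c * h' (t - s)) (t - s)) :
    HasDerivAt (kernelSum k h S α b) (c * kernelSum k' h' S α b t) t := by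
  unfold kernelSum
  rw [mul_sum]
  refine HasDerivAt.fun_sum fun s hs => ?_
  have h1 := ((hk s hs).comp_sub_const t s).ofReal_comp.const_mul (α s)
  have h2 := ((hh s hs).comp_sub_const t s).ofReal_comp.const_mul (b s)
  refine (h1.fun_add h2).congr_deriv ?_
  push_cast; ring

variable {N : ℕ} {S : Finset ℝ} {α b : ℝ → ℂ} {A B a t : ℝ}

lemma norm_kernelSum_le (hN : 10000 ≤ N) (hS : CircSep (1 / N) S) (ha0 : 0 < a)
    (ha : ∀ s ∈ S, a ≤ N * circ (t - s)) {k h : ℝ → ℝ} {c d : ℝ} (hc : 0 ≤ c) (hd : 0 ≤ d)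
    (hk : ∀ s ∈ S, |k (t - s)| ≤ c / |N * sin (π * (t - s))| ^ 4)
    (hh : ∀ s ∈ S, |h (t - s)| ≤ d / |N * sin (π * (t - s))| ^ 3)
    (hA0 : 0 ≤ A) (hB0 : 0 ≤ B) (hA : ∀ s ∈ S, ‖α s‖ ≤ A) (hB : ∀ s ∈ S, ‖b s‖ ≤ B) :
    ‖kernelSum k h S α b t‖ ≤ c * A * quarticSum a + d * B * cubicSum a := by
  have h4 := sum_inv_sin_pow_four_le hN hS ha0 ha
  have h3 := sum_inv_sin_pow_three_le hN hS ha0 ha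
  calc ‖kernelSum k h S α b t‖
      ≤ ∑ s ∈ S, (c * A * (1 / |N * sin (π * (t - s))| ^ 4)
          + d * B * (1 / |N * sin (π * (t - s))| ^ 3)) := by
        refine norm_sum_le_of_le _ fun s hs => (norm_add_le _ _).trans (add_le_add ?_ ?_)
        · rw [norm_mul, Complex.norm_real, norm_eq_abs]
          calc ‖α s‖ * |k (t - s)| ≤ A * (c / |N * sin (π * (t - s))| ^ 4) :=
                mul_le_mul (hA s hs) (hk s hs) (abs_nonneg _) hA0
            _ = _ := by ring
        · rw [norm_mul, Complex.norm_real, norm_eq_abs]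
          calc ‖b s‖ * |h (t - s)| ≤ B * (d / |N * sin (π * (t - s))| ^ 3) :=
                mul_le_mul (hB s hs) (hh s hs) (abs_nonneg _) hB0
            _ = _ := by ring
    _ = c * A * ∑ s ∈ S, (1 / |N * sin (π * (t - s))| ^ 4)
          + d * B * ∑ s ∈ S, (1 / |N * sin (π * (t - s))| ^ 3) := by
        rw [sum_add_distrib, mul_sum, mul_sum]
    _ ≤ _ := by
        refine add_le_add (mul_le_mul_of_nonneg_left h4 (by positivity))
          (mul_le_mul_of_nonneg_left h3 (by positivity))

lemma sin_ne_zero_of_le (hN : 10000 ≤ N) (ha0 : 0 < a) {x : ℝ} (ha : a ≤ N * circ x) :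
    sin (π * x) ≠ 0 := by
  have hN' : (0 : ℝ) < N := by have : 0 < N := by omega
                               positivity
  exact sin_pi_ne_zero_of_circ_pos (pos_of_mul_pos_right (ha0.trans_le ha) hN'.le)

lemma le_abs_mul_sin (hN : 10000 ≤ N) (ha1 : a ≤ 1) {x : ℝ} (ha : a ≤ N * circ x) :
    3.1 * a ≤ |N * sin (π * x)| := by
  have hN' : (10000 : ℝ) ≤ N := by exact_mod_cast hN
  rw [abs_mul, Nat.abs_cast]
  by_cases h : circ x ≤ 1 / 12
  · have := le_abs_sin_of_circ_le h
    nlinarith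
  · have := two_mul_circ_le_abs_sin x
    nlinarith

lemma norm_interp_le (hN : 10000 ≤ N) (hS : CircSep (1 / N) S) (ha0 : 0 < a)
    (ha : ∀ s ∈ S, a ≤ N * circ (t - s)) (hA0 : 0 ≤ A) (hB0 : 0 ≤ B)
    (hA : ∀ s ∈ S, ‖α s‖ ≤ A) (hB : ∀ s ∈ S, ‖b s‖ ≤ B) :
    ‖kernelSum (jackson N) (jacksonOdd N) S α b t‖ ≤ A * quarticSum a + B * cubicSum a := by
  have := norm_kernelSum_le hN hS ha0 ha (k := jackson N) (h := jacksonOdd N) zero_le_one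
    zero_le_one (fun s hs => by
      rw [abs_of_nonneg (jackson_nonneg _ _)]
      exact jackson_le (by omega) (sin_ne_zero_of_le hN ha0 (ha s hs)))
    (fun s hs => abs_jacksonOdd_le (by omega) (sin_ne_zero_of_le hN ha0 (ha s hs))) hA0 hB0 hA hB
  simpa using this

lemma norm_interpD_le (hN : 10000 ≤ N) (hS : CircSep (1 / N) S)
    (ha : ∀ s ∈ S, 1 ≤ N * circ (t - s)) (hA0 : 0 ≤ A) (hB0 : 0 ≤ B)
    (hA : ∀ s ∈ S, ‖α s‖ ≤ A) (hB : ∀ s ∈ S, ‖b s‖ ≤ B) :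
    ‖kernelSum (jacksonD N) (jacksonOddD N) S α b t‖ ≤
      2.8 * A * quarticSum 1 + 2.57 * B * cubicSum 1 :=
  norm_kernelSum_le hN hS one_pos ha (by norm_num) (by norm_num)
    (fun s hs => abs_jacksonD_le (by simpa using le_abs_mul_sin hN le_rfl (ha s hs)))
    (fun s hs => abs_jacksonOddD_le (by omega) (by simpa using le_abs_mul_sin hN le_rfl (ha s hs)))
    hA0 hB0 hA hB

lemma norm_interpDD_le (hN : 10000 ≤ N) (hS : CircSep (1 / N) S)
    (ha : ∀ s ∈ S, 0.75 ≤ N * circ (t - s)) (hA0 : 0 ≤ A) (hB0 : 0 ≤ B)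
    (hA : ∀ s ∈ S, ‖α s‖ ≤ A) (hB : ∀ s ∈ S, ‖b s‖ ≤ B) :
    ‖kernelSum (jacksonDD N) (jacksonOddDD N) S α b t‖ ≤
      9.1 * A * quarticSum 0.75 + 7 * B * cubicSum 0.75 := by
  have hx : ∀ s ∈ S, 2.325 ≤ |N * sin (π * (t - s))| := fun s hs => by
    have := le_abs_mul_sin hN (by norm_num) (ha s hs)
    norm_num at this ⊢
    linarith
  exact norm_kernelSum_le hN hS (by norm_num) ha (by norm_num) (by norm_num)
    (fun s hs => abs_jacksonDD_le (by omega) (hx s hs))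
    (fun s hs => abs_jacksonOddDD_le (by omega) (hx s hs)) hA0 hB0 hA hB

lemma CircSep.mono {Δ : ℝ} {S S' : Finset ℝ} (hS : CircSep Δ S) (h : S' ⊆ S) : CircSep Δ S' :=
  fun s hs s' hs' => hS s (h hs) s' (h hs')

/-- The other nodes are far from a point close to the node `s₀`. -/
lemma le_circ_of_erase (hN : 0 < N) (hS : CircSep (1 / N) S) {s₀ : ℝ} (hs₀ : s₀ ∈ S)
    (ht : N * circ (t - s₀) ≤ 1 - a) : ∀ s ∈ S.erase s₀, a ≤ N * circ (t - s) := by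
  intro s hs
  have hN' : (0 : ℝ) < N := by positivity
  have h1 := hS s (mem_of_mem_erase hs) s₀ hs₀ (ne_of_mem_erase hs)
  have h2 := circ_add_le (s - t) (t - s₀)
  rw [sub_add_sub_cancel, circ_sub_comm s t] at h2
  rw [div_le_iff₀' hN'] at h1
  nlinarith

lemma exists_preimage_of_near_id {E : Type*} [NormedAddCommGroup E] [NormedSpace ℂ E]
    [FiniteDimensional ℂ E] (L : E →ₗ[ℂ] E) (hL : ∀ x, ‖x - L x‖ ≤ 1 / 2 * ‖x‖) (y : E) :
    ∃ x, L x = y := by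
  refine LinearMap.injective_iff_surjective.1 ?_ y
  rw [injective_iff_map_eq_zero]
  intro x hx
  have := hL x
  rw [hx, sub_zero] at this
  exact norm_eq_zero.1 (by linarith [norm_nonneg x])

lemma quarticSum_one : quarticSum 1 ≤ 0.0236 := by norm_num [quarticSum]
lemma cubicSum_one : cubicSum 1 ≤ 0.0815 := by norm_num [cubicSum]
lemma quarticSum_threeQuarters : quarticSum 0.75 ≤ 0.0715 := by norm_num [quarticSum]
lemma cubicSum_threeQuarters : cubicSum 0.75 ≤ 0.179 := by norm_num [cubicSum]
lemma quarticSum_far : quarticSum 0.65 ≤ 0.126 := by norm_num [quarticSum]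
lemma cubicSum_far : cubicSum 0.65 ≤ 0.268 := by norm_num [cubicSum]
lemma quarticSum_half : quarticSum (1 / 2) ≤ 0.352 := by norm_num [quarticSum]
lemma cubicSum_half : cubicSum (1 / 2) ≤ 0.567 := by norm_num [cubicSum]

lemma le_circ_node (hN : 0 < N) (hS : CircSep (1 / N) S) {s₀ : ℝ} (hs₀ : s₀ ∈ S) :
    ∀ s ∈ S.erase s₀, 1 ≤ N * circ (s₀ - s) :=
  le_circ_of_erase hN hS hs₀ (by simp [circ])

/-- Solvability of the interpolation system. -/
lemma exists_interp_coeff (hN : 10000 ≤ N) (hS : CircSep (1 / N) S) (v w : ℝ → ℂ) :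
    ∃ α b : ℝ → ℂ, ∀ s ∈ S,
      α s + kernelSum (jackson N) (jacksonOdd N) (S.erase s) α b s = v s ∧
      b s + kernelSum (jacksonD N) (jacksonOddD N) (S.erase s) α b s = w s := by
  -- Coefficients are functions on ℝ in `kernelSum`, but finite dimension requires functions on the
  -- nodes; extension by zero links the two.
  let X := Function.ExtendByZero.linearMap ℂ (Subtype.val : S → ℝ)
  have hX : ∀ (x : S → ℂ) (s : S), X x s = x s := fun x s =>
    Subtype.val_injective.extend_apply _ _ _
  let L : ((S → ℂ) × (S → ℂ)) →ₗ[ℂ] ((S → ℂ) × (S → ℂ)) :=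
    { toFun := fun x =>
        (fun i => x.1 i + kernelSum (jackson N) (jacksonOdd N) (S.erase i) (X x.1) (X x.2) i,
          fun i => x.2 i + kernelSum (jacksonD N) (jacksonOddD N) (S.erase i) (X x.1) (X x.2) i)
      map_add' := fun x y => by
        ext i <;> simp only [Prod.fst_add, Prod.snd_add, Pi.add_apply, map_add, kernelSum_add] <;>
          ring
      map_smul' := fun c x => by
        ext i <;> simp only [Prod.smul_fst, Prod.smul_snd, Pi.smul_apply, map_smul,
          kernelSum_smul, smul_eq_mul, RingHom.id_apply] <;> ring }
  -- In the sup norm the off-diagonal part has norm at most max(0.0236 + 0.0815, 2.8 · 0.0236 + 2.57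
  -- · 0.0815) < 1/2.
  obtain ⟨x, hx⟩ := exists_preimage_of_near_id L (fun x => by
    have h1 : ∀ s ∈ S, ‖X x.1 s‖ ≤ ‖x‖ := fun s hs => by
      rw [hX x.1 ⟨s, hs⟩]
      exact (norm_le_pi_norm x.1 _).trans (norm_fst_le x)
    have h2 : ∀ s ∈ S, ‖X x.2 s‖ ≤ ‖x‖ := fun s hs => by
      rw [hX x.2 ⟨s, hs⟩]
      exact (norm_le_pi_norm x.2 _).trans (norm_snd_le x)
    have h4 := quarticSum_one
    have h3 := cubicSum_one
    have hx0 := norm_nonneg x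
    refine norm_prod_le_iff.2 ⟨?_, ?_⟩
    · refine (pi_norm_le_iff_of_nonneg (by positivity)).2 fun i => ?_
      have := norm_interp_le hN (hS.mono (erase_subset _ _)) one_pos
        (le_circ_node (by omega) hS i.2) hx0 hx0
        (fun s hs => h1 s (mem_of_mem_erase hs)) (fun s hs => h2 s (mem_of_mem_erase hs))
      simp only [L, LinearMap.coe_mk, AddHom.coe_mk, Prod.fst_sub, Pi.sub_apply, sub_add_cancel_left,
        norm_neg]
      refine this.trans ?_
      nlinarith
    · refine (pi_norm_le_iff_of_nonneg (by positivity)).2 fun i => ?_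
      have := norm_interpD_le hN (hS.mono (erase_subset _ _))
        (le_circ_node (by omega) hS i.2) hx0 hx0
        (fun s hs => h1 s (mem_of_mem_erase hs)) (fun s hs => h2 s (mem_of_mem_erase hs))
      simp only [L, LinearMap.coe_mk, AddHom.coe_mk, Prod.snd_sub, Pi.sub_apply, sub_add_cancel_left,
        norm_neg]
      refine this.trans ?_
      nlinarith) (fun i => v i, fun i => w i)
  refine ⟨X x.1, X x.2, fun s hs => ?_⟩
  have h1 := congrFun (congrArg Prod.fst hx) ⟨s, hs⟩
  have h2 := congrFun (congrArg Prod.snd hx) ⟨s, hs⟩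
  simp only [L, LinearMap.coe_mk, AddHom.coe_mk] at h1 h2
  rw [hX x.1 ⟨s, hs⟩, hX x.2 ⟨s, hs⟩]
  exact ⟨h1, h2⟩

/-- A priori bounds for the coefficients of the interpolation problem. -/
lemma interp_coeff_bound (hN : 10000 ≤ N) (hS : CircSep (1 / N) S) {v w : ℝ → ℂ} {V W : ℝ}
    (hv : ∀ s ∈ S, ‖v s‖ ≤ V) (hw : ∀ s ∈ S, ‖w s‖ ≤ W) (hV : 0 ≤ V) (hW : 0 ≤ W)
    (h : ∀ s ∈ S, α s + kernelSum (jackson N) (jacksonOdd N) (S.erase s) α b s = v s ∧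
      b s + kernelSum (jacksonD N) (jacksonOddD N) (S.erase s) α b s = w s) :
    ∃ A B : ℝ, 0 ≤ A ∧ 0 ≤ B ∧ (∀ s ∈ S, ‖α s‖ ≤ A) ∧ (∀ s ∈ S, ‖b s‖ ≤ B) ∧
      A ≤ V + (0.0236 * A + 0.0815 * B) ∧ B ≤ W + (0.0661 * A + 0.2096 * B) ∧
      ∀ s ∈ S, ‖v s - α s‖ ≤ 0.0236 * A + 0.0815 * B := by
  rcases S.eq_empty_or_nonempty with rfl | hne
  · exact ⟨0, 0, by simp [hV, hW]⟩
  -- Taking `A` and `B` as attained maxima of the two coefficient families lets each equation, read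
  -- at its maximizer, bound the maximum in terms of `A` and `B` themselves.
  obtain ⟨s₁, hs₁, h₁⟩ := S.exists_max_image (fun s => ‖α s‖) hne
  obtain ⟨s₂, hs₂, h₂⟩ := S.exists_max_image (fun s => ‖b s‖) hne
  have h4 := quarticSum_one
  have h3 := cubicSum_one
  have hA0 := norm_nonneg (α s₁)
  have hB0 := norm_nonneg (b s₂)
  have e1 : ∀ s ∈ S, ‖kernelSum (jackson N) (jacksonOdd N) (S.erase s) α b s‖ ≤
      0.0236 * ‖α s₁‖ + 0.0815 * ‖b s₂‖ := fun s hs => by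
    refine (norm_interp_le hN (hS.mono (erase_subset _ _)) one_pos
      (le_circ_node (by omega) hS hs) hA0 hB0 (fun r hr => h₁ r (mem_of_mem_erase hr))
      (fun r hr => h₂ r (mem_of_mem_erase hr))).trans ?_
    nlinarith
  have e2 : ∀ s ∈ S, ‖kernelSum (jacksonD N) (jacksonOddD N) (S.erase s) α b s‖ ≤
      0.0661 * ‖α s₁‖ + 0.2096 * ‖b s₂‖ := fun s hs => by
    refine (norm_interpD_le hN (hS.mono (erase_subset _ _))
      (le_circ_node (by omega) hS hs) hA0 hB0 (fun r hr => h₁ r (mem_of_mem_erase hr))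
      (fun r hr => h₂ r (mem_of_mem_erase hr))).trans ?_
    nlinarith
  refine ⟨‖α s₁‖, ‖b s₂‖, hA0, hB0, h₁, h₂, ?_, ?_, ?_⟩
  · rw [eq_sub_of_add_eq (h s₁ hs₁).1]
    refine (norm_sub_le _ _).trans (add_le_add (hv _ hs₁) ?_)
    rw [← eq_sub_of_add_eq (h s₁ hs₁).1]
    exact e1 _ hs₁
  · rw [eq_sub_of_add_eq (h s₂ hs₂).2]
    refine (norm_sub_le _ _).trans (add_le_add (hw _ hs₂) ?_)
    rw [← eq_sub_of_add_eq (h s₂ hs₂).2]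
    exact e2 _ hs₂
  · intro s hs
    rw [← (h s hs).1, add_sub_cancel_left]
    exact e1 s hs

/-- Second order Taylor estimate on the unit interval. -/
lemma norm_sub_sub_le_of_deriv2 {g g₁ g₂ : ℝ → ℂ} {M : ℝ}
    (h1 : ∀ θ ∈ Set.Icc (0 : ℝ) 1, HasDerivAt g (g₁ θ) θ)
    (h2 : ∀ θ ∈ Set.Icc (0 : ℝ) 1, HasDerivAt g₁ (g₂ θ) θ)
    (hM : ∀ θ ∈ Set.Icc (0 : ℝ) 1, ‖g₂ θ‖ ≤ M) : ‖g 1 - g 0 - g₁ 0‖ ≤ M / 2 := by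
  have hd : ∀ θ ∈ Set.Icc (0 : ℝ) 1, ‖g₁ θ - g₁ 0‖ ≤ M * θ := by
    intro θ hθ
    have := (convex_Icc (0 : ℝ) 1).norm_image_sub_le_of_norm_hasDerivWithin_le
      (fun x hx => (h2 x hx).hasDerivWithinAt) hM (Set.left_mem_Icc.2 zero_le_one) hθ
    rwa [sub_zero, norm_of_nonneg hθ.1] at this
  have hf : ∀ θ ∈ Set.Icc (0 : ℝ) 1,
      HasDerivAt (fun θ : ℝ => g θ - g 0 - θ * g₁ 0) (g₁ θ - g₁ 0) θ := by
    intro θ hθ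
    have h3 : HasDerivAt (fun θ : ℝ => (θ : ℂ) * g₁ 0) (g₁ 0) θ := by
      simpa using (Complex.ofRealCLM.hasDerivAt (x := θ)).mul_const (g₁ 0)
    exact ((h1 θ hθ).sub_const _).sub h3
  have hB : ∀ θ : ℝ, HasDerivAt (fun θ : ℝ => M * θ ^ 2 / 2) (M * θ) θ := by
    intro θ
    refine (((hasDerivAt_pow 2 θ).const_mul M).div_const 2).congr_deriv ?_
    simp only [Nat.reduceSub]; push_cast; ring
  have := image_norm_le_of_norm_deriv_right_le_deriv_boundary
    (f := fun θ : ℝ => g θ - g 0 - θ * g₁ 0) (f' := fun θ => g₁ θ - g₁ 0) (a := 0) (b := 1)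
    (fun θ hθ => (hf θ hθ).continuousAt.continuousWithinAt)
    (fun θ hθ => (hf θ (Set.Ico_subset_Icc_self hθ)).hasDerivWithinAt)
    (B := fun θ : ℝ => M * θ ^ 2 / 2) (by simp) hB
    (fun θ hθ => hd θ (Set.Ico_subset_Icc_self hθ)) (Set.right_mem_Icc.2 zero_le_one)
  simpa using this

lemma interp_mem {n : ℕ} (S : Finset ℝ) (α b : ℝ → ℂ) :
    kernelSum (jackson (n + 1)) (jacksonOdd (n + 1)) S α b ∈ TrigPoly (2 * n + 1) := by
  have : kernelSum (jackson (n + 1)) (jacksonOdd (n + 1)) S α b =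
      ∑ s ∈ S, (α s • (fun t => ((jackson (n + 1) (t - s) : ℝ) : ℂ)) +
        b s • (fun t => ((jacksonOdd (n + 1) (t - s) : ℝ) : ℂ))) := by
    ext t; simp [kernelSum]
  rw [this]
  exact Submodule.sum_mem _ fun s _ => Submodule.add_mem _
    (Submodule.smul_mem _ _ (TrigPoly_mono (by omega) (TrigPoly_comp_sub (jackson_mem n) s)))
    (Submodule.smul_mem _ _ (TrigPoly_comp_sub (jacksonOdd_mem n) s))

end

/-! ### Hermite interpolation and the dual certificate for large N. -/

section

open Real Finset

variable {N : ℕ} {S : Finset ℝ} {α b : ℝ → ℂ} {A B : ℝ}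

lemma interp_hasDerivAt_node (hN : 10000 ≤ N) (hS : CircSep (1 / N) S) {s₀ : ℝ} (hs₀ : s₀ ∈ S) :
    HasDerivAt (kernelSum (jackson N) (jacksonOdd N) S α b)
      (π * N * (b s₀ + kernelSum (jacksonD N) (jacksonOddD N) (S.erase s₀) α b s₀)) s₀ := by
  have hN0 : 0 < N := by omega
  have h1 : HasDerivAt (fun t => α s₀ * (jackson N (t - s₀) : ℂ)) 0 s₀ := by
    have h := hasDerivAt_jackson_zero hN0
    rw [← sub_self s₀] at h
    simpa using ((h.comp_sub_const s₀ s₀).ofReal_comp).const_mul (α s₀)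
  have h2 : HasDerivAt (fun t => b s₀ * (jacksonOdd N (t - s₀) : ℂ)) (b s₀ * (π * N : ℝ)) s₀ := by
    have h := hasDerivAt_jacksonOdd_zero hN0
    rw [← sub_self s₀] at h
    exact ((h.comp_sub_const s₀ s₀).ofReal_comp).const_mul (b s₀)
  have hne : ∀ s ∈ S.erase s₀, sin (π * (s₀ - s)) ≠ 0 := fun s hs =>
    sin_ne_zero_of_le hN one_pos (le_circ_node hN0 hS hs₀ s hs)
  have h3 := kernelSum_hasDerivAt (c := π * N) α b
    (fun s hs => hasDerivAt_jackson hN0 (hne s hs))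
    (fun s hs => hasDerivAt_jacksonOdd hN0 (hne s hs))
  have h4 := (h1.fun_add h2).fun_add h3
  refine (h4.congr_of_eventuallyEq (Filter.Eventually.of_forall fun t =>
    kernelSum_eq_add_erase _ _ α b t hs₀)).congr_deriv ?_
  push_cast; ring

lemma interp_node (hN : 10000 ≤ N) {s₀ : ℝ} (hs₀ : s₀ ∈ S) :
    kernelSum (jackson N) (jacksonOdd N) S α b s₀ =
      α s₀ + kernelSum (jackson N) (jacksonOdd N) (S.erase s₀) α b s₀ := by
  rw [kernelSum_eq_add_erase _ _ α b _ hs₀, sub_self, jackson_zero (by omega), jacksonOdd_zero]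
  simp

lemma norm_interp_near_le (hN : 10000 ≤ N) (hS : CircSep (1 / N) S) {s₀ : ℝ} (hs₀ : s₀ ∈ S)
    (hA0 : 0 ≤ A) (hB0 : 0 ≤ B) (hA : ∀ s ∈ S, ‖α s‖ ≤ A) (hB : ∀ s ∈ S, ‖b s‖ ≤ B)
    {t a K : ℝ} (ha0 : 0 < a) (ht : N * circ (t - s₀) ≤ 1 - a) (hK : jackson N (t - s₀) ≤ K) :
    ‖kernelSum (jackson N) (jacksonOdd N) S α b t‖ ≤
      A * K + B + (A * quarticSum a + B * cubicSum a) := by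
  rw [kernelSum_eq_add_erase _ _ α b _ hs₀]
  refine (norm_add_le _ _).trans (add_le_add ((norm_add_le _ _).trans (add_le_add ?_ ?_)) ?_)
  · rw [norm_mul, Complex.norm_real, norm_eq_abs, abs_of_nonneg (jackson_nonneg _ _)]
    exact mul_le_mul (hA _ hs₀) hK (jackson_nonneg _ _) hA0
  · rw [norm_mul, Complex.norm_real, norm_eq_abs]
    calc ‖b s₀‖ * |jacksonOdd N (t - s₀)| ≤ B * 1 :=
          mul_le_mul (hB _ hs₀) (abs_jacksonOdd_le_one (by omega)) (abs_nonneg _) hB0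
      _ = B := mul_one B
  · exact norm_interp_le hN (hS.mono (erase_subset _ _)) ha0
      (le_circ_of_erase (by omega) hS hs₀ ht) hA0 hB0
      (fun s hs => hA s (mem_of_mem_erase hs)) (fun s hs => hB s (mem_of_mem_erase hs))

lemma norm_interp_global_le (hN : 10000 ≤ N) (hS : CircSep (1 / N) S)
    (hA0 : 0 ≤ A) (hB0 : 0 ≤ B) (hA : ∀ s ∈ S, ‖α s‖ ≤ A) (hB : ∀ s ∈ S, ‖b s‖ ≤ B) (t : ℝ) :
    ‖kernelSum (jackson N) (jacksonOdd N) S α b t‖ ≤ A + B + (0.352 * A + 0.567 * B) := by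
  have h4 := quarticSum_half
  have h3 := cubicSum_half
  -- Either one node is within 1/2 after scaling, and the separation puts all others at distance at
  -- least 1/2, or every node is that far.
  by_cases h : ∃ s₀ ∈ S, N * circ (t - s₀) < 1 / 2
  · obtain ⟨s₀, hs₀, h⟩ := h
    refine (norm_interp_near_le hN hS hs₀ hA0 hB0 hA hB (a := 1 / 2) (K := 1) (by norm_num)
      (by linarith) (jackson_le_one _ _)).trans ?_
    nlinarith
  · push Not at h
    refine (norm_interp_le hN hS (by norm_num : (0 : ℝ) < 1 / 2) h hA0 hB0 hA hB).trans ?_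
    nlinarith

/-- Hermite interpolation by trigonometric polynomials at separated nodes. -/
theorem exists_interp {n : ℕ} (hn : 10000 ≤ n + 1) {S : Finset ℝ}
    (hS : CircSep (1 / (n + 1 : ℕ)) S) {v w : ℝ → ℂ} {M : ℝ} (hM : 0 ≤ M)
    (hv : ∀ s ∈ S, ‖v s‖ ≤ M) (hw : ∀ s ∈ S, ‖w s‖ ≤ M) :
    ∃ P ∈ TrigPoly (2 * n + 1), (∀ t, ‖P t‖ ≤ 4 * M) ∧
      ∀ s ∈ S, P s = v s ∧ HasDerivAt P (π * (n + 1 : ℕ) * w s) s := by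
  obtain ⟨α, b, h⟩ := exists_interp_coeff hn hS v w
  obtain ⟨A, B, hA0, hB0, hA, hB, h1, h2, -⟩ := interp_coeff_bound hn hS hv hw hM hM h
  refine ⟨_, interp_mem S α b, fun t => ?_, fun s hs => ⟨?_, ?_⟩⟩
  -- The two coefficient inequalities give A ≤ 1.14 M and B ≤ 1.37 M, so the bound is below 4 M.
  · refine (norm_interp_global_le hn hS hA0 hB0 hA hB t).trans ?_
    linarith
  · rw [interp_node hn hs, (h s hs).1]
  · have := interp_hasDerivAt_node (α := α) (b := b) hn hS hs
    rwa [(h s hs).2] at this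

/-- Near a node, the interpolating polynomial of unimodular data drops below one quadratically. -/
lemma norm_interp_quadratic_le (hN : 10000 ≤ N) (hS : CircSep (1 / N) S) {s₀ : ℝ} (hs₀ : s₀ ∈ S)
    (hA : ∀ s ∈ S, ‖α s‖ ≤ 1.0316) (hB : ∀ s ∈ S, ‖b s‖ ≤ 0.0864) {v : ℂ} (hv : ‖v‖ = 1)
    (hva : ‖v - α s₀‖ ≤ 0.0315)
    (h1 : α s₀ + kernelSum (jackson N) (jacksonOdd N) (S.erase s₀) α b s₀ = v)
    (h2 : b s₀ + kernelSum (jacksonD N) (jacksonOddD N) (S.erase s₀) α b s₀ = 0)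
    {τ : ℝ} (hτ : N * |τ| ≤ 1 / 4) :
    ‖kernelSum (jackson N) (jacksonOdd N) S α b (s₀ + τ)‖ ≤ 1 - 0.05 * (π * N * τ) ^ 2 := by
  have hN0 : 0 < N := by omega
  have hN' : (10000 : ℝ) ≤ N := by exact_mod_cast hN
  have hfar : ∀ θ ∈ Set.Icc (0 : ℝ) 1, ∀ s ∈ S.erase s₀, 0.75 ≤ N * circ (s₀ + θ * τ - s) := by
    intro θ hθ
    refine le_circ_of_erase hN0 hS hs₀ ?_
    have h3 := circ_le (s₀ + θ * τ - s₀) 0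
    have h4 : |s₀ + θ * τ - s₀ - (0 : ℤ)| ≤ |τ| := by
      rw [Int.cast_zero, sub_zero, add_sub_cancel_left, abs_mul, abs_of_nonneg hθ.1]
      exact mul_le_of_le_one_left (abs_nonneg _) hθ.2
    have : N * circ (s₀ + θ * τ - s₀) ≤ N * |τ| := by gcongr; exact h3.trans h4
    norm_num at this ⊢
    linarith
  have hne : ∀ θ ∈ Set.Icc (0 : ℝ) 1, ∀ s ∈ S.erase s₀, sin (π * (s₀ + θ * τ - s)) ≠ 0 :=
    fun θ hθ s hs => sin_ne_zero_of_le hN (by norm_num) (hfar θ hθ s hs)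
  have hlin : ∀ θ : ℝ, HasDerivAt (fun θ : ℝ => s₀ + θ * τ) τ θ := fun θ => by
    simpa using ((hasDerivAt_id θ).mul_const τ).const_add s₀
  set R := kernelSum (jackson N) (jacksonOdd N) (S.erase s₀) α b with hR
  set D := kernelSum (jacksonD N) (jacksonOddD N) (S.erase s₀) α b with hD
  set E := kernelSum (jacksonDD N) (jacksonOddDD N) (S.erase s₀) α b with hE
  set X := π * N * τ with hX
  -- Second-order Taylor estimate for the contribution `R` of the other nodes. The constant 0.7803
  -- bounds 9.1 · 1.0316 · 0.0715 + 7 · 0.0864 · 0.179.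
  have hT := norm_sub_sub_le_of_deriv2 (g := fun θ => R (s₀ + θ * τ))
    (g₁ := fun θ => X * D (s₀ + θ * τ)) (g₂ := fun θ => X ^ 2 * E (s₀ + θ * τ))
    (M := X ^ 2 * 0.7803) (fun θ hθ => by
      have := (kernelSum_hasDerivAt (c := π * N) α b
        (fun s hs => hasDerivAt_jackson hN0 (hne θ hθ s hs))
        (fun s hs => hasDerivAt_jacksonOdd hN0 (hne θ hθ s hs))).scomp θ (hlin θ)
      refine this.congr_deriv ?_
      rw [hX, Complex.real_smul]; push_cast; ring)
    (fun θ hθ => by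
      have := ((kernelSum_hasDerivAt (c := π * N) α b
        (fun s hs => hasDerivAt_jacksonD hN0 (hne θ hθ s hs))
        (fun s hs => hasDerivAt_jacksonOddD hN0 (hne θ hθ s hs))).scomp θ (hlin θ)).const_mul (X : ℂ)
      refine this.congr_deriv ?_
      rw [hX, Complex.real_smul]; push_cast; ring)
    (fun θ hθ => by
      rw [norm_mul, norm_pow, Complex.norm_real, norm_eq_abs, sq_abs]
      gcongr
      refine (norm_interpDD_le hN (hS.mono (erase_subset _ _)) (hfar θ hθ) (by norm_num)
        (by norm_num) (fun s hs => hA s (mem_of_mem_erase hs))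
        (fun s hs => hB s (mem_of_mem_erase hs))).trans ?_
      have h4 := quarticSum_threeQuarters
      have h3 := cubicSum_threeQuarters
      norm_num at h3 h4 ⊢
      linarith)
  simp only [one_mul, zero_mul, add_zero] at hT
  have hb : D s₀ = -b s₀ := by linear_combination h2
  have hr : R s₀ = v - α s₀ := by linear_combination h1
  rw [hb, hr] at hT
  -- The interpolation conditions read R(s₀) = v - α and D(s₀) = -b, so the linear terms of the odd
  -- kernel and of `R` cancel. Every summand after the first is then quadratic in X or bounded by a
  -- multiple of 1 - K, with K the Jackson kernel. The gain 0.528 X² of K, reduced by these small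
  -- multiples, still exceeds the Taylor loss 0.3902 X² by more than 0.05 X².
  have hdec : kernelSum (jackson N) (jacksonOdd N) S α b (s₀ + τ) =
      v * (jackson N τ : ℂ) + (v - α s₀) * ((1 - jackson N τ : ℝ) : ℂ)
        + b s₀ * ((jacksonOdd N τ - X : ℝ) : ℂ)
        + (R (s₀ + τ) - (v - α s₀) - X * -b s₀) := by
    rw [kernelSum_eq_add_erase _ _ α b _ hs₀, add_sub_cancel_left]
    push_cast; ring
  have hK0 := jackson_nonneg N τ
  have hK1 := jackson_le_one N τ
  have hK := jackson_le_near hN hτ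
  have hH := abs_jacksonOdd_sub_le (t := τ) hN0
  rw [← hX] at hK hH
  have hXle : |X| ≤ 0.7855 := by
    rw [hX, abs_mul, abs_mul, Nat.abs_cast, abs_of_pos pi_pos, mul_assoc]
    have h0 : 0 ≤ N * |τ| := by positivity
    nlinarith [pi_lt_d4, pi_pos]
  have hH' : |jacksonOdd N τ - X| ≤ 0.7855 * (1 - jackson N τ) + 0.001 * X ^ 2 := by
    refine hH.trans (add_le_add (mul_le_mul_of_nonneg_right hXle (by linarith)) ?_)
    have h5 : X ^ 2 / (N : ℝ) ^ 2 ≤ X ^ 2 * 0.0001 := by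
      rw [div_le_iff₀ (by positivity)]
      have : 1 ≤ 0.0001 * (N : ℝ) ^ 2 := by nlinarith
      nlinarith [sq_nonneg X]
    have h6 : 0 ≤ X ^ 2 / (N : ℝ) ^ 2 := by positivity
    nlinarith [abs_nonneg X, sq_nonneg X]
  rw [hdec]
  have n1 : ‖v * (jackson N τ : ℂ)‖ = jackson N τ := by
    rw [norm_mul, hv, one_mul, Complex.norm_real, norm_of_nonneg hK0]
  have n2 : ‖(v - α s₀) * ((1 - jackson N τ : ℝ) : ℂ)‖ ≤ 0.0315 * (1 - jackson N τ) := by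
    rw [norm_mul, Complex.norm_real, norm_of_nonneg (by linarith)]
    exact mul_le_mul_of_nonneg_right hva (by linarith)
  have n3 : ‖b s₀ * ((jacksonOdd N τ - X : ℝ) : ℂ)‖ ≤
      0.0864 * (0.7855 * (1 - jackson N τ) + 0.001 * X ^ 2) := by
    rw [norm_mul, Complex.norm_real, norm_eq_abs]
    exact mul_le_mul (hB _ hs₀) hH' (abs_nonneg _) (by norm_num)
  have n4 := norm_add_le (v * (jackson N τ : ℂ) + (v - α s₀) * ((1 - jackson N τ : ℝ) : ℂ)
        + b s₀ * ((jacksonOdd N τ - X : ℝ) : ℂ)) (R (s₀ + τ) - (v - α s₀) - X * -b s₀)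
  have n5 := norm_add₃_le (a := v * (jackson N τ : ℂ))
    (b := (v - α s₀) * ((1 - jackson N τ : ℝ) : ℂ)) (c := b s₀ * ((jacksonOdd N τ - X : ℝ) : ℂ))
  refine n4.trans ((add_le_add (n5.trans (add_le_add (add_le_add n1.le n2) n3)) hT).trans ?_)
  norm_num at hK ⊢
  nlinarith [sq_nonneg X]

/-- The dual certificate: a trigonometric polynomial interpolating unimodular data at separated
nodes, of modulus less than one elsewhere. -/
theorem exists_certificate {n : ℕ} (hn : 10000 ≤ n + 1) {S : Finset ℝ}
    (hS : CircSep (1 / (n + 1 : ℕ)) S) {v : ℝ → ℂ} (hv : ∀ s ∈ S, ‖v s‖ = 1) :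
    ∃ q ∈ TrigPoly (2 * n + 1), (∀ s ∈ S, q s = v s) ∧
      ∀ t w : ℝ, w ≤ 1 → (∀ s ∈ S, w ≤ ((n + 1 : ℕ) * circ (t - s)) ^ 2) →
        ‖q t‖ ≤ 1 - 0.04 * w := by
  obtain ⟨α, b, h⟩ := exists_interp_coeff hn hS v 0
  obtain ⟨A, B, hA0, hB0, hA, hB, h1, h2, h3⟩ := interp_coeff_bound hn hS (V := 1) (W := 0)
    (fun s hs => (hv s hs).le) (by simp) zero_le_one le_rfl h
  -- Obtained by solving the two coefficient inequalities with V = 1 and W = 0.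
  have hA1 : A ≤ 1.0316 := by linarith
  have hB1 : B ≤ 0.0864 := by linarith
  refine ⟨_, interp_mem S α b, fun s hs => ?_, fun t w hw hwS => ?_⟩
  · rw [interp_node hn hs, (h s hs).1]
  have hfin : ∀ s₀ ∈ S, ∀ r a K : ℝ, 0 < a → (n + 1 : ℕ) * circ (r - s₀) ≤ 1 - a →
      jackson (n + 1) (r - s₀) ≤ K → 0 ≤ K →
      1.0316 * K + 0.0864 + (1.0316 * quarticSum a + 0.0864 * cubicSum a) ≤ 0.96 →
      ‖kernelSum (jackson (n + 1)) (jacksonOdd (n + 1)) S α b r‖ ≤ 0.96 := by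
    intro s₀ hs₀ r a K ha hr hK hK0 hle
    refine (norm_interp_near_le hn hS hs₀ (by norm_num) (by norm_num)
      (fun s hs => (hA s hs).trans hA1) (fun s hs => (hB s hs).trans hB1) ha hr hK).trans hle
  by_cases hnear : ∃ s₀ ∈ S, (n + 1 : ℕ) * circ (t - s₀) < 1 / 2
  · obtain ⟨s₀, hs₀, hlt⟩ := hnear
    have hper : kernelSum (jackson (n + 1)) (jacksonOdd (n + 1)) S α b t =
        kernelSum (jackson (n + 1)) (jacksonOdd (n + 1)) S α b
          (s₀ + ((t - s₀) - round (t - s₀))) := by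
      have := TrigPoly_periodic (interp_mem (n := n) S α b) (s₀ + ((t - s₀) - round (t - s₀)))
        (round (t - s₀))
      rw [← this]; congr 1; ring
    have hw0 := hwS s₀ hs₀
    set τ := (t - s₀) - round (t - s₀) with hτ
    have habs : circ (t - s₀) = |τ| := rfl
    rw [habs] at hlt hw0
    have hcirc : (n + 1 : ℕ) * circ (s₀ + τ - s₀) ≤ (n + 1 : ℕ) * |τ| := by
      rw [add_sub_cancel_left]
      have := circ_le τ 0
      rw [Int.cast_zero, sub_zero] at this
      gcongr
    rw [hper]
    rcases le_or_gt ((n + 1 : ℕ) * |τ|) (1 / 4) with hq | hq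
    · refine (norm_interp_quadratic_le hn hS hs₀ (fun s hs => (hA s hs).trans hA1)
        (fun s hs => (hB s hs).trans hB1) (hv s₀ hs₀) ((h3 s₀ hs₀).trans (by linarith))
        (h s₀ hs₀).1 (h s₀ hs₀).2 hq).trans ?_
      have h5 : (π * (n + 1 : ℕ) * τ) ^ 2 = π ^ 2 * ((n + 1 : ℕ) * |τ|) ^ 2 := by
        rw [mul_pow, mul_pow, mul_pow, sq_abs]; ring
      rw [h5]
      have h6 : (1 : ℝ) ≤ π ^ 2 := one_le_pow₀ (by linarith [pi_gt_three])
      have h7 : (0 : ℝ) ≤ ((n + 1 : ℕ) * |τ|) ^ 2 := sq_nonneg _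
      generalize ((n + 1 : ℕ) * |τ|) ^ 2 = Y at hw0 h7 ⊢
      have h8 : Y ≤ π ^ 2 * Y := le_mul_of_one_le_left h7 h6
      linarith
    · have h96 : ‖kernelSum (jackson (n + 1)) (jacksonOdd (n + 1)) S α b (s₀ + τ)‖ ≤ 0.96 := by
        -- As the point moves off the node, the Jackson kernel falls but the other nodes come
        -- closer. No single pair of bounds covers all of [1/4, 1/2], so the interval is cut at
        -- 0.35.
        rcases le_or_gt ((n + 1 : ℕ) * |τ|) 0.35 with hq2 | hq2
        · have k4 := quarticSum_far
          have k3 := cubicSum_far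
          refine hfin s₀ hs₀ _ 0.65 0.66 (by norm_num) (hcirc.trans (by linarith)) ?_ (by norm_num)
            (by linarith)
          rw [add_sub_cancel_left]
          exact jackson_le_of_quarter hn hlt.le hq.le
        · have k4 := quarticSum_half
          have k3 := cubicSum_half
          refine hfin s₀ hs₀ _ (1 / 2) 0.435 (by norm_num) (hcirc.trans (by linarith)) ?_
            (by norm_num) (by linarith)
          rw [add_sub_cancel_left]
          exact jackson_le_of_third hn hlt.le hq2.le
      linarith
  · push Not at hnear
    have k4 := quarticSum_half
    have k3 := cubicSum_half
    have := norm_interp_le (α := α) (b := b) hn hS (by norm_num : (0 : ℝ) < 1 / 2) hnear hA0 hB0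
      hA hB
    have h5 : A * quarticSum (1 / 2) + B * cubicSum (1 / 2) ≤ 0.96 := by nlinarith
    linarith

end

/-! ### Dilation of the circle: from large N to every cut-off f. -/

section

open Real Finset

variable {S : Finset ℝ} {m f : ℕ}

lemma circ_add_int (x : ℝ) (n : ℤ) : circ (x + n) = circ x := by
  rw [circ, circ, round_add_intCast]
  congr 1; push_cast; ring

/-- Multiplication by `m` on the circle expands distances by a factor of at most `m`. -/
lemma circ_le_mul_circ_div (hm : 0 < m) (x : ℝ) : circ x ≤ m * circ (x / m) := by
  have hm' : (0 : ℝ) < m := by exact_mod_cast hm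
  refine (circ_le x (m * round (x / m))).trans (le_of_eq ?_)
  rw [circ, ← abs_of_pos hm', ← abs_mul, abs_of_pos hm', mul_sub, mul_div_cancel₀ _ hm'.ne']
  push_cast; rfl

/-- The preimage of `S` under multiplication by `m` on the circle. -/
def dilate (m : ℕ) (S : Finset ℝ) : Finset ℝ :=
  (S ×ˢ range m).image fun p => (p.1 + p.2) / m

lemma mem_dilate {s : ℝ} (hs : s ∈ S) {j : ℕ} (hj : j < m) : (s + j) / m ∈ dilate m S :=
  mem_image.2 ⟨(s, j), mem_product.2 ⟨hs, mem_range.2 hj⟩, rfl⟩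

lemma forall_mem_dilate {p : ℝ → Prop} (h : ∀ s ∈ S, ∀ j < m, p ((s + (j : ℕ)) / m)) :
    ∀ s ∈ dilate m S, p s := by
  intro s hs
  obtain ⟨⟨r, j⟩, hr, rfl⟩ := mem_image.1 hs
  rw [mem_product, mem_range] at hr
  exact h r hr.1 j hr.2

lemma circ_le_mul_circ_shift (hm : 0 < m) (t s : ℝ) (i j : ℕ) :
    circ (t - s) ≤ m * circ ((t + i) / m - (s + j) / m) := by
  have h := circ_le_mul_circ_div hm (t - s + ((i - j : ℤ) : ℝ))
  rw [circ_add_int] at h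
  refine h.trans (le_of_eq ?_)
  congr 2; push_cast; ring

/-- Preimages of different nodes inherit the separation divided by `m`. Preimages of one node are
1/m apart, which is where f ≥ 2 is needed. -/
lemma CircSep.dilate (hm : 0 < m) (hf : 2 ≤ f) (hS : CircSep (2 / f) S) :
    CircSep (2 / (m * f)) (dilate m S) := by
  have hm' : (0 : ℝ) < m := by exact_mod_cast hm
  have hf' : (2 : ℝ) ≤ f := by exact_mod_cast hf
  refine forall_mem_dilate fun s hs i hi => forall_mem_dilate fun r hr j hj hne => ?_
  have key : 2 / (f : ℝ) ≤ m * circ ((s + i) / m - (r + j) / m) := by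
    rcases eq_or_ne s r with rfl | hsr
    · have hij : (i : ℤ) - j ≠ 0 := by
        rintro h
        have : i = j := by omega
        exact hne (by rw [this])
      set k := round ((s + i) / m - (s + j) / m) with hk
      have hne0 : ((i : ℤ) - j) - m * k ≠ 0 := by
        intro h
        have hdvd : (m : ℤ) ∣ (i : ℤ) - j := ⟨k, by linarith⟩
        have := Int.eq_zero_of_abs_lt_dvd hdvd (by rw [abs_lt]; omega)
        exact hij this
      have h1 : (1 : ℝ) ≤ |((((i : ℤ) - j) - m * k : ℤ) : ℝ)| := by
        exact_mod_cast Int.one_le_abs hne0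
      have h2 : m * circ ((s + i) / m - (s + j) / m) = |((((i : ℤ) - j) - m * k : ℤ) : ℝ)| := by
        rw [circ, ← hk, ← abs_of_pos hm', ← abs_mul, abs_of_pos hm']
        congr 1; push_cast; field_simp; ring
      rw [h2]
      exact le_trans ((div_le_one (by linarith)).2 hf') h1
    · exact (hS s hs r hr hsr).trans (circ_le_mul_circ_shift hm s r i j)
  rw [mul_comm, ← div_div, div_le_iff₀ hm', mul_comm]
  exact key

lemma CircSep.eq_of_circ_eq_zero {Δ : ℝ} (hΔ : 0 < Δ) (hS : CircSep Δ S) {s r : ℝ} (hs : s ∈ S)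
    (hr : r ∈ S) (h : circ (s - r) = 0) : s = r := by
  by_contra hne
  have := hS s hs r hr hne
  linarith

/-- The value at x is read off from the node congruent to mx modulo 1, unique by separation; hence
the data are constant on the fibres of multiplication by `m`. -/
lemma exists_dilate_data {Δ : ℝ} (hm : 0 < m) (hΔ : 0 < Δ) (hS : CircSep Δ S) (v : ℝ → ℂ) :
    ∃ V : ℝ → ℂ, ∀ s ∈ S, ∀ j : ℕ, V ((s + j) / m) = v s := by
  classical
  have hm' : (m : ℝ) ≠ 0 := by exact_mod_cast hm.ne'
  refine ⟨fun x => ∑ s ∈ S, if circ (m * x - s) = 0 then v s else 0, fun s hs j => ?_⟩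
  have hc : ∀ r, circ (m * ((s + j) / m) - r) = circ (s - r) := fun r => by
    rw [mul_div_cancel₀ _ hm', ← circ_add_int (s - r) j]
    congr 1; push_cast; ring
  simp only [hc]
  rw [sum_eq_single_of_mem s hs, if_pos]
  · simp [circ]
  · intro r hr hne
    exact if_neg fun h => hne (hS.eq_of_circ_eq_zero hΔ hs hr h).symm

/-- The average of `P ((t + j) / m)` over `0 ≤ j < m`. -/
def dilateAverage (m : ℕ) (P : ℝ → ℂ) (t : ℝ) : ℂ := 1 / m * ∑ j ∈ range m, P ((t + j) / m)

lemma norm_dilateAverage_le (hm : 0 < m) {P : ℝ → ℂ} {t M : ℝ}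
    (h : ∀ j < m, ‖P ((t + (j : ℕ)) / m)‖ ≤ M) : ‖dilateAverage m P t‖ ≤ M := by
  have hm' : (0 : ℝ) < m := by exact_mod_cast hm
  rw [dilateAverage, norm_mul, norm_div, norm_one, Complex.norm_natCast, one_div,
    inv_mul_le_iff₀ hm']
  refine (norm_sum_le_of_le _ fun j hj => h j (mem_range.1 hj)).trans ?_
  rw [sum_const, card_range, nsmul_eq_mul]

lemma dilateAverage_eq (hm : 0 < m) {P : ℝ → ℂ} {t : ℝ} {c : ℂ}
    (h : ∀ j < m, P ((t + (j : ℕ)) / m) = c) : dilateAverage m P t = c := by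
  have hm' : (m : ℂ) ≠ 0 := by exact_mod_cast hm.ne'
  rw [dilateAverage, sum_congr rfl fun j hj => h j (mem_range.1 hj), sum_const, card_range,
    nsmul_eq_mul]
  field_simp

lemma hasDerivAt_dilateAverage (hm : 0 < m) {P : ℝ → ℂ} {t : ℝ} {c : ℂ}
    (h : ∀ j < m, HasDerivAt P c ((t + (j : ℕ)) / m)) :
    HasDerivAt (dilateAverage m P) (c / m) t := by
  have hm' : (m : ℂ) ≠ 0 := by exact_mod_cast hm.ne'
  have h1 : ∀ j ∈ range m, HasDerivAt (fun t : ℝ => P ((t + j) / m)) (c / m) t := by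
    intro j hj
    have h2 : HasDerivAt (fun t : ℝ => (t + j) / m) (1 / m) t :=
      ((hasDerivAt_id t).add_const (j : ℝ)).div_const _
    refine ((h j (mem_range.1 hj)).scomp t h2).congr_deriv ?_
    rw [Complex.real_smul]; push_cast; ring
  refine ((HasDerivAt.fun_sum h1).const_mul (1 / m : ℂ)).congr_deriv ?_
  rw [sum_const, card_range, nsmul_eq_mul]
  field_simp

lemma CircSep.subsingleton (hS : CircSep 2 S) {s r : ℝ} (hs : s ∈ S) (hr : r ∈ S) : s = r := by
  by_contra hne
  have := hS s hs r hr hne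
  linarith [circ_le_half (s - r)]

/-- The factor 20000 is even, so mf/2 is an integer N = n + 1 for every f. It is at least 10000, and
2/(mf) is exactly 1/N. -/
lemma exists_dilate_params (hf : 2 ≤ f) : ∃ m n : ℕ, 0 < m ∧ 10000 ≤ n + 1 ∧ 2 * n + 1 ≤ m * f ∧
    m * f = 2 * (n + 1) := by
  refine ⟨20000, 10000 * f - 1, ?_⟩
  omega

/-- The case f = 1: a constant carries the value and a sine carries the derivative. -/
lemma exists_interp_single (s : ℝ) (v β : ℂ) {M : ℝ} (hv : ‖v‖ ≤ M) (hβ : ‖β‖ ≤ M) :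
    ∃ P ∈ TrigPoly 1, (∀ t, ‖P t‖ ≤ 4 * M) ∧ P s = v ∧ HasDerivAt P β s := by
  have hM : 0 ≤ M := (norm_nonneg _).trans hv
  set c : ℂ := β / (4 * π * Complex.I) with hc
  have h0 : (fun t => v * expo 0 (t - s) + c * (expo 1 (t - s) - expo (-1) (t - s))) ∈
      TrigPoly 1 := by
    refine Submodule.add_mem _ ?_ (Submodule.smul_mem _ c (Submodule.sub_mem _ ?_ ?_))
    · exact Submodule.smul_mem _ v (TrigPoly_comp_sub (expo_mem (by simp)) s)
    · exact TrigPoly_comp_sub (expo_mem (by simp)) s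
    · exact TrigPoly_comp_sub (expo_mem (by simp)) s
  have hpi : (π : ℂ) ≠ 0 := by exact_mod_cast pi_ne_zero
  refine ⟨_, h0, fun t => ?_, ?_, ?_⟩
  · have hcn : ‖c‖ ≤ M := by
      rw [hc, norm_div]
      refine (div_le_self (norm_nonneg _) ?_).trans hβ
      rw [norm_mul, norm_mul, Complex.norm_I, Complex.norm_real, norm_of_nonneg pi_pos.le]
      norm_num; linarith [pi_gt_three]
    have h1 := norm_sub_le (expo 1 (t - s)) (expo (-1) (t - s))
    rw [norm_expo, norm_expo] at h1
    refine (norm_add_le _ _).trans ?_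
    rw [norm_mul, norm_mul, norm_expo, mul_one]
    nlinarith [norm_nonneg c, norm_nonneg (expo 1 (t - s) - expo (-1) (t - s))]
  · simp [expo_at_zero]
  · have hd : ∀ k : ℤ, HasDerivAt (fun t => expo k (t - s)) (2 * π * Complex.I * k) s := by
      intro k
      have := hasDerivAt_expo k 0
      rw [expo_at_zero, mul_one, ← sub_self s] at this
      exact this.comp_sub_const s s
    refine (((hd 0).const_mul v).add (((hd 1).sub (hd (-1))).const_mul c)).congr_deriv ?_
    rw [hc]; push_cast; field_simp [Complex.I_ne_zero]; ring

/-- Hermite interpolation of bounded data on a `2/f`-separated set by a bounded trigonometric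
polynomial of degree `f`. -/
theorem exists_hermite (hf : 1 ≤ f) (hS : CircSep (2 / f) S) {v β : ℝ → ℂ} {M : ℝ} (hM : 0 ≤ M)
    (hv : ∀ s ∈ S, ‖v s‖ ≤ M) (hβ : ∀ s ∈ S, ‖β s‖ ≤ f * M) :
    ∃ P ∈ TrigPoly f, (∀ t, ‖P t‖ ≤ 4 * M) ∧ ∀ s ∈ S, P s = v s ∧ HasDerivAt P (β s) s := by
  rcases hf.lt_or_eq with hf2 | rfl
  · obtain ⟨m, n, hm, hn, hdeg, hmn⟩ := exists_dilate_params (f := f) hf2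
    have hf0 : (0 : ℝ) < f := by exact_mod_cast hf
    have hm' : (0 : ℝ) < m := by exact_mod_cast hm
    have hmn' : (m * f : ℝ) = 2 * (n + 1 : ℕ) := by exact_mod_cast hmn
    obtain ⟨V, hV⟩ := exists_dilate_data hm (by positivity) hS v
    -- This scaling makes the derivative prescribed upstairs π(n + 1)·W = mβ, and averaging over the
    -- fibre divides it by `m`. The bound f M on β keeps `W` below M.
    obtain ⟨W, hW⟩ := exists_dilate_data hm (by positivity) hS
      fun s => β s * ((2 / (π * f) : ℝ) : ℂ)
    have hsep : CircSep (1 / (n + 1 : ℕ)) (dilate m S) := by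
      have := hS.dilate hm hf2
      rwa [hmn', div_mul_cancel_left₀ two_ne_zero, ← one_div] at this
    obtain ⟨P, hP, hPM, hPS⟩ := exists_interp hn hsep hM (v := V) (w := W)
      (forall_mem_dilate fun s hs j _ => by rw [hV s hs j]; exact hv s hs)
      (forall_mem_dilate fun s hs j _ => by
        rw [hW s hs j, norm_mul, Complex.norm_real, norm_of_nonneg (by positivity)]
        calc ‖β s‖ * (2 / (π * f)) ≤ f * M * (2 / (π * f)) := by gcongr; exact hβ s hs
          _ = M * (2 / π) := by field_simp
          _ ≤ M * 1 := by
            gcongr; rw [div_le_one pi_pos]; linarith [pi_gt_three]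
          _ = M := mul_one M)
    refine ⟨dilateAverage m P, TrigPoly_average hm (TrigPoly_mono hdeg hP),
      fun t => norm_dilateAverage_le hm fun j _ => hPM _, fun s hs => ⟨?_, ?_⟩⟩
    · exact dilateAverage_eq hm fun j hj => by rw [(hPS _ (mem_dilate hs hj)).1, hV s hs]
    · refine (hasDerivAt_dilateAverage hm (P := P) fun j hj =>
        ((hPS _ (mem_dilate hs hj)).2.congr_deriv (by rw [hW s hs]))).congr_deriv ?_
      have hpi : (π : ℂ) ≠ 0 := by exact_mod_cast pi_ne_zero
      have hfc : (f : ℂ) ≠ 0 := by exact_mod_cast hf0.ne'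
      have hmc : (m : ℂ) ≠ 0 := by exact_mod_cast hm'.ne'
      have hnc : (((n + 1 : ℕ) : ℝ) : ℂ) = m * f / 2 := by
        have : ((n + 1 : ℕ) : ℝ) = m * f / 2 := by linarith
        rw [this]; push_cast; ring
      rw [← Complex.ofReal_natCast (n + 1), hnc]
      push_cast; field_simp
  · rw [Nat.cast_one, div_one] at hS
    rcases S.eq_empty_or_nonempty with rfl | ⟨s, hs⟩
    · exact ⟨0, Submodule.zero_mem _, by simpa using hM, by simp⟩
    · obtain ⟨P, hP, hPM, h1, h2⟩ := exists_interp_single s (v s) (β s) (hv s hs)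
        (by simpa using hβ s hs)
      refine ⟨P, hP, hPM, fun r hr => ?_⟩
      rw [hS.subsingleton hr hs]
      exact ⟨h1, h2⟩

/-- The dual certificate for a `2/f`-separated set: a trigonometric polynomial of degree `f`
interpolating unimodular data, of modulus less than one elsewhere. -/
theorem exists_dual_certificate (hf : 1 ≤ f) (hS : CircSep (2 / f) S) {v : ℝ → ℂ}
    (hv : ∀ s ∈ S, ‖v s‖ = 1) :
    ∃ q ∈ TrigPoly f, (∀ s ∈ S, q s = v s) ∧
      ∀ t w : ℝ, w ≤ 1 → (∀ s ∈ S, w ≤ (f * circ (t - s)) ^ 2) → ‖q t‖ ≤ 1 - 0.01 * w := by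
  rcases hf.lt_or_eq with hf2 | rfl
  · obtain ⟨m, n, hm, hn, hdeg, hmn⟩ := exists_dilate_params (f := f) hf2
    have hf0 : (0 : ℝ) < f := by exact_mod_cast hf
    have hm' : (0 : ℝ) < m := by exact_mod_cast hm
    have hmn' : (m * f : ℝ) = 2 * (n + 1 : ℕ) := by exact_mod_cast hmn
    obtain ⟨V, hV⟩ := exists_dilate_data hm (by positivity) hS v
    have hsep : CircSep (1 / (n + 1 : ℕ)) (dilate m S) := by
      have := hS.dilate hm hf2
      rwa [hmn', div_mul_cancel_left₀ two_ne_zero, ← one_div] at this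
    obtain ⟨P, hP, hPS, hPw⟩ := exists_certificate hn hsep (v := V)
      (forall_mem_dilate fun s hs j _ => by rw [hV s hs j]; exact hv s hs)
    refine ⟨dilateAverage m P, TrigPoly_average hm (TrigPoly_mono hdeg hP), fun s hs =>
      dilateAverage_eq hm fun j hj => by rw [hPS _ (mem_dilate hs hj), hV s hs],
      fun t w hw hwS => norm_dilateAverage_le hm fun i _ => ?_⟩
    -- Here N = mf/2, so squared scaled distances upstairs are at least a quarter of those below;
    -- this turns 0.04 into 0.01.
    refine (hPw _ (w / 4) (by linarith) (forall_mem_dilate fun s hs j _ => ?_)).trans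
      (le_of_eq (by ring))
    have h1 := circ_le_mul_circ_shift hm t s i j
    have h2 : ((n + 1 : ℕ) : ℝ) = f * m / 2 := by linarith
    have h3 : (f * circ (t - s)) ^ 2 ≤ (f * (m * circ ((t + i) / m - (s + j) / m))) ^ 2 := by
      have := circ_nonneg (t - s)
      gcongr
    rw [h2]
    linarith [hwS s hs]
  · rw [Nat.cast_one, div_one] at hS
    rcases S.eq_empty_or_nonempty with rfl | ⟨s, hs⟩
    · exact ⟨0, Submodule.zero_mem _, by simp, fun t w hw _ => by simp; linarith⟩
    -- For a single node, v·cos²(π(t - s)) is an explicit certificate of degree 1.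
    · refine ⟨fun t => v s / 4 * (geomSq 2 (t - s) : ℂ),
        Submodule.smul_mem _ (v s / 4) (TrigPoly_comp_sub (geomSq_mem 1) s), fun r hr => ?_,
        fun t w hw hwS => ?_⟩
      · rw [hS.subsingleton hr hs]
        simp only [sub_self, geomSq_zero]
        push_cast; ring
      · have h1 : geomSq 2 (t - s) / 4 ≤ 1 - 4 * circ (t - s) ^ 2 := by
          have h2 := geomSq_mul_sin 2 (t - s)
          have h3 := two_mul_circ_le_abs_sin (t - s)
          have h4 := pow_le_pow_left₀ (by have := circ_nonneg (t - s); positivity) h3 2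
          rw [sq_abs] at h4
          have h5 : π * (2 : ℕ) * (t - s) = 2 * (π * (t - s)) := by push_cast; ring
          rw [h5, sin_two_mul, mul_pow, mul_pow, cos_sq'] at h2
          rcases eq_or_ne (sin (π * (t - s))) 0 with h0 | h0
          · rw [h0] at h4
            have := geomSq_le 2 (t - s)
            push_cast at this
            nlinarith
          · have h6 : 0 < sin (π * (t - s)) ^ 2 := by positivity
            have h7 : geomSq 2 (t - s) = 4 * (1 - sin (π * (t - s)) ^ 2) := by
              apply mul_right_cancel₀ h6.ne'
              linarith
            linarith
        have h2 := hwS s hs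
        rw [norm_mul, norm_div, hv s hs, Complex.norm_real, norm_of_nonneg (geomSq_nonneg _ _)]
        norm_num at h2 ⊢
        nlinarith [sq_nonneg (circ (t - s))]

end

/-! ### Complex measures: integrals, the certificate inequality and the cone condition. -/

section

open VectorMeasure Finset

section ComplexMeasure

variable {X : Type*} [MeasurableSpace X] {μ ν : ComplexMeasure X} {f g : X → ℂ}

/-- The integral of a complex function against a complex measure. -/
def cint (μ : ComplexMeasure X) (f : X → ℂ) : ℂ :=
  VectorMeasure.integral μ f (ContinuousLinearMap.mul ℝ ℂ)

lemma cint_const_mul (c : ℂ) (f : X → ℂ) : cint μ (fun x => c * f x) = c * cint μ f := by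
  rw [cint, VectorMeasure.integral_eq_setToFun]
  exact setToFun_smul _ (fun c s x => by simp [VectorMeasure.transpose, mul_left_comm]) c f

lemma cint_add (hf : μ.Integrable f) (hg : μ.Integrable g) :
    cint μ (fun x => f x + g x) = cint μ f + cint μ g := integral_fun_add hf hg

lemma cint_sub (hf : μ.Integrable f) (hg : μ.Integrable g) :
    cint μ (fun x => f x - g x) = cint μ f - cint μ g := integral_fun_sub hf hg

lemma cint_sum {ι : Type*} (s : Finset ι) {f : ι → X → ℂ} (hf : ∀ i ∈ s, μ.Integrable (f i)) :
    cint μ (fun x => ∑ i ∈ s, f i x) = ∑ i ∈ s, cint μ (f i) := integral_finsetSum s hf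

lemma norm_cint_le (f : X → ℂ) : ‖cint μ f‖ ≤ ∫ x, ‖f x‖ ∂μ.variation := by
  have h := norm_integral_le_integral_norm (μ := μ) (f := f) (B := ContinuousLinearMap.mul ℝ ℂ)
  rwa [ContinuousLinearMap.opNorm_mul, one_mul] at h

lemma cint_indicator [IsFiniteMeasure μ.variation] {s : Set X} (hs : MeasurableSet s) (c : ℂ) :
    cint μ (s.indicator fun _ => c) = c * μ s := by
  rw [cint, VectorMeasure.integral_eq_setToFun, setToFun_indicator_const _ hs (measure_ne_top _ _)]
  simp [VectorMeasure.transpose, mul_comm]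

lemma cint_sub_vectorMeasure (hμ : μ.Integrable f) (hν : ν.Integrable f) :
    cint (μ - ν) f = cint μ f - cint ν f := integral_sub_vectorMeasure hμ hν

variable [MeasurableSingletonClass X] {T : Finset X}

lemma cint_eq_sum_add [IsFiniteMeasure μ.variation] (T : Finset X) (hf : μ.Integrable f) :
    cint μ f = ∑ t ∈ T, f t * μ {t} + cint μ ((T : Set X)ᶜ.indicator f) := by
  classical
  have hT : MeasurableSet (T : Set X) := T.measurableSet
  have hsplit : f = fun x => (∑ t ∈ T, ({t} : Set X).indicator (fun _ => f t) x) +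
      (T : Set X)ᶜ.indicator f x := by
    ext x
    by_cases hx : x ∈ T
    · rw [Set.indicator_of_notMem (by simpa using hx), add_zero, sum_eq_single_of_mem x hx]
      · simp
      · intro t _ ht
        exact Set.indicator_of_notMem (by simpa using ht.symm) _
    · rw [Set.indicator_of_mem (by simpa using hx), sum_eq_zero, zero_add]
      intro t ht
      exact Set.indicator_of_notMem (by rintro rfl; exact hx ht) _
  have hi : ∀ t ∈ T, μ.Integrable (({t} : Set X).indicator fun _ => f t) := fun t _ =>
    (integrable_const _).indicator (measurableSet_singleton t)
  conv_lhs => rw [hsplit]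
  rw [cint_add (Integrable.fun_finsetSum T hi) (hf.indicator hT.compl), cint_sum T hi]
  congr 1
  exact sum_congr rfl fun t _ => cint_indicator (measurableSet_singleton t) _

/-- If `q` attains the phases of a measure `μ` on a finite set carrying at least half of the
variation, then `∫ (1 - |q|) d|μ|` is controlled by `∫ q dμ`. -/
lemma integral_one_sub_norm_le [IsFiniteMeasure μ.variation] {q : X → ℂ}
    (hq : μ.Integrable q) (hT1 : ∀ t ∈ T, ‖q t‖ = 1) (hTq : ∀ t ∈ T, q t * μ {t} = ‖μ {t}‖)
    (hcone : μ.variation.real (T : Set X)ᶜ ≤ ∑ t ∈ T, ‖μ {t}‖) :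
    ∫ x, (1 - ‖q x‖) ∂μ.variation ≤ ‖cint μ q‖ := by
  have hT : MeasurableSet (T : Set X) := T.measurableSet
  have h1 : ∫ x, (1 - ‖q x‖) ∂μ.variation = ∫ x in (T : Set X)ᶜ, (1 - ‖q x‖) ∂μ.variation := by
    rw [← MeasureTheory.integral_indicator hT.compl]
    congr 1
    ext x
    by_cases hx : x ∈ T
    · rw [Set.indicator_of_notMem (by simpa using hx), hT1 x hx, sub_self]
    · rw [Set.indicator_of_mem (by simpa using hx)]
  have h2 : ∫ x in (T : Set X)ᶜ, (1 - ‖q x‖) ∂μ.variation =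
      μ.variation.real (T : Set X)ᶜ - ∫ x in (T : Set X)ᶜ, ‖q x‖ ∂μ.variation := by
    rw [MeasureTheory.integral_sub (integrable_const _) hq.norm.integrableOn]
    simp [Measure.real]
  have h3 := cint_eq_sum_add T hq
  rw [sum_congr rfl hTq] at h3
  have h4 : ‖cint μ ((T : Set X)ᶜ.indicator q)‖ ≤ ∫ x in (T : Set X)ᶜ, ‖q x‖ ∂μ.variation := by
    refine (norm_cint_le _).trans (le_of_eq ?_)
    rw [← MeasureTheory.integral_indicator hT.compl]
    simp only [norm_indicator_eq_indicator_norm]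
  have h5 : (∑ t ∈ T, ‖μ {t}‖ : ℝ) ≤ ‖cint μ q‖ + ‖cint μ ((T : Set X)ᶜ.indicator q)‖ := by
    -- On `T` the phases of `q` undo those of μ, so the atoms contribute their total mass to ∫ q dμ.
    have h6 : ((∑ t ∈ T, ‖μ {t}‖ : ℝ) : ℂ) = cint μ q - cint μ ((T : Set X)ᶜ.indicator q) := by
      rw [h3]; push_cast; ring
    have h7 : ‖((∑ t ∈ T, ‖μ {t}‖ : ℝ) : ℂ)‖ = ∑ t ∈ T, ‖μ {t}‖ := by
      rw [Complex.norm_real, Real.norm_of_nonneg (sum_nonneg fun t _ => norm_nonneg _)]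
    rw [← h7, h6]
    exact norm_sub_le _ _
  rw [h1, h2]
  linarith

end ComplexMeasure

section Spikes

variable {T : Finset UnitAddCircle} {a : UnitAddCircle → ℂ} {μ : ComplexMeasure UnitAddCircle}

lemma variation_spikes_le : (spikes T a).variation ≤ ∑ t ∈ T, ‖a t‖ₑ • Measure.dirac t := by
  refine (variation_finsetSum_le _ _).trans (le_of_eq (sum_congr rfl fun t _ => variation_dirac))

lemma tvNorm_spikes_le : tvNorm (spikes T a) ≤ ∑ t ∈ T, ‖a t‖ₑ := by
  refine (variation_spikes_le _).trans (le_of_eq ?_)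
  simp

lemma tvNorm_spikes_lt_top : tvNorm (spikes T a) < ⊤ :=
  tvNorm_spikes_le.trans_lt (ENNReal.sum_lt_top.2 fun _ _ => enorm_lt_top)

lemma spikes_apply (E : Set UnitAddCircle) :
    spikes T a E = ∑ t ∈ T, VectorMeasure.dirac t (a t) E := by
  classical
  induction T using Finset.induction_on with
  | empty => simp [spikes]
  | insert t T ht ih =>
    rw [sum_insert ht, ← ih, spikes, spikes, sum_insert ht]; rfl

lemma spikes_apply_of_subset_compl {E : Set UnitAddCircle} (hE : E ⊆ (T : Set UnitAddCircle)ᶜ) :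
    spikes T a E = 0 := by
  rw [spikes_apply]
  exact sum_eq_zero fun t ht => dirac_apply_of_notMem fun h => hE h ht

lemma spikes_apply_singleton {t : UnitAddCircle} (ht : t ∈ T) : spikes T a {t} = a t := by
  rw [spikes_apply, sum_eq_single_of_mem t ht]
  · exact dirac_apply_of_mem (measurableSet_singleton t) rfl
  · intro s _ hs
    exact dirac_apply_of_notMem (by simpa using hs)

/-- If the total variation of `μ` is at most that of a sum of spikes on `T`, the difference has
most of its variation on `T`. -/
lemma variation_compl_le_sum (h : tvNorm μ ≤ tvNorm (spikes T a)) :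
    (μ - spikes T a).variation (T : Set UnitAddCircle)ᶜ ≤
      ∑ t ∈ T, ‖(μ - spikes T a) {t}‖ₑ := by
  have hT : MeasurableSet (T : Set UnitAddCircle) := T.measurableSet
  have h1 : (μ - spikes T a).variation (T : Set UnitAddCircle)ᶜ ≤
      μ.variation (T : Set UnitAddCircle)ᶜ := by
    refine variation_apply_le_of_forall_enorm_le hT.compl fun E _ hE => ?_
    rw [_root_.sub_apply, spikes_apply_of_subset_compl hE, sub_zero]
    exact enorm_measure_le_variation _ _
  have h2 : ∑ t ∈ T, ‖μ {t}‖ₑ ≤ μ.variation (T : Set UnitAddCircle) := by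
    rw [← sum_measure_singleton]
    exact sum_le_sum fun t _ => enorm_measure_le_variation _ _
  have h3 : μ.variation (T : Set UnitAddCircle) + μ.variation (T : Set UnitAddCircle)ᶜ ≤
      ∑ t ∈ T, ‖a t‖ₑ := by
    rw [measure_add_measure_compl hT]
    exact h.trans tvNorm_spikes_le
  have h4 : ∑ t ∈ T, ‖a t‖ₑ ≤ ∑ t ∈ T, ‖μ {t}‖ₑ + ∑ t ∈ T, ‖(μ - spikes T a) {t}‖ₑ := by
    rw [← sum_add_distrib]
    refine sum_le_sum fun t ht => ?_
    rw [_root_.sub_apply, spikes_apply_singleton ht]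
    have : a t = μ {t} - (μ {t} - a t) := by ring
    conv_lhs => rw [this]
    exact enorm_sub_le
  have hfin : μ.variation (T : Set UnitAddCircle) ≠ ⊤ :=
    ((measure_mono (Set.subset_univ _)).trans_lt (h.trans_lt tvNorm_spikes_lt_top)).ne
  -- Cancelling the finite quantity |μ|(T), which dominates ∑ |μ{t}|, leaves the bound on the
  -- complement.
  refine h1.trans ((ENNReal.add_le_add_iff_left hfin).1 (h3.trans (h4.trans ?_)))
  gcongr

end Spikes

end

/-! ### Fourier coefficients of measures, the low-pass filter and Fejér smoothing. -/

section

open Finset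

lemma fourier_coe_eq_expo (k : ℤ) (t : ℝ) : fourier k (t : UnitAddCircle) = expo k t := by
  rw [fourier_coe_apply, expo]; simp

/-- The trigonometric polynomial on the circle with given coefficients. -/
def trigSum (n : ℕ) (c : ℤ → ℂ) (x : UnitAddCircle) : ℂ :=
  ∑ k ∈ Icc (-(n : ℤ)) n, c k * fourier k x

variable {n : ℕ} {c d : ℤ → ℂ}

lemma continuous_trigSum (n : ℕ) (c : ℤ → ℂ) : Continuous (trigSum n c) := by
  unfold trigSum; fun_prop

lemma trigSum_coe_mem (n : ℕ) (c : ℤ → ℂ) : (fun t : ℝ => trigSum n c t) ∈ TrigPoly n := by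
  simpa only [trigSum, fourier_coe_eq_expo] using TrigPoly_of_coeff n c

lemma exists_trigSum_eq {P : ℝ → ℂ} (hP : P ∈ TrigPoly n) :
    ∃ c, ∀ t : ℝ, trigSum n c t = P t := by
  obtain ⟨c, hc⟩ := TrigPoly_coeff hP
  exact ⟨c, fun t => by simp only [hc, trigSum, fourier_coe_eq_expo]⟩

lemma integrable_of_continuous {ρ : Measure UnitAddCircle} [IsFiniteMeasure ρ] {E : Type*}
    [NormedAddCommGroup E] {g : UnitAddCircle → E} (hg : Continuous g) : Integrable g ρ :=
  hg.integrable_of_hasCompactSupport (HasCompactSupport.of_compactSpace g)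

lemma integral_fourier (k : ℤ) :
    ∫ x : UnitAddCircle, fourier k x = if k = 0 then 1 else 0 := by
  rw [← UnitAddCircle.intervalIntegral_preimage 0, zero_add, ← integral_expo]
  simp only [fourier_coe_eq_expo]

lemma integral_fourier_mul_trigSum {k : ℤ} (hk : k ∈ Icc (-(n : ℤ)) n) (d : ℤ → ℂ) :
    ∫ x, fourier k x * trigSum n d x = d (-k) := by
  have h : ∀ x : UnitAddCircle, fourier k x * trigSum n d x =
      ∑ l ∈ Icc (-(n : ℤ)) n, d l * fourier (k + l) x := by
    intro x
    rw [trigSum, mul_sum]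
    exact sum_congr rfl fun l _ => by rw [fourier_add]; ring
  simp only [h]
  rw [integral_finsetSum _ fun l _ => integrable_of_continuous (by fun_prop)]
  simp only [integral_const_mul, integral_fourier]
  rw [mem_Icc] at hk
  rw [sum_eq_single_of_mem (-k) (mem_Icc.2 ⟨by omega, by omega⟩)]
  · simp
  · intro l _ hl
    rw [if_neg (by omega), mul_zero]

lemma sum_Icc_neg {M : Type*} [AddCommMonoid M] (n : ℕ) (φ : ℤ → M) :
    ∑ k ∈ Icc (-(n : ℤ)) n, φ (-k) = ∑ k ∈ Icc (-(n : ℤ)) n, φ k :=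
  sum_nbij' (fun k => -k) (fun k => -k) (fun k hk => by rw [mem_Icc] at *; omega)
    (fun k hk => by rw [mem_Icc] at *; omega) (by simp) (by simp) (by simp)

/-- The Fourier coefficients of a complex measure on the circle. -/
def measureCoeff (μ : ComplexMeasure UnitAddCircle) (k : ℤ) : ℂ := cint μ (fourier (-k))

variable {μ ν : ComplexMeasure UnitAddCircle}

lemma measureCoeff_sub [IsFiniteMeasure μ.variation] [IsFiniteMeasure ν.variation] (k : ℤ) :
    measureCoeff (μ - ν) k = measureCoeff μ k - measureCoeff ν k :=
  cint_sub_vectorMeasure (integrable_of_continuous (map_continuous _))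
    (integrable_of_continuous (map_continuous _))

variable [IsFiniteMeasure μ.variation]

lemma cint_trigSum (n : ℕ) (c : ℤ → ℂ) :
    cint μ (trigSum n c) = ∑ k ∈ Icc (-(n : ℤ)) n, c k * measureCoeff μ (-k) := by
  have h : trigSum n c = fun x => ∑ k ∈ Icc (-(n : ℤ)) n, c k * fourier k x := rfl
  rw [h, cint_sum _ fun k _ => integrable_of_continuous (by fun_prop)]
  simp only [cint_const_mul, measureCoeff, neg_neg]

lemma conv_trigSum (n : ℕ) (c : ℤ → ℂ) :
    conv (trigSum n c) μ = trigSum n fun k => c k * measureCoeff μ k := by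
  ext t
  have h : ∀ τ, trigSum n c (t - τ) = trigSum n (fun k => c (-k) * fourier (-k) t) τ := by
    intro τ
    rw [trigSum, trigSum, ← sum_Icc_neg]
    refine sum_congr rfl fun k _ => ?_
    have h1 : fourier (-k) (t - τ) = fourier (-k) t * fourier k τ := by
      rw [fourier_apply, fourier_apply, fourier_apply, smul_sub, sub_eq_add_neg, ← neg_smul,
        neg_neg, AddCircle.toCircle_add, Circle.coe_mul]
    rw [h1]; ring
  rw [show conv (trigSum n c) μ t = cint μ fun τ => trigSum n c (t - τ) from rfl]
  simp only [h]
  rw [show (fun τ => trigSum n (fun k => c (-k) * fourier (-k) t) τ) =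
    trigSum n (fun k => c (-k) * fourier (-k) t) from rfl, cint_trigSum, trigSum, ← sum_Icc_neg]
  refine sum_congr rfl fun k _ => ?_
  rw [neg_neg]; ring

lemma lowPass_eq_trigSum (f : ℕ) : lowPass f μ = trigSum f (measureCoeff μ) := by
  have h : dirichletKernel f = trigSum f fun _ => 1 := by
    ext t; simp [dirichletKernel, trigSum]
  rw [lowPass, h, conv_trigSum]
  simp

/-- The integral of a trigonometric polynomial of degree `f` against `μ` is controlled by the
low-pass filtered measure. -/
lemma norm_cint_trigSum_le (f : ℕ) {M : ℝ} (hM : ∀ x, ‖trigSum f c x‖ ≤ M) :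
    ‖cint μ (trigSum f c)‖ ≤ M * ∫ x, ‖lowPass f μ x‖ := by
  have hc := continuous_trigSum f (measureCoeff μ)
  -- Both sides involve only the coefficients of μ of order at most `f`, which the filter leaves
  -- unchanged.
  have h : cint μ (trigSum f c) = ∫ x, trigSum f c x * trigSum f (measureCoeff μ) x := by
    have h1 : ∀ x, trigSum f c x * trigSum f (measureCoeff μ) x =
        ∑ k ∈ Icc (-(f : ℤ)) f, c k * (fourier k x * trigSum f (measureCoeff μ) x) := by
      intro x
      rw [trigSum, sum_mul]
      exact sum_congr rfl fun k _ => mul_assoc _ _ _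
    simp only [h1]
    rw [integral_finsetSum _ fun l _ => integrable_of_continuous (by fun_prop), cint_trigSum]
    refine sum_congr rfl fun k hk => ?_
    rw [integral_const_mul, integral_fourier_mul_trigSum hk]
  rw [h, lowPass_eq_trigSum, ← integral_const_mul]
  refine norm_integral_le_of_norm_le (integrable_of_continuous (by fun_prop))
    (Filter.Eventually.of_forall fun x => ?_)
  rw [norm_mul]
  gcongr
  exact hM x

section Fejer

variable (f : ℕ)

lemma fejerKernel_eq_trigSum : fejerKernel f =
    trigSum f fun k => 1 / ((f : ℂ) + 1) * ((f : ℂ) + 1 - ((|k| : ℤ) : ℂ)) := by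
  ext t
  simp only [fejerKernel, trigSum, mul_sum, mul_assoc]

lemma fejerKernel_coe (t : ℝ) :
    fejerKernel f (t : UnitAddCircle) = ((geomSq (f + 1) t / (f + 1) : ℝ) : ℂ) := by
  have h : ∑ k ∈ Icc (-(f : ℤ)) f, ((f : ℂ) + 1 - ((|k| : ℤ) : ℂ)) * expo k t =
      (geomSq (f + 1) t : ℂ) := by
    rw [geomSq_eq_sum, Nat.cast_succ (R := ℂ)]
    refine sum_subset (Icc_subset_Icc (by push_cast; omega) (by push_cast; omega))
      fun k hk hk' => ?_
    have : |k| = f + 1 := by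
      rw [mem_Icc] at hk hk'
      push_cast at hk
      rcases abs_cases k with h | h <;> omega
    rw [this]; push_cast; ring
  simp only [fejerKernel, fourier_coe_eq_expo, h]
  push_cast; ring

lemma norm_fejerKernel (x : UnitAddCircle) : ((‖fejerKernel f x‖ : ℝ) : ℂ) = fejerKernel f x := by
  induction x using QuotientAddGroup.induction_on with | _ t => ?_
  erw [fejerKernel_coe]
  rw [Complex.norm_real, Real.norm_of_nonneg]
  have := geomSq_nonneg (f + 1) t
  positivity

lemma continuous_fejerKernel : Continuous (fejerKernel f) := by
  rw [fejerKernel_eq_trigSum]; exact continuous_trigSum _ _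

lemma integral_norm_fejerKernel : ∫ x, ‖fejerKernel f x‖ = 1 := by
  have h : ((∫ x, ‖fejerKernel f x‖ : ℝ) : ℂ) = 1 := by
    rw [← integral_complex_ofReal]
    simp only [norm_fejerKernel]
    rw [fejerKernel_eq_trigSum]
    have := integral_fourier_mul_trigSum (n := f) (k := 0) (mem_Icc.2 ⟨by omega, by omega⟩)
      fun k => 1 / ((f : ℂ) + 1) * ((f : ℂ) + 1 - ((|k| : ℤ) : ℂ))
    simp only [fourier_zero, one_mul] at this
    rw [this]
    have hf : (f : ℂ) + 1 ≠ 0 := by exact_mod_cast f.succ_ne_zero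
    simp [hf]
  exact_mod_cast h

/-- The `L¹` norm of the Fejér smoothing of `μ` is the integral against `μ` of a trigonometric
polynomial bounded by one. -/
lemma exists_trigSum_cint_eq_integral_norm :
    ∃ c, (∀ x, ‖trigSum f c x‖ ≤ 1) ∧
      cint μ (trigSum f c) = (∫ x, ‖conv (fejerKernel f) μ x‖ : ℝ) := by
  set κ : ℤ → ℂ := fun k => 1 / ((f : ℂ) + 1) * ((f : ℂ) + 1 - ((|k| : ℤ) : ℂ)) with hκ
  set g := conv (fejerKernel f) μ with hg
  have hgt : g = trigSum f fun k => κ k * measureCoeff μ k := by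
    rw [hg, fejerKernel_eq_trigSum, conv_trigSum]
  have hgc : Continuous g := hgt ▸ continuous_trigSum _ _
  -- The conjugate phase of g. Division by zero makes it 0 where g vanishes, so |s| ≤ 1 and g·s =
  -- |g| hold everywhere.
  set s : UnitAddCircle → ℂ := fun x => (starRingEnd ℂ) (g x) / (‖g x‖ : ℂ) with hs
  have hsm : Measurable s :=
    (Complex.continuous_conj.comp hgc).measurable.div
      (Complex.continuous_ofReal.comp hgc.norm).measurable
  have hs1 : ∀ x, ‖s x‖ ≤ 1 := fun x => by
    rw [hs]
    simp only [norm_div, RCLike.norm_conj, Complex.norm_real, norm_norm]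
    exact div_self_le_one _
  have hgs : ∀ x, g x * s x = (‖g x‖ : ℂ) := fun x => by
    rcases eq_or_ne (g x) 0 with h0 | h0
    · simp [h0]
    · have : (‖g x‖ : ℂ) ≠ 0 := by exact_mod_cast norm_ne_zero_iff.2 h0
      simp only [hs]
      rw [mul_div_assoc', Complex.mul_conj, Complex.normSq_eq_norm_sq]
      push_cast
      field_simp
  have hint : ∀ k : ℤ, Integrable fun x : UnitAddCircle => fourier k x * s x := fun k =>
    (integrable_const (1 : ℝ)).mono'
      ((map_continuous _).measurable.mul hsm).aestronglyMeasurable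
      (Filter.Eventually.of_forall fun x => by
        rw [norm_mul, fourier_apply, Circle.norm_coe, one_mul]; exact hs1 x)
  set σ : ℤ → ℂ := fun k => ∫ x : UnitAddCircle, fourier k x * s x with hσ
  have hκn : ∀ k, κ (-k) = κ k := fun k => by simp only [hκ, abs_neg]
  have hsum : ∀ c : ℤ → ℂ, ∫ x, trigSum f c x * s x = ∑ k ∈ Icc (-(f : ℤ)) f, c k * σ k := by
    intro c
    have : ∀ x, trigSum f c x * s x = ∑ k ∈ Icc (-(f : ℤ)) f, c k * (fourier k x * s x) := by
      intro x
      rw [trigSum, sum_mul]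
      exact sum_congr rfl fun k _ => mul_assoc _ _ _
    simp only [this]
    rw [integral_finsetSum _ fun k _ => (hint k).const_mul _]
    simp only [integral_const_mul, hσ]
  -- These are the coefficients of τ ↦ ∫ K(x - τ) s(x) dx, K the Fejér kernel. It is bounded by ‖K‖₁
  -- = 1, and comparing coefficients replaces Fubini in the pairing with μ.
  refine ⟨fun k => κ k * σ (-k), fun τ => ?_, ?_⟩
  · have h1 : trigSum f (fun k => κ k * σ (-k)) τ = ∫ x, fejerKernel f (x - τ) * s x := by
      have h2 : ∀ x, fejerKernel f (x - τ) = trigSum f (fun k => κ k * fourier (-k) τ) x := by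
        intro x
        rw [fejerKernel_eq_trigSum, trigSum, trigSum]
        refine sum_congr rfl fun k _ => ?_
        have h3 : fourier k (x - τ) = fourier k x * fourier (-k) τ := by
          rw [fourier_apply, fourier_apply, fourier_apply, smul_sub, sub_eq_add_neg, ← neg_smul,
            AddCircle.toCircle_add, Circle.coe_mul]
        rw [h3]; ring
      simp only [h2]
      rw [hsum, trigSum, ← sum_Icc_neg]
      refine sum_congr rfl fun k _ => ?_
      rw [hκn, neg_neg]; ring
    rw [h1]
    refine (norm_integral_le_of_norm_le (g := fun x => ‖fejerKernel f (x - τ)‖)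
      (integrable_of_continuous ?_) (Filter.Eventually.of_forall fun x => ?_)).trans (le_of_eq ?_)
    · have := continuous_fejerKernel f
      fun_prop
    · rw [norm_mul]
      exact mul_le_of_le_one_right (norm_nonneg _) (hs1 x)
    · rw [integral_sub_right_eq_self (fun x => ‖fejerKernel f x‖), integral_norm_fejerKernel]
  · rw [cint_trigSum, ← sum_Icc_neg, ← integral_complex_ofReal]
    simp only [← hgs, hκn, neg_neg]
    rw [hgt, hsum]
    exact sum_congr rfl fun k _ => by ring

end Fejer

end

/-! ### Low-degree approximation and the stability estimate. -/

section

open Real Finset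

/-- Taylor estimate for a trigonometric polynomial, from Bernstein's inequality. -/
lemma norm_sub_taylor_le_of_mem_TrigPoly {n : ℕ} {P P' : ℝ → ℂ} (hP : P ∈ TrigPoly n)
    (hd : ∀ t, HasDerivAt P (P' t) t) {M : ℝ} (hM : ∀ t, ‖P t‖ ≤ M) (a τ : ℝ) :
    ‖P (a + τ) - P a - τ * P' a‖ ≤ (4 * π * n) ^ 2 * M * τ ^ 2 := by
  obtain ⟨Q, hQ, hQd⟩ := TrigPoly_hasDerivAt hP
  have hQP : Q = P' := funext fun t => (hQd t).unique (hd t)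
  subst hQP
  obtain ⟨R, hR, hRd⟩ := TrigPoly_hasDerivAt hQ
  have hRM := norm_deriv_le_of_mem_TrigPoly hQ hRd (norm_deriv_le_of_mem_TrigPoly hP hd hM)
  have hM0 : 0 ≤ M := (norm_nonneg _).trans (hM 0)
  have hlin : ∀ θ : ℝ, HasDerivAt (fun θ : ℝ => a + θ * τ) τ θ := fun θ => by
    simpa using ((hasDerivAt_id θ).mul_const τ).const_add a
  have h := norm_sub_sub_le_of_deriv2 (g := fun θ => P (a + θ * τ))
    (g₁ := fun θ => τ * Q (a + θ * τ)) (g₂ := fun θ => (τ : ℂ) ^ 2 * R (a + θ * τ))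
    (M := τ ^ 2 * (4 * π * n * (4 * π * n * M)))
    (fun θ _ => ((hd _).scomp θ (hlin θ)).congr_deriv (by rw [Complex.real_smul]))
    (fun θ _ => (((hRd _).scomp θ (hlin θ)).const_mul (τ : ℂ)).congr_deriv (by
      rw [Complex.real_smul]; ring))
    (fun θ _ => by
      rw [norm_mul, norm_pow, Complex.norm_real, norm_eq_abs, sq_abs]
      gcongr
      exact hRM _)
  simp only [one_mul, zero_mul, add_zero] at h
  refine h.trans ?_
  have : 0 ≤ (4 * π * n) ^ 2 * M * τ ^ 2 := by positivity
  linarith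

/-- The two polynomials share value and derivative at `s`, so only their second-order Taylor
remainders survive; periodicity reduces t - s to its representative nearest 0. -/
lemma norm_sub_le_of_hermite {f F : ℕ} {G G' p : ℝ → ℂ} {M : ℝ} (hG : G ∈ TrigPoly F)
    (hGd : ∀ t, HasDerivAt G (G' t) t) (hG1 : ∀ t, ‖G t‖ ≤ 1) (hp : p ∈ TrigPoly f)
    (hpM : ∀ t, ‖p t‖ ≤ M) {s : ℝ} (h0 : p s = G s) (h1 : HasDerivAt p (G' s) s) (t : ℝ) :
    ‖G t - p t‖ ≤ ((4 * π * F) ^ 2 + (4 * π * f) ^ 2 * M) * circ (t - s) ^ 2 := by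
  obtain ⟨p', -, hpd⟩ := TrigPoly_hasDerivAt hp
  have hp' : p' s = G' s := (hpd s).unique h1
  set τ := (t - s) - round (t - s) with hτ
  have ht : t = (s + τ) + (round (t - s) : ℤ) := by rw [hτ]; ring
  have hGt : G t = G (s + τ) := by
    conv_lhs => rw [ht]
    exact TrigPoly_periodic hG _ _
  have hpt : p t = p (s + τ) := by
    conv_lhs => rw [ht]
    exact TrigPoly_periodic hp _ _
  have e1 := norm_sub_taylor_le_of_mem_TrigPoly hG hGd hG1 s τ
  have e2 := norm_sub_taylor_le_of_mem_TrigPoly hp hpd hpM s τ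
  have hc : circ (t - s) ^ 2 = τ ^ 2 := by rw [circ, sq_abs]
  rw [hGt, hpt, hc]
  have : G (s + τ) - p (s + τ) =
      (G (s + τ) - G s - τ * G' s) - (p (s + τ) - p s - τ * p' s) := by rw [h0, hp']; ring
  rw [this]
  refine (norm_sub_le _ _).trans ((add_le_add e1 e2).trans (le_of_eq ?_))
  ring

/-- A trigonometric polynomial of high degree is approximated by one of low degree, with an error
controlled by the defect of the dual certificate. -/
lemma exists_lowDegree_approx {f F : ℕ} (hf : 1 ≤ f) (hfF : f < F) {S : Finset ℝ}
    (hS : CircSep (2 / f) S) {G : ℝ → ℂ} (hG : G ∈ TrigPoly F) (hG1 : ∀ t, ‖G t‖ ≤ 1)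
    {q : ℝ → ℂ} (hq : ∀ t w : ℝ, w ≤ 1 → (∀ s ∈ S, w ≤ (f * circ (t - s)) ^ 2) →
      ‖q t‖ ≤ 1 - 0.01 * w) :
    ∃ p ∈ TrigPoly f, (∀ t, ‖p t‖ ≤ 16 * π * (F / f)) ∧
      ∀ t, ‖G t - p t‖ ≤ 100000000 * (F / f : ℝ) ^ 2 * (1 - ‖q t‖) := by
  have hf0 : (0 : ℝ) < f := by exact_mod_cast hf
  have hF0 : (0 : ℝ) ≤ F := Nat.cast_nonneg F
  set R : ℝ := F / f with hR
  have hFR : (F : ℝ) = f * R := by rw [hR]; field_simp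
  have hR1 : 1 ≤ R := by rw [hR, one_le_div hf0]; exact_mod_cast hfF.le
  have hpi := pi_gt_three
  have hpi' := pi_lt_four
  obtain ⟨G', -, hGd⟩ := TrigPoly_hasDerivAt hG
  have hG'b := norm_deriv_le_of_mem_TrigPoly hG hGd hG1
  -- Bernstein gives |G'| ≤ 4πF = f · 4πR, so M = 4πR bounds both the values and the rescaled
  -- derivatives.
  obtain ⟨p, hp, hpM, hpS⟩ := exists_hermite hf hS (v := G) (β := G') (M := 4 * π * R)
    (by positivity) (fun s _ => (hG1 s).trans (by nlinarith))
    (fun s _ => (hG'b s).trans (le_of_eq (by rw [hFR]; ring)))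
  have hpM' : ∀ t, ‖p t‖ ≤ 16 * π * R := fun t => (hpM t).trans (le_of_eq (by ring))
  refine ⟨p, hp, hpM', fun t => ?_⟩
  -- The weight is min(1, (f · distance to the nearest node)²), and 1 when there is no node. The
  -- trivial bound on |G - p| serves far away, the Hermite estimate close by.
  have hmin : ∃ w : ℝ, w ≤ 1 ∧ (∀ s ∈ S, w ≤ (f * circ (t - s)) ^ 2) ∧
      ‖G t - p t‖ ≤ 1000000 * R ^ 2 * w := by
    have hone : ‖G t - p t‖ ≤ 1000000 * R ^ 2 * 1 := by
      refine (norm_sub_le _ _).trans ((add_le_add (hG1 t) (hpM' t)).trans ?_)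
      nlinarith
    rcases S.eq_empty_or_nonempty with rfl | hne
    · exact ⟨1, le_rfl, by simp, hone⟩
    · obtain ⟨s, hs, hmin⟩ := S.exists_min_image (fun s => circ (t - s)) hne
      refine ⟨min 1 ((f * circ (t - s)) ^ 2), min_le_left _ _, fun r hr => ?_, ?_⟩
      · refine (min_le_right _ _).trans ?_
        have := circ_nonneg (t - s)
        have := hmin r hr
        gcongr
      · rcases min_cases 1 ((f * circ (t - s)) ^ 2) with ⟨h, -⟩ | ⟨h, -⟩
        · rw [h]; exact hone
        · rw [h]
          refine (norm_sub_le_of_hermite hG hGd hG1 hp hpM' (hpS s hs).1 (hpS s hs).2 t).trans ?_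
          rw [hFR, mul_pow (f : ℝ)]
          have hX : 0 ≤ (f : ℝ) ^ 2 * circ (t - s) ^ 2 := by positivity
          have hc : (4 * π) ^ 2 * R ^ 2 + (4 * π) ^ 2 * (16 * π * R) ≤ 1000000 * R ^ 2 := by
            have h1 : (4 * π) ^ 2 ≤ 256 := by nlinarith
            have h2 : 16 * π * R ≤ 64 * R ^ 2 := by nlinarith
            have h3 : 0 ≤ 16 * π * R := by positivity
            nlinarith [sq_nonneg R]
          calc _ = ((4 * π) ^ 2 * R ^ 2 + (4 * π) ^ 2 * (16 * π * R)) *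
                ((f : ℝ) ^ 2 * circ (t - s) ^ 2) := by ring
            _ ≤ _ := mul_le_mul_of_nonneg_right hc hX
  obtain ⟨w, hw1, hwS, hw⟩ := hmin
  have h1 := hq t w hw1 hwS
  have h2 : (1000000 : ℝ) * R ^ 2 * w ≤ 1000000 * R ^ 2 * (100 * (1 - ‖q t‖)) := by
    gcongr
    linarith
  linarith

/-- Passes to one real representative of each point; the circle distance of two points is `circ` of
the difference of their representatives. -/
lemma exists_lift (T : Finset UnitAddCircle) {Δ : ℝ}
    (h : ENNReal.ofReal Δ ≤ (T : Set UnitAddCircle).einfsep) :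
    ∃ S : Finset ℝ, CircSep Δ S ∧ (∀ s ∈ S, (s : UnitAddCircle) ∈ T) ∧
      ∀ x ∈ T, ∃ s ∈ S, (s : UnitAddCircle) = x := by
  classical
  have hlift : ∀ x : UnitAddCircle, ∃ t : ℝ, (t : UnitAddCircle) = x := fun x =>
    QuotientAddGroup.mk_surjective x
  choose σ hσ using hlift
  refine ⟨T.image σ, ?_, ?_, fun x hx => ⟨_, mem_image_of_mem _ hx, hσ x⟩⟩
  · intro s hs r hr hne
    obtain ⟨x, hx, rfl⟩ := mem_image.1 hs
    obtain ⟨y, hy, rfl⟩ := mem_image.1 hr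
    have hxy : x ≠ y := by rintro rfl; exact hne rfl
    have h1 := Set.le_edist_of_le_einfsep (mem_coe.2 hx) (mem_coe.2 hy) hxy h
    rw [edist_dist, ENNReal.ofReal_le_ofReal_iff dist_nonneg, dist_eq_norm] at h1
    refine h1.trans (le_of_eq ?_)
    have h2 : x - y = ((σ x - σ y : ℝ) : UnitAddCircle) := by
      rw [QuotientAddGroup.mk_sub, hσ, hσ]
    rw [h2, UnitAddCircle.norm_eq, circ]
  · intro s hs
    obtain ⟨x, hx, rfl⟩ := mem_image.1 hs
    rwa [hσ]

/-- Stability of the measures whose variation is concentrated on a separated set, in terms of their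
low-pass filtrations. -/
theorem integral_norm_conv_fejerKernel_le {f F : ℕ} (hf : 1 ≤ f) (hfF : f < F)
    {T : Finset UnitAddCircle}
    (hT : ENNReal.ofReal (2 / (f : ℝ)) ≤ (T : Set UnitAddCircle).einfsep)
    {μ : ComplexMeasure UnitAddCircle} [IsFiniteMeasure μ.variation]
    (hcone : μ.variation.real (T : Set UnitAddCircle)ᶜ ≤ ∑ t ∈ T, ‖μ {t}‖) :
    ∫ x, ‖conv (fejerKernel F) μ x‖ ≤
      200000000 * (F / f : ℝ) ^ 2 * ∫ x, ‖lowPass f μ x‖ := by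
  obtain ⟨S, hS, hST, hTS⟩ := exists_lift T hT
  have hf0 : (0 : ℝ) < f := by exact_mod_cast hf
  have hR1 : 1 ≤ (F / f : ℝ) := by rw [one_le_div hf0]; exact_mod_cast hfF.le
  -- The certificate needs unimodular data, hence the value 1 at points without mass.
  set v : UnitAddCircle → ℂ := fun x =>
    if μ {x} = 0 then 1 else (starRingEnd ℂ) (μ {x}) / (‖μ {x}‖ : ℂ) with hv
  have hv1 : ∀ x, ‖v x‖ = 1 := fun x => by
    simp only [hv]
    split_ifs with h
    · exact norm_one
    · rw [norm_div, RCLike.norm_conj, Complex.norm_real, norm_norm,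
        div_self (norm_ne_zero_iff.2 h)]
  have hvμ : ∀ x, v x * μ {x} = (‖μ {x}‖ : ℂ) := fun x => by
    simp only [hv]
    split_ifs with h
    · simp [h]
    · have : (‖μ {x}‖ : ℂ) ≠ 0 := by exact_mod_cast norm_ne_zero_iff.2 h
      rw [div_mul_eq_mul_div, mul_comm, Complex.mul_conj, Complex.normSq_eq_norm_sq]
      push_cast
      field_simp
  obtain ⟨q, hq, hqS, hqw⟩ := exists_dual_certificate hf hS (v := fun s => v s) fun s _ => hv1 _
  obtain ⟨cq, hcq⟩ := exists_trigSum_eq hq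
  have hq1 : ∀ x, ‖trigSum f cq x‖ ≤ 1 := fun x => by
    induction x using QuotientAddGroup.induction_on with | _ t => ?_
    have := hqw t 0 zero_le_one fun s _ => sq_nonneg _
    erw [hcq]
    linarith
  have hqT : ∀ x ∈ T, trigSum f cq x = v x := fun x hx => by
    obtain ⟨s, hs, rfl⟩ := hTS x hx
    rw [hcq, hqS s hs]
  have hdef : ∫ x, (1 - ‖trigSum f cq x‖) ∂μ.variation ≤ ∫ x, ‖lowPass f μ x‖ := by
    refine (integral_one_sub_norm_le (integrable_of_continuous (continuous_trigSum _ _))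
      (fun x hx => ?_) (fun x hx => ?_) hcone).trans ?_
    · rw [hqT x hx, hv1]
    · rw [hqT x hx, hvμ]
    · simpa using norm_cint_trigSum_le (μ := μ) f hq1
  obtain ⟨cG, hG1, hGint⟩ := exists_trigSum_cint_eq_integral_norm (μ := μ) F
  obtain ⟨p, hp, hpM, hGp⟩ := exists_lowDegree_approx hf hfF hS (trigSum_coe_mem F cG)
    (fun t => hG1 t) hqw
  obtain ⟨cp, hcp⟩ := exists_trigSum_eq hp
  have hGc := continuous_trigSum F cG
  have hpc := continuous_trigSum f cp
  have hqc := continuous_trigSum f cq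
  have hpM' : ∀ x, ‖trigSum f cp x‖ ≤ 16 * π * (F / f) := fun x => by
    induction x using QuotientAddGroup.induction_on with | _ t => ?_
    erw [hcp]
    exact hpM t
  have hpint := norm_cint_trigSum_le (μ := μ) f hpM'
  -- The pointwise bound |G - p| ≤ C R² (1 - |q|) is integrated against the variation of μ, where
  -- the defect of the certificate is already controlled.
  have hdiff : ‖cint μ fun x => trigSum F cG x - trigSum f cp x‖ ≤
      100000000 * (F / f : ℝ) ^ 2 * ∫ x, ‖lowPass f μ x‖ := by
    refine (norm_cint_le _).trans ?_
    refine (integral_mono (g := fun x => 100000000 * (F / f : ℝ) ^ 2 * (1 - ‖trigSum f cq x‖))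
      (integrable_of_continuous (by fun_prop)) (integrable_of_continuous (by fun_prop))
      fun x => ?_).trans ?_
    · induction x using QuotientAddGroup.induction_on with | _ t => ?_
      have := hGp t
      rw [← hcp, ← hcq] at this
      exact this
    · rw [integral_const_mul]
      gcongr
  rw [cint_sub (integrable_of_continuous hGc) (integrable_of_continuous hpc)] at hdiff
  have hnorm : ‖cint μ (trigSum F cG)‖ = ∫ x, ‖conv (fejerKernel F) μ x‖ := by
    rw [hGint, Complex.norm_real, norm_of_nonneg (integral_nonneg fun x => norm_nonneg _)]
  rw [← hnorm]
  have h1 : ‖cint μ (trigSum F cG)‖ ≤ ‖cint μ (trigSum F cG) - cint μ (trigSum f cp)‖ +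
      ‖cint μ (trigSum f cp)‖ := by
    simpa using norm_add_le (cint μ (trigSum F cG) - cint μ (trigSum f cp))
      (cint μ (trigSum f cp))
  have hL : 0 ≤ ∫ x, ‖lowPass f μ x‖ := integral_nonneg fun x => norm_nonneg _
  -- Since R ≥ 1, the linear bound on p is absorbed into the quadratic one.
  have h2 : 16 * π * (F / f : ℝ) ≤ 100000000 * (F / f : ℝ) ^ 2 := by
    nlinarith [pi_lt_four]
  have h3 := mul_le_mul_of_nonneg_right h2 hL
  linarith

lemma l1Norm_eq_ofReal {g : UnitAddCircle → ℂ} (hg : Continuous g) :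
    l1Norm g = ENNReal.ofReal (∫ x, ‖g x‖) := by
  rw [l1Norm, eLpNorm_one_eq_lintegral_enorm,
    ofReal_integral_norm_eq_lintegral_enorm (integrable_of_continuous hg)]

lemma spikes_mem_feasibleSet {f : ℕ} {T : Finset UnitAddCircle} {a z y : UnitAddCircle → ℂ} {δ : ℝ}
    (hz : l1Norm z ≤ ENNReal.ofReal δ) (hy : ∀ t, y t = lowPass f (spikes T a) t + z t) :
    spikes T a ∈ feasibleSet f y δ := by
  have : (fun t => lowPass f (spikes T a) t - y t) = -z := by
    ext t; simp [hy]
  rw [feasibleSet, Set.mem_ofPred_eq, this, l1Norm, eLpNorm_neg]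
  exact hz

end

end SuperRes

end

theorem theorem1 :
    ∃ C₀ : ℝ, 0 < C₀ ∧
      ∀ (fLo fHi : ℕ), 1 ≤ fLo → fLo < fHi →
      ∀ (T : Finset UnitAddCircle) (a : UnitAddCircle → ℂ), (∀ t ∈ T, a t ≠ 0) →
        ENNReal.ofReal (2 / (fLo : ℝ)) ≤ (T : Set UnitAddCircle).einfsep →
      ∀ (δ : ℝ) (z y : UnitAddCircle → ℂ), 0 ≤ δ →
        MeasureTheory.MemLp z 1 MeasureTheory.volume →
        SuperRes.l1Norm z ≤ ENNReal.ofReal δ →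
        (∀ t, y t = SuperRes.lowPass fLo (SuperRes.spikes T a) t + z t) →
      ∀ xEst : MeasureTheory.ComplexMeasure UnitAddCircle,
        (SuperRes.IsSolution fLo y δ xEst ∨
          (xEst ∈ SuperRes.feasibleSet fLo y δ ∧
            SuperRes.tvNorm xEst ≤ SuperRes.tvNorm (SuperRes.spikes T a))) →
        SuperRes.l1Norm
            (SuperRes.conv (SuperRes.fejerKernel fHi) (xEst - SuperRes.spikes T a)) ≤
          ENNReal.ofReal (C₀ * ((fHi : ℝ) / (fLo : ℝ)) ^ 2 * δ) := by
  refine ⟨400000000, by norm_num, ?_⟩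
  intro f F hf hfF T a _ hT δ z y hδ hz hzδ hy xEst hx
  have hfeas : xEst ∈ SuperRes.feasibleSet f y δ := hx.elim (fun h => h.1) fun h => h.1
  -- The true measure is itself feasible, so a minimizer has no larger total variation.
  have htv : SuperRes.tvNorm xEst ≤ SuperRes.tvNorm (SuperRes.spikes T a) :=
    hx.elim (fun h => h.2 (SuperRes.spikes_mem_feasibleSet hzδ hy)) fun h => h.2
  set x := SuperRes.spikes T a with hxdef
  have hfin1 : IsFiniteMeasure x.variation := ⟨SuperRes.tvNorm_spikes_lt_top⟩
  have hfin2 : IsFiniteMeasure xEst.variation := ⟨htv.trans_lt SuperRes.tvNorm_spikes_lt_top⟩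
  have hfin3 : IsFiniteMeasure (xEst - x).variation :=
    isFiniteMeasure_of_le _ VectorMeasure.variation_sub_le
  have hcone : (xEst - x).variation.real (T : Set UnitAddCircle)ᶜ ≤
      ∑ t ∈ T, ‖(xEst - x) {t}‖ := by
    refine ENNReal.toReal_le_of_le_ofReal (Finset.sum_nonneg fun t _ => norm_nonneg _) ?_
    rw [ENNReal.ofReal_sum_of_nonneg fun t _ => norm_nonneg _]
    simp only [ofReal_norm]
    exact SuperRes.variation_compl_le_sum htv
  have hlow : ∀ t, SuperRes.lowPass f (xEst - x) t =
      (SuperRes.lowPass f xEst t - y t) + z t := by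
    intro t
    rw [hy, SuperRes.lowPass_eq_trigSum, SuperRes.lowPass_eq_trigSum, SuperRes.lowPass_eq_trigSum]
    simp only [SuperRes.trigSum, SuperRes.measureCoeff_sub, sub_mul, Finset.sum_sub_distrib]
    ring
  have hcont : Continuous (SuperRes.lowPass f (xEst - x)) := by
    rw [SuperRes.lowPass_eq_trigSum]; exact SuperRes.continuous_trigSum _ _
  have hlow1 : ∫ t, ‖SuperRes.lowPass f (xEst - x) t‖ ≤ 2 * δ := by
    rw [← ENNReal.ofReal_le_ofReal_iff (by positivity), ← SuperRes.l1Norm_eq_ofReal hcont,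
      two_mul, ENNReal.ofReal_add hδ hδ]
    have h1 : SuperRes.lowPass f (xEst - x) = (fun t => SuperRes.lowPass f xEst t - y t) + z :=
      funext hlow
    have h2 : (fun t => SuperRes.lowPass f xEst t - y t) = SuperRes.lowPass f (xEst - x) - z := by
      rw [h1, add_sub_cancel_right]
    -- The residual is a continuous function minus `z`; the triangle inequality in L¹ requires its
    -- measurability.
    have h3 : AEStronglyMeasurable (fun t => SuperRes.lowPass f xEst t - y t) volume := by
      rw [h2]; exact hcont.aestronglyMeasurable.sub hz.1
    rw [h1]
    exact (eLpNorm_add_le h3 hz.1 le_rfl).trans (add_le_add hfeas hzδ)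
  have hcontF : Continuous (SuperRes.conv (SuperRes.fejerKernel F) (xEst - x)) := by
    rw [SuperRes.fejerKernel_eq_trigSum, SuperRes.conv_trigSum]
    exact SuperRes.continuous_trigSum _ _
  rw [SuperRes.l1Norm_eq_ofReal hcontF]
  refine ENNReal.ofReal_le_ofReal
    ((SuperRes.integral_norm_conv_fejerKernel_le hf hfF hT hcone).trans ?_)
  calc _ ≤ 200000000 * ((F : ℝ) / f) ^ 2 * (2 * δ) := by gcongr
    _ = _ := by ring
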